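/- Let $M$ be a compact connected complex surface, let $\mathcal{X}$ be a complex manifold with $\dim_{\mathbb C}\mathcal{X}=2+n$, $n\ge 1$, and let $\pi:\mathcal{X}\to M$ be a holomorphic fibration, that is, a proper surjective holomorphic map whose differential has maximal rank everywhere. Let $L$ be an ample holomorphic line bundle over $\mathcal{X}$, that is, $L$ carries a smooth Hermitian metric of positive curvature. A smooth Hermitian metric on $L$ is written $\phi$, where $|s|^2=e^{-\phi}$ for a local holomorphic frame $s$; its curvature is the real $(1,1)$-form $\sqrt{-1}\partial\bar\partial\phi$. Let $\omega=\sqrt{-1}\,g_{\alpha\bar\beta}\,dz^\alpha\wedge d\bar z^\beta$ be a Kähler form on $M$. Suppose that $L$ admits a geodesic-Einstein metric with respect to $\omega$: a smooth metric $\phi$ whose curvature is positive on every fibre of $\pi$ and for which there is a constant $\lambda$ such that $$g^{\alpha\bar\beta}\left(\phi_{\alpha\bar\beta}-\phi_{\alpha\bar j}\,\phi^{i\bar j}\,\phi_{i\bar\beta}\right)=\lambda$$ in all local holomorphic coordinates $(z;v)=(z^1,z^2;v^1,\dots,v^n)$ of $\mathcal{X}$ with $\pi(z;v)=z$. Here Greek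 indices are derivatives in $z$, Latin indices are derivatives in $v$, and $(\phi^{i\bar j})$ is the inverse of $(\phi_{i\bar j})$. For $0\le i\le 2$ let $S_i(L)=\pi_*\left(c_1(L)^{n+i}\right)\in H^{2i}(M,\mathbb R)$; it is represented, for every smooth metric $\psi$ on $L$, by the form $\int_{\mathcal{X}/M}\left(\frac{\sqrt{-1}}{2\pi}\partial\bar\partial\psi\right)^{n+i}$. Let $C_0(L)+C_1(L)+C_2(L)$, with $C_i(L)\in H^{2i}(M,\mathbb R)$, be the inverse of $S_0(L)+S_1(L)+S_2(L)$, so that $$C_2(L)=\frac{S_1(L)^2-S_0(L)S_2(L)}{S_0(L)^3}.$$ Then $$\int_M C_2(L)>0 .$$ -/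

import Mathlib

open scoped Manifold ContDiff Topology

namespace GeodesicEinstein

noncomputable section

/-- The model space `ℂ^d`. Its Lebesgue measure `volume` is the product one, for which the real
parallelepiped spanned by `e_1, i e_1, …, e_d, i e_d` has measure one. -/
abbrev CVec (d : ℕ) : Type := Fin d → ℂ

/-! ### Alternating forms on a vector space -/

section Linear

variable {E : Type*} [NormedAddCommGroup E] [NormedSpace ℝ E]

/-- The `(k+l)`-linear form `v ↦ a (v_1, …, v_k) * b (v_{k+1}, …, v_{k+l})`. -/
def tensorForm {k l : ℕ} (a : E [⋀^Fin k]→L[ℝ] ℝ) (b : E [⋀^Fin l]→L[ℝ] ℝ) :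
    ContinuousMultilinearMap ℝ (fun _ : Fin (k + l) => E) ℝ where
  toFun v := a (fun i => v (Fin.castAdd l i)) * b (fun j => v (Fin.natAdd k j))
  map_update_add' := by
    intro inst v i x y
    obtain rfl : inst = instDecidableEqFin _ := Subsingleton.elim _ _
    refine Fin.addCases (fun i => ?_) (fun j => ?_) i
    · have h1 : ∀ z : E, (fun p : Fin k => Function.update v (Fin.castAdd l i) z (Fin.castAdd l p))
          = Function.update (fun p : Fin k => v (Fin.castAdd l p)) i z := fun z =>
        Function.update_comp_eq_of_injective v (Fin.castAdd_injective k l) i z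
      have h2 : ∀ z : E, (fun p : Fin l => Function.update v (Fin.castAdd l i) z (Fin.natAdd k p))
          = (fun p : Fin l => v (Fin.natAdd k p)) := fun z => by
        funext p
        exact Function.update_of_ne (by simp [Fin.ext_iff]; omega) _ _
      simp only [h1, h2, ContinuousAlternatingMap.map_update_add, add_mul]
    · have h1 : ∀ z : E, (fun p : Fin l => Function.update v (Fin.natAdd k j) z (Fin.natAdd k p))
          = Function.update (fun p : Fin l => v (Fin.natAdd k p)) j z := fun z =>
        Function.update_comp_eq_of_injective v (Fin.natAdd_injective l k) j z
      have h2 : ∀ z : E, (fun p : Fin k => Function.update v (Fin.natAdd k j) z (Fin.castAdd l p))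
          = (fun p : Fin k => v (Fin.castAdd l p)) := fun z => by
        funext p
        exact Function.update_of_ne (by simp [Fin.ext_iff]; omega) _ _
      simp only [h1, h2, ContinuousAlternatingMap.map_update_add, mul_add]
  map_update_smul' := by
    intro inst v i c x
    obtain rfl : inst = instDecidableEqFin _ := Subsingleton.elim _ _
    refine Fin.addCases (fun i => ?_) (fun j => ?_) i
    · have h1 : ∀ z : E, (fun p : Fin k => Function.update v (Fin.castAdd l i) z (Fin.castAdd l p))
          = Function.update (fun p : Fin k => v (Fin.castAdd l p)) i z := fun z =>
        Function.update_comp_eq_of_injective v (Fin.castAdd_injective k l) i z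
      have h2 : ∀ z : E, (fun p : Fin l => Function.update v (Fin.castAdd l i) z (Fin.natAdd k p))
          = (fun p : Fin l => v (Fin.natAdd k p)) := fun z => by
        funext p
        exact Function.update_of_ne (by simp [Fin.ext_iff]; omega) _ _
      simp only [h1, h2, ContinuousAlternatingMap.map_update_smul, smul_eq_mul, mul_assoc]
    · have h1 : ∀ z : E, (fun p : Fin l => Function.update v (Fin.natAdd k j) z (Fin.natAdd k p))
          = Function.update (fun p : Fin l => v (Fin.natAdd k p)) j z := fun z =>
        Function.update_comp_eq_of_injective v (Fin.natAdd_injective l k) j z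
      have h2 : ∀ z : E, (fun p : Fin k => Function.update v (Fin.natAdd k j) z (Fin.castAdd l p))
          = (fun p : Fin k => v (Fin.castAdd l p)) := fun z => by
        funext p
        exact Function.update_of_ne (by simp [Fin.ext_iff]; omega) _ _
      simp only [h1, h2, ContinuousAlternatingMap.map_update_smul, smul_eq_mul]
      ring
  cont := by fun_prop

/-- The wedge product `a ∧ b = (1 / (k! l!)) ∑_σ sgn σ · (a ⊗ b) ∘ σ`, so that
`(a ∧ b)(u, v) = a u * b v - a v * b u` for one-forms. -/
def wedge {k l : ℕ} (a : E [⋀^Fin k]→L[ℝ] ℝ) (b : E [⋀^Fin l]→L[ℝ] ℝ) :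
    E [⋀^Fin (k + l)]→L[ℝ] ℝ :=
  ((k.factorial * l.factorial : ℝ)⁻¹) •
    ContinuousMultilinearMap.alternatization (tensorForm a b)

/-- The `p`-fold wedge power of a two-form. -/
def wedgePow (a : E [⋀^Fin 2]→L[ℝ] ℝ) : (p : ℕ) → E [⋀^Fin (2 * p)]→L[ℝ] ℝ
  | 0 => ContinuousAlternatingMap.constOfIsEmpty ℝ E (Fin 0) 1
  | p + 1 => wedge (wedgePow a p) a

/-- A form of degree `p` seen as a form of degree `q`, when `p = q`. -/
def castDegree {p q : ℕ} (h : p = q) (a : E [⋀^Fin p]→L[ℝ] ℝ) : E [⋀^Fin q]→L[ℝ] ℝ :=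
  { a.toContinuousMultilinearMap.domDomCongr (finCongr h) with
    map_eq_zero_of_eq' := fun v i j hv hij =>
      a.map_eq_zero_of_eq (fun k => v (finCongr h k)) (i := (finCongr h).symm i)
        (j := (finCongr h).symm j) (by simpa using hv) (by simpa using hij) }

/-- Insert the vectors `b_1, …, b_j` in front: `(contract b A)(w) = A (b_1, …, b_j, w)`. -/
def contract {k : ℕ} : (j : ℕ) → (Fin j → E) → E [⋀^Fin (k + j)]→L[ℝ] ℝ → E [⋀^Fin k]→L[ℝ] ℝ
  | 0, _, A => A
  | j + 1, b, A => contract j (fun i => b i.succ)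
      ((ContinuousAlternatingMap.curryLeft (n := k + j) A) (b 0))

end Linear

/-- The complex structure `v ↦ i v`, as a real-linear map. -/
def complexStr (E : Type*) [NormedAddCommGroup E] [NormedSpace ℂ E] [NormedSpace ℝ E]
    [IsScalarTower ℝ ℂ E] : E →L[ℝ] E :=
  (Complex.I • ContinuousLinearMap.id ℂ E).restrictScalars ℝ

/-- The positively oriented real basis `e_1, i e_1, …, e_d, i e_d` of `ℂ^d`. -/
def realBasis (d : ℕ) (k : Fin (2 * d)) : CVec d :=
  Pi.single ⟨k / 2, by omega⟩ (if (k : ℕ) % 2 = 0 then 1 else Complex.I)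

/-- The real two-form `i ∂∂̄ f = - (1/2) d (df ∘ J)` of a real function `f` on a complex vector
space, where `J` is multiplication by `i`. -/
def iddbar {E : Type*} [NormedAddCommGroup E] [NormedSpace ℂ E] [NormedSpace ℝ E]
    [IsScalarTower ℝ ℂ E] (f : E → ℝ) (u : E) : E [⋀^Fin 2]→L[ℝ] ℝ :=
  (-(1 / 2) : ℝ) • extDeriv (fun w => ContinuousAlternatingMap.ofSubsingleton ℝ E ℝ (0 : Fin 1)
    ((fderiv ℝ f w).comp (complexStr E))) u

/-- For a real `(1,1)`-form written as `F = i ∑ F_{a b̄} dz^a ∧ dz̄^b`, the value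
`∑ F_{a b̄} u^a conj (v^b) = (F(u, i v) - i F(u, v)) / 2`. -/
def hermCoeff {E : Type*} [NormedAddCommGroup E] [NormedSpace ℂ E] [NormedSpace ℝ E]
    (F : E [⋀^Fin 2]→L[ℝ] ℝ) (u v : E) : ℂ :=
  ((F ![u, Complex.I • v] : ℂ) - Complex.I * (F ![u, v] : ℂ)) / 2

/-! ### Differential forms on complex manifolds -/

section Forms

variable {E : Type*} [NormedAddCommGroup E] [NormedSpace ℂ E] [NormedSpace ℝ E]
  [IsScalarTower ℝ ℂ E] {X : Type*} [TopologicalSpace X] [ChartedSpace E X]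

/-- Real differential forms of degree `k` (no regularity). As in Mathlib, the tangent space
`TangentSpace 𝓘(ℝ, E) x` at `x` is the model space `E`, through the preferred chart at `x`; the
transition maps are holomorphic, so multiplication by `i` on it does not depend on that chart. -/
def DForm (E : Type*) [NormedAddCommGroup E] [NormedSpace ℝ E] (X : Type*) (k : ℕ) : Type _ :=
  X → E [⋀^Fin k]→L[ℝ] ℝ

/-- The expression of a form in a chart `e`, that is its pull-back by `e.symm`. -/
def inChart {k : ℕ} (α : DForm E X k) (e : OpenPartialHomeomorph X E) (u : E) :
    E [⋀^Fin k]→L[ℝ] ℝ :=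
  (α (e.symm u)).compContinuousLinearMap
    (mfderiv 𝓘(ℝ, E) 𝓘(ℝ, E) e.symm u : E →L[ℝ] E)

/-- Smooth forms. -/
def IsSmoothForm {k : ℕ} (α : DForm E X k) : Prop :=
  ∀ x : X, ContDiffOn ℝ ∞ (inChart α (chartAt E x)) (chartAt E x).target

/-- The exterior derivative. -/
def extD {k : ℕ} (α : DForm E X k) : DForm E X (k + 1) := fun x =>
  extDeriv (inChart α (chartAt E x)) (chartAt E x x)

/-- A Kähler form: a smooth closed real `(1,1)`-form that is positive. -/
structure IsKahlerForm (α : DForm E X 2) : Prop where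
  smooth : IsSmoothForm α
  closed : ∀ x, extD α x = 0
  type_one_one : ∀ x (u v : E), α x ![Complex.I • u, Complex.I • v] = α x ![u, v]
  positive : ∀ x (v : E), v ≠ 0 → 0 < α x ![v, Complex.I • v]

end Forms

/-! ### Integration over a compact complex manifold -/

/-- A finite family of holomorphic charts with a subordinate smooth partition of unity. -/
structure ChartPartition (E : Type*) [NormedAddCommGroup E] [NormedSpace ℂ E] [NormedSpace ℝ E]
    (X : Type*) [TopologicalSpace X] [ChartedSpace E X] where
  size : ℕ
  chart : Fin size → OpenPartialHomeomorph X E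
  chart_mem : ∀ j, chart j ∈ IsManifold.maximalAtlas 𝓘(ℂ, E) ω X
  weight : Fin size → X → ℝ
  weight_smooth : ∀ j, ContMDiff 𝓘(ℝ, E) 𝓘(ℝ, ℝ) ∞ (weight j)
  weight_nonneg : ∀ j x, 0 ≤ weight j x
  weight_supp : ∀ j, tsupport (weight j) ⊆ (chart j).source
  weight_sum : ∀ x, ∑ j, weight j x = 1

open Classical in
/-- The integral `∫_M α` of a form of top degree over a compact complex manifold of dimension `d`
with its complex orientation, through a partition of unity. The value does not depend on the one
that is used. -/
def integral {d : ℕ} {M : Type*} [TopologicalSpace M] [ChartedSpace (CVec d) M]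
    (α : DForm (CVec d) M (2 * d)) : ℝ :=
  if h : Nonempty (ChartPartition (CVec d) M) then
    ∑ j, ∫ u : CVec d, if u ∈ (h.some.chart j).target then
      h.some.weight j ((h.some.chart j).symm u) * inChart α (h.some.chart j) u (realBasis d)
    else 0
  else 0

/-! ### Holomorphic fibrations and integration along the fibres -/

section Fibration

variable {m n : ℕ} {X M : Type*} [TopologicalSpace X] [ChartedSpace (CVec m × CVec n) X]
  [TopologicalSpace M] [ChartedSpace (CVec m) M]

/-- A proper surjective holomorphic map whose differential has maximal rank everywhere. -/
structure IsHolomorphicFibration (m n : ℕ) {X M : Type*} [TopologicalSpace X]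
    [ChartedSpace (CVec m × CVec n) X] [TopologicalSpace M] [ChartedSpace (CVec m) M]
    (π : X → M) : Prop where
  holomorphic : ContMDiff 𝓘(ℂ, CVec m × CVec n) 𝓘(ℂ, CVec m) ω π
  proper : IsProperMap π
  surjective : Function.Surjective π
  submersion : ∀ x, Function.Surjective (mfderiv 𝓘(ℂ, CVec m × CVec n) 𝓘(ℂ, CVec m) π x)

/-- A local admissible holomorphic coordinate system `(z; v)` of `X` over coordinates `z` of `M`:
a pair of holomorphic charts in which `π (z; v) = z`. -/
structure IsAdmissible (π : X → M) (e : OpenPartialHomeomorph X (CVec m × CVec n))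
    (f : OpenPartialHomeomorph M (CVec m)) : Prop where
  top_mem : e ∈ IsManifold.maximalAtlas 𝓘(ℂ, CVec m × CVec n) ω X
  base_mem : f ∈ IsManifold.maximalAtlas 𝓘(ℂ, CVec m) ω M
  maps : ∀ x ∈ e.source, π x ∈ f.source
  proj : ∀ x ∈ e.source, f (π x) = (e x).1

/-- A chart partition of the total space by admissible coordinate systems. -/
structure AdmissiblePartition (π : X → M) extends ChartPartition (CVec m × CVec n) X where
  base : Fin size → OpenPartialHomeomorph M (CVec m)
  admissible : ∀ j, IsAdmissible π (chart j) (base j)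

open Classical in
/-- Integration along the fibres of the form `Θ` of degree `k + 2 n`. In admissible coordinates
`(z; v)`, the value of `∫_{X/M} Θ` on tangent vectors `w_1, …, w_k` of the base is the integral over
the fibre of `Θ (∂_{v,1}, …, ∂_{v,2n}, w_1, …, w_k) dv`; the fibre has even real dimension, so that
the position of its vectors does not matter. The value does not depend on the partition used. -/
def fibreIntegral (π : X → M) {k : ℕ} (Θ : DForm (CVec m × CVec n) X (k + 2 * n)) :
    DForm (CVec m) M k := fun y =>
  if h : Nonempty (AdmissiblePartition π) then
    ∑ j, if y ∈ (h.some.base j).source then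
      ContinuousAlternatingMap.compContinuousLinearMap
        (∫ v : CVec n, if (h.some.base j y, v) ∈ (h.some.chart j).target then
            h.some.weight j ((h.some.chart j).symm (h.some.base j y, v)) •
              (contract (2 * n) (fun i => ((0 : CVec m), realBasis n i))
                (inChart Θ (h.some.chart j) (h.some.base j y, v))).compContinuousLinearMap
                  (ContinuousLinearMap.inl ℝ (CVec m) (CVec n))
          else 0)
        (mfderiv 𝓘(ℝ, CVec m) 𝓘(ℝ, CVec m) (h.some.base j) y : CVec m →L[ℝ] CVec m)
    else 0
  else 0

end Fibration

/-! ### Hermitian metrics on holomorphic line bundles -/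

section LineBundle

variable {E : Type*} [NormedAddCommGroup E] [NormedSpace ℂ E] [NormedSpace ℝ E]
  [IsScalarTower ℝ ℂ E] {X : Type*} [TopologicalSpace X] [ChartedSpace E X]
  {L : X → Type*} [TopologicalSpace (Bundle.TotalSpace ℂ L)] [∀ x, AddCommGroup (L x)]
  [∀ x, Module ℂ (L x)] [∀ x, TopologicalSpace (L x)] [FiberBundle ℂ L] [VectorBundle ℂ ℂ L]

/-- The local frame of `L` given by the preferred trivialization at `x₀`. -/
def localFrame (L : X → Type*) [TopologicalSpace (Bundle.TotalSpace ℂ L)]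
    [∀ x, AddCommGroup (L x)] [∀ x, Module ℂ (L x)] [∀ x, TopologicalSpace (L x)]
    [FiberBundle ℂ L] (x₀ x : X) : L x :=
  (trivializationAt ℂ L x₀).symm x 1

/-- A smooth Hermitian metric on `L`, given by the squared norm. -/
structure HermitianMetric (E : Type*) [NormedAddCommGroup E] [NormedSpace ℝ E]
    {X : Type*} [TopologicalSpace X] [ChartedSpace E X]
    (L : X → Type*) [TopologicalSpace (Bundle.TotalSpace ℂ L)] [∀ x, AddCommGroup (L x)]
    [∀ x, Module ℂ (L x)] [∀ x, TopologicalSpace (L x)] [FiberBundle ℂ L] where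
  normSq : ∀ x, L x → ℝ
  normSq_pos : ∀ x (s : L x), s ≠ 0 → 0 < normSq x s
  normSq_smul : ∀ x (c : ℂ) (s : L x), normSq x (c • s) = ‖c‖ ^ 2 * normSq x s
  smooth : ∀ x₀, ContMDiffOn 𝓘(ℝ, E) 𝓘(ℝ, ℝ) ∞ (fun x => normSq x (localFrame L x₀ x))
    (trivializationAt ℂ L x₀).baseSet

/-- The local weight `φ = - log |s|^2` of a metric, for the local frame `s` at `x₀`. -/
def HermitianMetric.weight (φ : HermitianMetric E L) (x₀ x : X) : ℝ :=
  -Real.log (φ.normSq x (localFrame L x₀ x))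

/-- The curvature form `i ∂∂̄ φ` of a metric. It does not depend on the frame nor on the chart. -/
def curvature (φ : HermitianMetric E L) : DForm E X 2 := fun x =>
  iddbar (fun u => φ.weight x ((chartAt E x).symm u)) (chartAt E x x)

/-- `L` is ample, that is positive: it carries a smooth metric with `i ∂∂̄ φ > 0`. -/
def IsAmple (E : Type*) [NormedAddCommGroup E] [NormedSpace ℂ E] [NormedSpace ℝ E]
    [IsScalarTower ℝ ℂ E] {X : Type*} [TopologicalSpace X] [ChartedSpace E X]
    (L : X → Type*) [TopologicalSpace (Bundle.TotalSpace ℂ L)] [∀ x, AddCommGroup (L x)]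
    [∀ x, Module ℂ (L x)] [∀ x, TopologicalSpace (L x)] [FiberBundle ℂ L] : Prop :=
  ∃ φ : HermitianMetric E L, ∀ x (v : E), v ≠ 0 → 0 < curvature φ x ![v, Complex.I • v]

end LineBundle

/-! ### Geodesic-Einstein metrics and the classes `S` and `C` -/

section Geodesic

variable {m n : ℕ} {X M : Type*} [TopologicalSpace X] [ChartedSpace (CVec m × CVec n) X]
  [TopologicalSpace M] [ChartedSpace (CVec m) M]
  {L : X → Type*} [TopologicalSpace (Bundle.TotalSpace ℂ L)] [∀ x, AddCommGroup (L x)]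
  [∀ x, Module ℂ (L x)] [∀ x, TopologicalSpace (L x)] [FiberBundle ℂ L] [VectorBundle ℂ ℂ L]

/-- `φ ∈ F⁺(L)`: the curvature is positive on the tangent spaces of the fibres. -/
def IsFibrewisePositive (π : X → M) (φ : HermitianMetric (CVec m × CVec n) L) : Prop :=
  ∀ x (v : CVec m × CVec n), v ≠ 0 →
    (mfderiv 𝓘(ℂ, CVec m × CVec n) 𝓘(ℂ, CVec m) π x :
      CVec m × CVec n →L[ℂ] CVec m) v = 0 →
    0 < curvature φ x ![v, Complex.I • v]

/-- The matrix `c(φ)_{α β̄} = φ_{α β̄} - φ_{α j̄} φ^{i j̄} φ_{i β̄}` of the geodesic curvature at the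
point with coordinates `u` of an admissible coordinate system `e`. -/
def geodesicCurvature (φ : HermitianMetric (CVec m × CVec n) L)
    (e : OpenPartialHomeomorph X (CVec m × CVec n)) (u : CVec m × CVec n) :
    Matrix (Fin m) (Fin m) ℂ :=
  let F := inChart (curvature φ) e u
  let ez : Fin m → CVec m × CVec n := fun α => (Pi.single α 1, 0)
  let ev : Fin n → CVec m × CVec n := fun i => (0, Pi.single i 1)
  let A : Matrix (Fin m) (Fin m) ℂ := Matrix.of fun α β => hermCoeff F (ez α) (ez β)
  let B : Matrix (Fin m) (Fin n) ℂ := Matrix.of fun α j => hermCoeff F (ez α) (ev j)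
  let B' : Matrix (Fin n) (Fin m) ℂ := Matrix.of fun i β => hermCoeff F (ev i) (ez β)
  let D : Matrix (Fin n) (Fin n) ℂ := Matrix.of fun i j => hermCoeff F (ev i) (ev j)
  A - B * D⁻¹ * B'

/-- The matrix `g_{α β̄}` of a real `(1,1)`-form `i g_{α β̄} dz^α ∧ dz̄^β` on the base, at the point
with coordinates `z` of a chart `f`. -/
def baseMatrix (η : DForm (CVec m) M 2) (f : OpenPartialHomeomorph M (CVec m)) (z : CVec m) :
    Matrix (Fin m) (Fin m) ℂ :=
  Matrix.of fun α β => hermCoeff (inChart η f z) (Pi.single α 1) (Pi.single β 1)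

/-- `φ` is a geodesic-Einstein metric with respect to the Kähler form `η` of the base: it lies in
`F⁺(L)` and `tr_η c(φ) = g^{α β̄} c(φ)_{α β̄}` is a constant. -/
def IsGeodesicEinstein (π : X → M) (η : DForm (CVec m) M 2)
    (φ : HermitianMetric (CVec m × CVec n) L) : Prop :=
  IsFibrewisePositive π φ ∧
  ∃ lam : ℝ, ∀ (e : OpenPartialHomeomorph X (CVec m × CVec n))
    (f : OpenPartialHomeomorph M (CVec m)), IsAdmissible π e f → ∀ x ∈ e.source,
      ((baseMatrix η f (f (π x)))⁻¹ * geodesicCurvature φ e (e x)).trace = (lam : ℂ)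

/-- The first Chern form `c_1(L, φ) = (i / 2π) ∂∂̄ φ`. -/
def chernForm (φ : HermitianMetric (CVec m × CVec n) L) : DForm (CVec m × CVec n) X 2 :=
  fun x => (2 * Real.pi)⁻¹ • curvature φ x

/-- The `S`-form `S_i(L, φ) = ∫_{X/M} c_1(L, φ)^{n+i}`, of degree `2 i`. -/
def sForm (π : X → M) (φ : HermitianMetric (CVec m × CVec n) L) (i : ℕ) :
    DForm (CVec m) M (2 * i) :=
  fibreIntegral π (k := 2 * i) fun x =>
    castDegree (show 2 * (n + i) = 2 * i + 2 * n by ring) (wedgePow (chernForm φ x) (n + i))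

/-- The function `S_0(L, φ)`, a form of degree zero. -/
def sZero (π : X → M) (φ : HermitianMetric (CVec m × CVec n) L) (y : M) : ℝ :=
  sForm π φ 0 y Fin.elim0

/-! The `C`-forms are the components of the formal inverse `1 / (S_0 + S_1 + S_2 + ⋯)`:
`C_0 S_0 = 1`, `C_0 S_1 + C_1 S_0 = 0` and `C_0 S_2 + C_1 ∧ S_1 + C_2 S_0 = 0`. -/

/-- `C_0 = 1 / S_0`. -/
def cZero (π : X → M) (φ : HermitianMetric (CVec m × CVec n) L) (y : M) : ℝ :=
  (sZero π φ y)⁻¹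

/-- `C_1 = - C_0 S_1 / S_0`. -/
def cOne (π : X → M) (φ : HermitianMetric (CVec m × CVec n) L) : DForm (CVec m) M 2 := fun y =>
  (-(cZero π φ y / sZero π φ y)) • sForm π φ 1 y

/-- `C_2 = - (C_0 S_2 + C_1 ∧ S_1) / S_0`, that is `(S_1 ∧ S_1 - S_0 S_2) / S_0 ^ 3`. -/
def cTwo (π : X → M) (φ : HermitianMetric (CVec m × CVec n) L) : DForm (CVec m) M 4 := fun y =>
  (-(sZero π φ y)⁻¹) •
    (cZero π φ y • (sForm π φ 2 y : CVec m [⋀^Fin 4]→L[ℝ] ℝ)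
      + (wedge (cOne π φ y) (sForm π φ 1 y) : CVec m [⋀^Fin 4]→L[ℝ] ℝ))

/-- The de Rham class `C_2(L) ∈ H⁴(M, ℝ)`, as the set of its representatives: the smooth four-forms
that differ from the `C`-form `C_2(L, φ)` of a smooth metric `φ` by an exact form. -/
def cTwoClass (π : X → M) (L : X → Type*) [TopologicalSpace (Bundle.TotalSpace ℂ L)]
    [∀ x, AddCommGroup (L x)] [∀ x, Module ℂ (L x)] [∀ x, TopologicalSpace (L x)]
    [FiberBundle ℂ L] [VectorBundle ℂ ℂ L] : Set (DForm (CVec m) M 4) :=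
  {Γ | ∃ (φ : HermitianMetric (CVec m × CVec n) L) (β : DForm (CVec m) M 3),
    IsSmoothForm β ∧ ∀ y, Γ y = cTwo π φ y + extD β y}

end Geodesic

end

end GeodesicEinstein

/-! At a point of the total space, the curvature of a fibrewise positive metric splits orthogonally
into a positive form along the fibre and a horizontal form, whose matrix is the Schur complement
c(φ). Fibre integration of c_1(L, φ)^(n+i) keeps n vertical factors and i horizontal ones. Hence S_i
at a point y of M is (n+i)!/i! times the i-th moment of the forms C = c(φ)/2π, for one positive
measure on the fibre over y that is the same for all i (`exists_density_contract_wedgePow`,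
`exists_moments`).

In complex dimension two the wedge square on real (1,1)-forms is a Lorentzian quadratic form:
positive on positive forms, nonpositive on the orthogonal complement of a positive form
(`pairing_self_pos`, `pairing_self_nonpos`). The geodesic-Einstein equation says that C ∧ η is
constant along the fibre over y. With a the mass of the measure and S the integral of C, the form aC
- S is therefore orthogonal to η, and its square is nonpositive. Integrated over the fibre, this is
a reversed Cauchy-Schwarz inequality a ∫ C ∧ C ≤ S ∧ S (`mass_mul_moment_le`), that is S_1 ∧ S_1 ≥
2(n+1)/(n+2) S_0 S_2 (`sZero_mul_sForm_two_le`). Since S_0 is a positive constant, it follows that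
C_2(L, φ) ≥ n/(n+2) S_0⁻² S_2(L, φ) at every point (`cTwo_ge`).

The form S_2(L, φ) of the geodesic-Einstein metric itself is not known to be positive, as its
curvature is controlled only on the fibres. Its integral, however, does not depend on the metric,
and for a metric of positive curvature all the horizontal forms are positive, so S_2 is positive at
every point (`sForm_two_pos`). This is where ampleness enters.

The independence of the metric rests on transgression. Two metrics differ by a function, which a
partition of unity cuts into pieces with support in one admissible chart and one frame of L; each
piece changes the powers of the curvature by an exact form with the same support
(`exists_transgression`). Fibre integration commutes with d (`extD_fibreIntegral`), so the S-forms
change by exact forms (`cohomologous`), and Stokes' formula (`integral_extD`) removes these. The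
same facts make S_0 constant and give all representatives of C_2(L) the same integral
(`sZero_const`, `integral_cTwoClass`). -/

namespace GeodesicEinstein

noncomputable section

set_option linter.unusedSectionVars false

/-! ### Alternating forms: wedge powers as Pfaffians, contractions, top degree. -/

section

section AlternatingAlgebra

variable {E : Type*} [NormedAddCommGroup E] [NormedSpace ℝ E]
  {F : Type*} [NormedAddCommGroup F] [NormedSpace ℝ F]

/-- A linear left inverse of the joint evaluation of alternating forms at all tuples taken from a
finite family of vectors. -/
theorem exists_eval_leftInverse [FiniteDimensional ℝ E] (k : ℕ) :
    ∃ (ι : Type) (_ : Fintype ι) (w : ι → Fin k → E)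
      (Ψ : (ι → ℝ) →L[ℝ] (E [⋀^Fin k]→L[ℝ] ℝ)), ∀ a, Ψ (fun i => a (w i)) = a := by
  classical
  let b := Module.finBasis ℝ E
  let ι := Fin k → Fin (Module.finrank ℝ E)
  let w : ι → Fin k → E := fun s i => b (s i)
  let Φ : (E [⋀^Fin k]→L[ℝ] ℝ) →ₗ[ℝ] (ι → ℝ) :=
    { toFun := fun a i => a (w i)
      map_add' := fun _ _ => rfl
      map_smul' := fun _ _ => rfl }
  have hinj : LinearMap.ker Φ = ⊥ := by
    rw [LinearMap.ker_eq_bot']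
    intro a ha
    apply ContinuousAlternatingMap.toAlternatingMap_injective
    refine Module.Basis.ext_alternating b fun v _ => ?_
    exact congrFun ha v
  obtain ⟨Ψ, hΨ⟩ := Φ.exists_leftInverse_of_injective hinj
  refine ⟨ι, inferInstance, w, LinearMap.toContinuousLinearMap Ψ, fun a => ?_⟩
  exact LinearMap.congr_fun hΨ a

/-- In finite dimension a form is a linear function of finitely many of its values, so regularity
may be tested on each fixed tuple of vectors. Most smoothness statements about forms reduce to
scalar functions in this way. -/
theorem contDiffWithinAt_alternating_iff [FiniteDimensional ℝ E] {k : ℕ} {n : WithTop ℕ∞}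
    {f : F → E [⋀^Fin k]→L[ℝ] ℝ} {s : Set F} {x : F} :
    ContDiffWithinAt ℝ n f s x ↔ ∀ v, ContDiffWithinAt ℝ n (fun y => f y v) s x := by
  constructor
  · intro h v
    exact (ContinuousAlternatingMap.apply ℝ E ℝ v).contDiff.contDiffAt.comp_contDiffWithinAt x h
  · intro h
    obtain ⟨ι, _, w, Ψ, hΨ⟩ := exists_eval_leftInverse (E := E) k
    have h1 : ContDiffWithinAt ℝ n (fun y => fun i => f y (w i)) s x :=
      contDiffWithinAt_pi.2 fun i => h (w i)
    have h2 := Ψ.contDiff.contDiffAt.comp_contDiffWithinAt x h1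
    exact h2.congr (fun y _ => (hΨ (f y)).symm) (hΨ (f x)).symm

theorem contDiffOn_alternating_iff [FiniteDimensional ℝ E] {k : ℕ} {n : WithTop ℕ∞}
    {f : F → E [⋀^Fin k]→L[ℝ] ℝ} {s : Set F} :
    ContDiffOn ℝ n f s ↔ ∀ v, ContDiffOn ℝ n (fun y => f y v) s :=
  ⟨fun h v x hx => contDiffWithinAt_alternating_iff.1 (h x hx) v,
    fun h x hx => contDiffWithinAt_alternating_iff.2 fun v => h v x hx⟩

theorem contDiff_alternating_iff [FiniteDimensional ℝ E] {k : ℕ} {n : WithTop ℕ∞}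
    {f : F → E [⋀^Fin k]→L[ℝ] ℝ} :
    ContDiff ℝ n f ↔ ∀ v, ContDiff ℝ n (fun y => f y v) := by
  simp only [← contDiffOn_univ]
  exact contDiffOn_alternating_iff

/-! ### Evaluation formulas -/

theorem castDegree_apply {p q : ℕ} (h : p = q) (a : E [⋀^Fin p]→L[ℝ] ℝ) (v : Fin q → E) :
    castDegree h a v = a (fun i => v (Fin.cast h i)) := rfl

theorem wedge_apply {k l : ℕ} (a : E [⋀^Fin k]→L[ℝ] ℝ) (b : E [⋀^Fin l]→L[ℝ] ℝ)
    (v : Fin (k + l) → E) :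
    wedge a b v = (k.factorial * l.factorial : ℝ)⁻¹ * ∑ σ : Equiv.Perm (Fin (k + l)),
      (Equiv.Perm.sign σ : ℝ) *
        (a (fun i => v (σ (Fin.castAdd l i))) * b (fun j => v (σ (Fin.natAdd k j)))) := by
  unfold wedge
  rw [ContinuousAlternatingMap.smul_apply, ContinuousMultilinearMap.alternatization_apply_apply,
    smul_eq_mul]
  congr 1
  refine Finset.sum_congr rfl fun σ _ => ?_
  rw [Units.smul_def, zsmul_eq_mul]
  rfl

theorem wedge_comp {k l : ℕ} (a : E [⋀^Fin k]→L[ℝ] ℝ) (b : E [⋀^Fin l]→L[ℝ] ℝ) (f : F →L[ℝ] E) :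
    (wedge a b).compContinuousLinearMap f =
      wedge (a.compContinuousLinearMap f) (b.compContinuousLinearMap f) := by
  ext v
  simp only [ContinuousAlternatingMap.compContinuousLinearMap_apply, wedge_apply]
  rfl

theorem wedgePow_comp (a : E [⋀^Fin 2]→L[ℝ] ℝ) (f : F →L[ℝ] E) (p : ℕ) :
    (wedgePow a p).compContinuousLinearMap f = wedgePow (a.compContinuousLinearMap f) p := by
  induction p with
  | zero => rfl
  | succ p ih =>
    show (wedge (wedgePow a p) a).compContinuousLinearMap f = wedge _ _
    rw [wedge_comp, ih]

theorem contract_apply {k : ℕ} (j : ℕ) (b : Fin j → E) (A : E [⋀^Fin (k + j)]→L[ℝ] ℝ)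
    (w : Fin k → E) :
    contract j b A w = A (fun i => Fin.append b w (Fin.cast (Nat.add_comm k j) i)) := by
  induction j with
  | zero =>
    show A w = _
    congr 1
    funext i
    rw [show Fin.cast (Nat.add_comm k 0) i = Fin.natAdd 0 i from Fin.ext (by simp),
      Fin.append_right]
  | succ j ih =>
    show contract j (fun i => b i.succ) (ContinuousAlternatingMap.curryLeft (n := k + j) A (b 0)) w
      = _
    rw [ih, ContinuousAlternatingMap.curryLeft_apply_apply]
    congr 1
    funext i
    refine Fin.cases ?_ (fun i => ?_) i
    · rw [Matrix.cons_val_zero]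
      rw [show Fin.cast (Nat.add_comm k (j + 1)) 0 = Fin.castAdd k (0 : Fin (j + 1)) from
        Fin.ext (by simp), Fin.append_left]
    · rw [Matrix.cons_val_succ]
      by_cases hi : (i : ℕ) < j
      · rw [show Fin.cast (Nat.add_comm k j) i = Fin.castAdd k ⟨i, hi⟩ from Fin.ext (by simp),
          show Fin.cast (Nat.add_comm k (j + 1)) i.succ = Fin.castAdd k ⟨i + 1, by omega⟩ from
          Fin.ext (by simp), Fin.append_left, Fin.append_left]
        rfl
      · rw [show Fin.cast (Nat.add_comm k j) i = Fin.natAdd j ⟨i - j, by omega⟩ from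
          Fin.ext (by simp; omega),
          show Fin.cast (Nat.add_comm k (j + 1)) i.succ = Fin.natAdd (j + 1) ⟨i - j, by omega⟩ from
          Fin.ext (by simp; omega), Fin.append_right, Fin.append_right]

theorem sum_perm_fin_succ {n : ℕ} (f : Equiv.Perm (Fin (n + 1)) → ℝ) :
    ∑ σ, f σ = ∑ p : Fin (n + 1), ∑ e : Equiv.Perm (Fin n),
      f (Equiv.Perm.decomposeFin.symm (p, e)) := by
  rw [← Equiv.sum_comp Equiv.Perm.decomposeFin.symm, Fintype.sum_prod_type]

theorem sum_perm_fin_three (h : Fin 3 → Fin 3 → Fin 3 → ℝ) :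
    ∑ σ : Equiv.Perm (Fin 3), (Equiv.Perm.sign σ : ℝ) * h (σ 0) (σ 1) (σ 2) =
    h 0 1 2 - h 0 2 1 - h 1 0 2 + h 1 2 0 - h 2 1 0 + h 2 0 1 := by
  have e0 : ∀ (p : Fin 3) (e : Equiv.Perm (Fin 2)), Equiv.Perm.decomposeFin.symm (p, e) 1 =
      Equiv.swap 0 p (e 0).succ := fun p e => by
    simp
  have e1 : ∀ (p : Fin 3) (e : Equiv.Perm (Fin 2)), Equiv.Perm.decomposeFin.symm (p, e) 2 =
      Equiv.swap 0 p (e 1).succ := fun p e => by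
    simpa using Equiv.Perm.decomposeFin_symm_apply_succ e p 1
  have e2 : ∀ (p : Fin 2) (e : Equiv.Perm (Fin 1)), Equiv.Perm.decomposeFin.symm (p, e) 1 =
      Equiv.swap 0 p (e 0).succ := fun p e => by
    simp
  simp only [sum_perm_fin_succ, Fin.sum_univ_succ, Finset.univ_unique, Finset.sum_singleton,
    Equiv.Perm.decomposeFin_symm_apply_zero, e0, e1, e2, Equiv.Perm.decomposeFin.symm_sign]
  simp [Equiv.swap_apply_def, Fin.ext_iff]
  ring

/-- A permutation is split into the image `p` of `0` and a permutation of the rest; the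
transposition of `0` and `p` contributes the sign unless `p = 0`. The four inner sums are left in
the form to which `sum_perm_fin_three` applies. -/
theorem sum_perm_fin_four (h : Fin 4 → Fin 4 → Fin 4 → Fin 4 → ℝ) :
    ∑ σ : Equiv.Perm (Fin 4), (Equiv.Perm.sign σ : ℝ) * h (σ 0) (σ 1) (σ 2) (σ 3) =
    ∑ p : Fin 4, (if p = 0 then 1 else -1) * ∑ e : Equiv.Perm (Fin 3), (Equiv.Perm.sign e : ℝ) *
      h p (Equiv.swap 0 p (e 0).succ) (Equiv.swap 0 p (e 1).succ) (Equiv.swap 0 p (e 2).succ) := by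
  rw [sum_perm_fin_succ]
  refine Finset.sum_congr rfl fun p _ => ?_
  rw [Finset.mul_sum]
  refine Finset.sum_congr rfl fun e _ => ?_
  have e0 : Equiv.Perm.decomposeFin.symm (p, e) 1 = Equiv.swap 0 p (e 0).succ := by
    simp
  have e1 : Equiv.Perm.decomposeFin.symm (p, e) 2 = Equiv.swap 0 p (e 1).succ := by
    simpa using Equiv.Perm.decomposeFin_symm_apply_succ e p 1
  have e2 : Equiv.Perm.decomposeFin.symm (p, e) 3 = Equiv.swap 0 p (e 2).succ := by
    simpa using Equiv.Perm.decomposeFin_symm_apply_succ e p 2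
  rw [Equiv.Perm.decomposeFin_symm_apply_zero, e0, e1, e2, Equiv.Perm.decomposeFin.symm_sign]
  split_ifs <;> simp

theorem two_form_swap (a : E [⋀^Fin 2]→L[ℝ] ℝ) (x y : E) : a ![x, y] = -a ![y, x] := by
  have h := a.toAlternatingMap.map_swap ![y, x] (i := 0) (j := 1) (by decide)
  have h2 : (![y, x] : Fin 2 → E) ∘ Equiv.swap 0 1 = ![x, y] := by
    funext i
    fin_cases i <;> simp
  rw [h2] at h
  exact h

theorem two_form_self (a : E [⋀^Fin 2]→L[ℝ] ℝ) (x : E) : a ![x, x] = 0 := by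
  have := two_form_swap a x x
  linarith

theorem wedge_one_two_apply (a : E [⋀^Fin 1]→L[ℝ] ℝ) (b : E [⋀^Fin 2]→L[ℝ] ℝ) (v : Fin 3 → E) :
    wedge a b v = a ![v 0] * b ![v 1, v 2] - a ![v 1] * b ![v 0, v 2]
      + a ![v 2] * b ![v 0, v 1] := by
  have key := sum_perm_fin_three fun i j k => a ![v i] * b ![v j, v k]
  have h : ∀ σ : Equiv.Perm (Fin 3),
      a (fun i => v (σ (Fin.castAdd 2 i))) * b (fun j => v (σ (Fin.natAdd 1 j)))
        = a ![v (σ 0)] * b ![v (σ 1), v (σ 2)] := by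
    intro σ
    congr 2
    · funext i
      fin_cases i
      rfl
    · funext i
      fin_cases i <;> rfl
  rw [wedge_apply]
  -- This turns `Fin (1 + 2)` into `Fin 3`, so that the expansion over permutations matches.
  simp only [Nat.reduceAdd] at *
  simp only [h]
  rw [key]
  rw [two_form_swap b (v 2) (v 1), two_form_swap b (v 2) (v 0), two_form_swap b (v 1) (v 0)]
  norm_num [Nat.factorial]
  ring

theorem wedge_two_two_apply (a : E [⋀^Fin 2]→L[ℝ] ℝ) (b : E [⋀^Fin 2]→L[ℝ] ℝ) (v : Fin 4 → E) :
    wedge a b v = a ![v 0, v 1] * b ![v 2, v 3] - a ![v 0, v 2] * b ![v 1, v 3]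
      + a ![v 0, v 3] * b ![v 1, v 2] + a ![v 1, v 2] * b ![v 0, v 3]
      - a ![v 1, v 3] * b ![v 0, v 2] + a ![v 2, v 3] * b ![v 0, v 1] := by
  have key := sum_perm_fin_four fun i j k l => a ![v i, v j] * b ![v k, v l]
  have h : ∀ σ : Equiv.Perm (Fin 4),
      a (fun i => v (σ (Fin.castAdd 2 i))) * b (fun j => v (σ (Fin.natAdd 2 j)))
        = a ![v (σ 0), v (σ 1)] * b ![v (σ 2), v (σ 3)] := by
    intro σ
    congr 2 <;>
    · funext i
      fin_cases i <;> rfl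
  rw [wedge_apply]
  simp only [Nat.reduceAdd] at *
  simp only [h]
  rw [key]
  have h3 := fun p : Fin 4 => sum_perm_fin_three fun i j k =>
    a ![v p, v (Equiv.swap 0 p i.succ)] *
      b ![v (Equiv.swap 0 p j.succ), v (Equiv.swap 0 p k.succ)]
  simp only [h3]
  simp only [Fin.sum_univ_succ, Fin.sum_univ_zero]
  simp [Equiv.swap_apply_def, Fin.ext_iff]
  rw [two_form_swap b (v 2) (v 1), two_form_swap b (v 2) (v 0), two_form_swap b (v 1) (v 0),
    two_form_swap b (v 3) (v 0), two_form_swap b (v 3) (v 1), two_form_swap b (v 3) (v 2),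
    two_form_swap a (v 2) (v 1), two_form_swap a (v 2) (v 0), two_form_swap a (v 1) (v 0),
    two_form_swap a (v 3) (v 0), two_form_swap a (v 3) (v 1), two_form_swap a (v 3) (v 2)]
  norm_num [Nat.factorial]
  ring

/-! ### Wedge powers of a two-form as Pfaffians -/

/-- The position `2 i + b` of the entry `b` of the pair `i`. -/
def pairIndex (p : ℕ) : Fin p × Fin 2 ≃ Fin (2 * p) :=
  finProdFinEquiv.trans (finCongr (Nat.mul_comm p 2))

theorem pairIndex_val (p : ℕ) (i : Fin p) (b : Fin 2) :
    (pairIndex p (i, b) : ℕ) = b + 2 * i := rfl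

/-- Pfaffian expansion, by induction on `p`. A permutation in the expansion of the power `p`,
extended by the identity on the last pair, is absorbed in the outer sum over all permutations. All
`(2p)!` of them contribute the same, which cancels the factorial in the wedge product and leaves one
more factor 1/2. -/
theorem wedgePow_apply (a : E [⋀^Fin 2]→L[ℝ] ℝ) (p : ℕ) (v : Fin (2 * p) → E) :
    wedgePow a p v = (2 ^ p : ℝ)⁻¹ * ∑ σ : Equiv.Perm (Fin (2 * p)), (Equiv.Perm.sign σ : ℝ) *
      ∏ i : Fin p, a ![v (σ (pairIndex p (i, 0))), v (σ (pairIndex p (i, 1)))] := by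
  induction p with
  | zero =>
    show (1 : ℝ) = _
    rw [Fintype.sum_eq_single (1 : Equiv.Perm (Fin (2 * 0)))
      (fun σ h => (h (Equiv.ext fun i => i.elim0)).elim)]
    simp
  | succ p ih =>
    show wedge (wedgePow a p) a v = _
    rw [wedge_apply]
    let ext' : Equiv.Perm (Fin (2 * p)) → Equiv.Perm (Fin (2 * p + 2)) := fun τ =>
      finSumFinEquiv.permCongr (Equiv.sumCongr τ (Equiv.refl (Fin 2)))
    have hext1 : ∀ τ i, ext' τ (Fin.castAdd 2 i) = Fin.castAdd 2 (τ i) := by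
      intro τ i
      simp [ext', Equiv.permCongr_apply]
    have hext2 : ∀ τ i, ext' τ (Fin.natAdd (2 * p) i) = Fin.natAdd (2 * p) i := by
      intro τ i
      simp [ext', Equiv.permCongr_apply]
    have hsign : ∀ τ, Equiv.Perm.sign (ext' τ) = Equiv.Perm.sign τ := by
      intro τ
      simp only [ext', Equiv.Perm.sign_permCongr]
      have := Equiv.Perm.sign_sumCongr τ (1 : Equiv.Perm (Fin 2))
      rw [Equiv.Perm.sign_one, mul_one] at this
      exact this
    let g : Equiv.Perm (Fin (2 * p + 2)) → ℝ := fun σ => (Equiv.Perm.sign σ : ℝ) *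
      ((∏ i : Fin p, a ![v (σ (Fin.castAdd 2 (pairIndex p (i, 0)))),
          v (σ (Fin.castAdd 2 (pairIndex p (i, 1))))]) *
        a ![v (σ (Fin.natAdd (2 * p) 0)), v (σ (Fin.natAdd (2 * p) 1))])
    have hg : ∀ σ : Equiv.Perm (Fin (2 * (p + 1))), (Equiv.Perm.sign σ : ℝ) *
        ∏ i : Fin (p + 1), a ![v (σ (pairIndex (p + 1) (i, 0))),
          v (σ (pairIndex (p + 1) (i, 1)))] = g σ := by
      intro σ
      simp only [g]
      rw [Fin.prod_univ_castSucc]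
      congr 2
      congr 1
      have e0 : pairIndex (p + 1) (Fin.last p, 0) = Fin.natAdd (2 * p) (0 : Fin 2) :=
        Fin.ext (by rw [pairIndex_val]; simp)
      have e1 : pairIndex (p + 1) (Fin.last p, 1) = Fin.natAdd (2 * p) (1 : Fin 2) :=
        Fin.ext (by rw [pairIndex_val]; simp; omega)
      rw [e0, e1]
    have hsum : ∀ σ : Equiv.Perm (Fin (2 * p + 2)), (Equiv.Perm.sign σ : ℝ) *
        (wedgePow a p (fun i => v (σ (Fin.castAdd 2 i))) *
          a (fun j => v (σ (Fin.natAdd (2 * p) j)))) =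
        (2 ^ p : ℝ)⁻¹ * ∑ τ : Equiv.Perm (Fin (2 * p)), g (σ * ext' τ) := by
      intro σ
      rw [ih]
      have hlast : (fun j => v (σ (Fin.natAdd (2 * p) j))) =
          ![v (σ (Fin.natAdd (2 * p) 0)), v (σ (Fin.natAdd (2 * p) 1))] := by
        funext j
        fin_cases j <;> rfl
      rw [hlast]
      simp only [g, Equiv.Perm.mul_apply, hext1, hext2, Equiv.Perm.sign_mul, hsign]
      rw [mul_assoc, Finset.sum_mul, Finset.mul_sum, Finset.mul_sum, Finset.mul_sum]
      refine Finset.sum_congr rfl fun τ _ => ?_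
      push_cast
      ring
    -- Right translation in the symmetric group does not change the sum.
    have hswap : ∀ τ : Equiv.Perm (Fin (2 * p)), ∑ σ, g (σ * ext' τ) = ∑ σ, g σ := fun τ =>
      Equiv.sum_comp (Equiv.mulRight (ext' τ)) g
    rw [Finset.sum_congr rfl fun σ _ => hsum σ, ← Finset.mul_sum, Finset.sum_comm]
    simp only [hswap]
    rw [Finset.sum_const, Finset.card_univ, Fintype.card_perm, Fintype.card_fin, nsmul_eq_mul]
    rw [Finset.sum_congr rfl fun σ _ => hg σ]
    have hf : ((2 * p).factorial : ℝ) ≠ 0 := by positivity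
    simp only [Nat.factorial_two, Nat.cast_ofNat]
    rw [pow_succ]
    field_simp

/-- The summand of the Pfaffian expansion. -/
def pfTerm (a : E [⋀^Fin 2]→L[ℝ] ℝ) (p : ℕ) (v : Fin (2 * p) → E)
    (σ : Equiv.Perm (Fin (2 * p))) : ℝ :=
  (Equiv.Perm.sign σ : ℝ) *
    ∏ i : Fin p, a ![v (σ (pairIndex p (i, 0))), v (σ (pairIndex p (i, 1)))]

/-- Exchanging two whole pairs moves both of their columns, hence is an even permutation, and it
only reorders the product. -/
theorem pfTerm_pairSwap (a : E [⋀^Fin 2]→L[ℝ] ℝ) (p : ℕ) (v : Fin (2 * (p + 1)) → E)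
    (σ : Equiv.Perm (Fin (2 * (p + 1)))) (j : Fin (p + 1)) :
    pfTerm a (p + 1) v (σ * (pairIndex (p + 1)).permCongr
      (Equiv.prodCongrLeft fun _ : Fin 2 => Equiv.swap 0 j)) = pfTerm a (p + 1) v σ := by
  have hs : Equiv.Perm.sign ((pairIndex (p + 1)).permCongr
      (Equiv.prodCongrLeft fun _ : Fin 2 => Equiv.swap 0 j)) = 1 := by
    rw [Equiv.Perm.sign_permCongr, Equiv.Perm.sign_prodCongrLeft]
    simp
  unfold pfTerm
  rw [Equiv.Perm.sign_mul, hs, mul_one]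
  congr 1
  simp only [Equiv.Perm.mul_apply, Equiv.permCongr_apply, Equiv.symm_apply_apply,
    Equiv.prodCongrLeft_apply]
  exact Equiv.prod_comp (Equiv.swap 0 j) fun i =>
    a ![v (σ (pairIndex (p + 1) (i, 0))), v (σ (pairIndex (p + 1) (i, 1)))]

/-- The sign of the transposition cancels against the antisymmetry of `a` in the first pair. -/
theorem pfTerm_flip (a : E [⋀^Fin 2]→L[ℝ] ℝ) (p : ℕ) (v : Fin (2 * (p + 1)) → E)
    (σ : Equiv.Perm (Fin (2 * (p + 1)))) :
    pfTerm a (p + 1) v (σ * Equiv.swap (pairIndex (p + 1) (0, 0)) (pairIndex (p + 1) (0, 1))) =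
      pfTerm a (p + 1) v σ := by
  unfold pfTerm
  rw [Equiv.Perm.sign_mul, Equiv.Perm.sign_swap (by simp), Fin.prod_univ_succ, Fin.prod_univ_succ]
  simp only [Equiv.Perm.mul_apply, Equiv.swap_apply_left, Equiv.swap_apply_right]
  rw [two_form_swap a (v (σ (pairIndex (p + 1) (0, 1))))]
  have h : ∀ (i : Fin p) (b : Fin 2),
      Equiv.swap (pairIndex (p + 1) (0, 0)) (pairIndex (p + 1) (0, 1))
        (pairIndex (p + 1) (i.succ, b)) = pairIndex (p + 1) (i.succ, b) := by
    intro i b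
    refine Equiv.swap_apply_of_ne_of_ne ?_ ?_ <;>
    · intro h
      have := (pairIndex (p + 1)).injective h
      simp at this
  simp only [h]
  push_cast
  ring

/-- A permutation of the positions that carries the first one to `x` and does not change the
summands of the Pfaffian expansion. -/
theorem exists_pfTerm_invariant (a : E [⋀^Fin 2]→L[ℝ] ℝ) (p : ℕ) (v : Fin (2 * (p + 1)) → E)
    (x : Fin (2 * (p + 1))) : ∃ s : Equiv.Perm (Fin (2 * (p + 1))), s 0 = x ∧
      ∀ σ, pfTerm a (p + 1) v (σ * s) = pfTerm a (p + 1) v σ := by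
  obtain ⟨⟨i, b⟩, rfl⟩ := (pairIndex (p + 1)).surjective x
  have h0 : (0 : Fin (2 * (p + 1))) = pairIndex (p + 1) (0, 0) := rfl
  refine Fin.cases ?_ (fun b' => ?_) b
  · refine ⟨_, ?_, fun σ => pfTerm_pairSwap a p v σ i⟩
    rw [h0, Equiv.permCongr_apply, Equiv.symm_apply_apply, Equiv.prodCongrLeft_apply]
    simp
  · obtain rfl : b' = 0 := Subsingleton.elim _ _
    refine ⟨(pairIndex (p + 1)).permCongr (Equiv.prodCongrLeft fun _ : Fin 2 => Equiv.swap 0 i) *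
      Equiv.swap (pairIndex (p + 1) (0, 0)) (pairIndex (p + 1) (0, 1)), ?_, fun σ => ?_⟩
    · rw [h0, Equiv.Perm.mul_apply, Equiv.swap_apply_left, Equiv.permCongr_apply,
        Equiv.symm_apply_apply, Equiv.prodCongrLeft_apply]
      simp
    · rw [← mul_assoc, pfTerm_flip, pfTerm_pairSwap]

/-- In the Pfaffian expansion `u` can be brought to the first of the `2(p+1)` slots by symmetries of
the summands. Its partner must then be `u'`, since every other partner gives a zero factor. The
count `2(p+1)` against one lost factor 1/2 leaves the coefficient `p+1`. -/
theorem wedgePow_succ_of_orthogonal (a : E [⋀^Fin 2]→L[ℝ] ℝ) (p : ℕ) (u u' : E)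
    (w : Fin (2 * p) → E) (hu : ∀ i, a ![u, w i] = 0) :
    wedgePow a (p + 1) (Fin.cons u (Fin.cons u' w) : Fin (2 * p + 1 + 1) → E) =
      (p + 1) * a ![u, u'] * wedgePow a p w := by
  set v : Fin (2 * (p + 1)) → E := (Fin.cons u (Fin.cons u' w) : Fin (2 * p + 1 + 1) → E) with hv
  -- For each permutation exactly one slot receives the vector of index 0, which is `u`; all slots
  -- contribute equally.
  have hsum : ∑ σ, pfTerm a (p + 1) v σ =
      (2 * (p + 1)) * ∑ σ, if σ 0 = 0 then pfTerm a (p + 1) v σ else 0 := by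
    have h1 : ∀ σ : Equiv.Perm (Fin (2 * (p + 1))), pfTerm a (p + 1) v σ =
        ∑ x, if σ x = 0 then pfTerm a (p + 1) v σ else 0 := by
      intro σ
      rw [Finset.sum_eq_single (σ.symm 0)]
      · simp
      · intro x _ hx
        rw [if_neg]
        intro h
        exact hx (by rw [← h, Equiv.symm_apply_apply])
      · simp
    have h2 : ∀ x : Fin (2 * (p + 1)), (∑ σ : Equiv.Perm (Fin (2 * (p + 1))),
        if σ x = 0 then pfTerm a (p + 1) v σ else 0) =
        ∑ σ, if σ 0 = 0 then pfTerm a (p + 1) v σ else 0 := by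
      intro x
      obtain ⟨s, hs, hinv⟩ := exists_pfTerm_invariant a p v x
      rw [← Equiv.sum_comp (Equiv.mulRight s⁻¹)]
      refine Finset.sum_congr rfl fun σ _ => ?_
      have e1 : (Equiv.mulRight s⁻¹ σ) x = σ 0 := by
        show σ (s⁻¹ x) = σ 0
        rw [← hs]
        exact congrArg σ (s.symm_apply_apply 0)
      have e2 : pfTerm a (p + 1) v (Equiv.mulRight s⁻¹ σ) = pfTerm a (p + 1) v σ := by
        rw [← hinv (Equiv.mulRight s⁻¹ σ)]
        simp
      rw [e1, e2]
    rw [Finset.sum_congr rfl fun σ _ => h1 σ, Finset.sum_comm,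
      Finset.sum_congr rfl fun x _ => h2 x, Finset.sum_const, Finset.card_univ, Fintype.card_fin,
      nsmul_eq_mul]
    push_cast
    ring
  -- Here `u` is in the first slot and is paired with some `w j`, so the first factor vanishes.
  have hzero : ∀ e : Equiv.Perm (Fin (2 * p + 1)), e 0 ≠ 0 →
      pfTerm a (p + 1) v (Equiv.Perm.decomposeFin.symm (0, e)) = 0 := by
    intro e he
    unfold pfTerm
    rw [Fin.prod_univ_succ]
    have i0 : pairIndex (p + 1) (0, 0) = (0 : Fin (2 * p + 1 + 1)) := rfl
    have i1 : pairIndex (p + 1) (0, 1) = (0 : Fin (2 * p + 1)).succ := Fin.ext (by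
      rw [pairIndex_val, Fin.val_succ, Fin.val_zero]; rfl)
    obtain ⟨j, hj⟩ := Fin.exists_succ_eq.2 he
    have e0 : v ((Equiv.Perm.decomposeFin.symm ((0 : Fin (2 * p + 1 + 1)), e))
        (pairIndex (p + 1) (0, 0))) = u := by
      rw [i0, Equiv.Perm.decomposeFin_symm_apply_zero]
      rfl
    have e1 : v ((Equiv.Perm.decomposeFin.symm ((0 : Fin (2 * p + 1 + 1)), e))
        (pairIndex (p + 1) (0, 1))) = w j := by
      rw [i1, Equiv.Perm.decomposeFin_symm_apply_succ, Equiv.swap_self, Equiv.refl_apply, ← hj]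
      rfl
    have e2 : a ![v ((Equiv.Perm.decomposeFin.symm ((0 : Fin (2 * p + 1 + 1)), e))
        (pairIndex (p + 1) (0, 0))), v ((Equiv.Perm.decomposeFin.symm
        ((0 : Fin (2 * p + 1 + 1)), e)) (pairIndex (p + 1) (0, 1)))] = 0 := by
      rw [e0, e1, hu]
    rw [e2]
    simp
  have hfix : ∀ τ : Equiv.Perm (Fin (2 * p)), pfTerm a (p + 1) v
      (Equiv.Perm.decomposeFin.symm (0, Equiv.Perm.decomposeFin.symm (0, τ))) =
      a ![u, u'] * pfTerm a p w τ := by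
    intro τ
    set ρ : Equiv.Perm (Fin (2 * (p + 1))) :=
      Equiv.Perm.decomposeFin.symm ((0 : Fin (2 * p + 1 + 1)), Equiv.Perm.decomposeFin.symm (0, τ))
      with hρ
    have r0 : v (ρ (pairIndex (p + 1) (0, 0))) = u := by
      rw [show pairIndex (p + 1) (0, 0) = (0 : Fin (2 * p + 1 + 1)) from rfl, hρ,
        Equiv.Perm.decomposeFin_symm_apply_zero]
      rfl
    have r1 : v (ρ (pairIndex (p + 1) (0, 1))) = u' := by
      rw [show pairIndex (p + 1) (0, 1) = (0 : Fin (2 * p + 1)).succ from Fin.ext (by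
        rw [pairIndex_val, Fin.val_succ, Fin.val_zero]; rfl), hρ, Equiv.Perm.decomposeFin_symm_apply_succ,
        Equiv.Perm.decomposeFin_symm_apply_zero, Equiv.swap_self]
      rfl
    have r2 : ∀ (i : Fin p) (b : Fin 2), v (ρ (pairIndex (p + 1) (i.succ, b))) =
        w (τ (pairIndex p (i, b))) := by
      intro i b
      rw [show pairIndex (p + 1) (i.succ, b) = (pairIndex p (i, b)).succ.succ from Fin.ext (by
        simp only [pairIndex_val, Fin.val_succ]; ring), hρ,
        Equiv.Perm.decomposeFin_symm_apply_succ, Equiv.Perm.decomposeFin_symm_apply_succ,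
        Equiv.swap_self, Equiv.swap_self]
      rfl
    unfold pfTerm
    rw [Fin.prod_univ_succ]
    simp only [r0, r1, r2]
    have hsg : Equiv.Perm.sign ρ = Equiv.Perm.sign τ := by
      rw [hρ, Equiv.Perm.decomposeFin.symm_sign, Equiv.Perm.decomposeFin.symm_sign]
      simp
    rw [hsg]
    ring
  have hinner : (∑ σ : Equiv.Perm (Fin (2 * (p + 1))),
      if σ 0 = 0 then pfTerm a (p + 1) v σ else 0) = a ![u, u'] * ∑ τ, pfTerm a p w τ := by
    have step := sum_perm_fin_succ (n := 2 * p + 1)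
      fun σ => if σ 0 = 0 then pfTerm a (p + 1) v σ else 0
    refine step.trans ?_
    rw [Fintype.sum_eq_single 0]
    · simp only [Equiv.Perm.decomposeFin_symm_apply_zero, if_true]
      rw [sum_perm_fin_succ, Fintype.sum_eq_single 0]
      · simp only [hfix]
        rw [Finset.mul_sum]
      · intro q hq
        refine Finset.sum_eq_zero fun e _ => hzero _ ?_
        rwa [Equiv.Perm.decomposeFin_symm_apply_zero]
    · intro q hq
      refine Finset.sum_eq_zero fun e _ => ?_
      rw [Equiv.Perm.decomposeFin_symm_apply_zero, if_neg hq]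
  have h1 := wedgePow_apply a (p + 1) v
  have h2 := wedgePow_apply a p w
  change _ = _ * ∑ σ, pfTerm a (p + 1) v σ at h1
  change _ = _ * ∑ σ, pfTerm a p w σ at h2
  rw [h1, h2, hsum, hinner, pow_succ]
  field_simp

theorem wedgePow_one_apply (a : E [⋀^Fin 2]→L[ℝ] ℝ) : wedgePow a 1 = a := by
  ext v
  have h := wedgePow_succ_of_orthogonal a 0 (v 0) (v 1) Fin.elim0 fun i => i.elim0
  have hv : (Fin.cons (v 0) (Fin.cons (v 1) Fin.elim0 : Fin 1 → E) : Fin 2 → E) = v := by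
    funext i
    fin_cases i <;> rfl
  have hv2 : ![v 0, v 1] = v := by
    funext i
    fin_cases i <;> rfl
  rw [hv2] at h
  have h0 : wedgePow a 0 (Fin.elim0 : Fin (2 * 0) → E) = 1 := rfl
  rw [h0] at h
  have h2 : wedgePow a (0 + 1) v = wedgePow a 1 v := rfl
  calc wedgePow a 1 v = wedgePow a (0 + 1)
        (Fin.cons (v 0) (Fin.cons (v 1) Fin.elim0 : Fin 1 → E) : Fin 2 → E) := by rw [hv]
    _ = a v := by
      refine h.trans ?_
      simp

theorem wedgePow_two (a : E [⋀^Fin 2]→L[ℝ] ℝ) : wedgePow a 2 = wedge a a := by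
  show wedge (wedgePow a 1) a = wedge a a
  rw [wedgePow_one_apply]

/-- The `n` mutually orthogonal pairs are peeled off one at a time with
`wedgePow_succ_of_orthogonal`. The coefficients `p, p-1, …, i+1` multiply to `p!/i!`. This factorial
is the source of the constants in the comparison of the S-forms. -/
theorem contract_wedgePow_of_orthogonal (a : E [⋀^Fin 2]→L[ℝ] ℝ) (n p i : ℕ)
    (h : 2 * p = 2 * i + 2 * n) (q : Fin (2 * n) → E) (w : Fin (2 * i) → E)
    (hq : ∀ k l : Fin n, k ≠ l → ∀ b c, a ![q (pairIndex n (k, b)), q (pairIndex n (l, c))] = 0)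
    (hw : ∀ k l, a ![q k, w l] = 0) :
    contract (2 * n) q (castDegree h (wedgePow a p)) w =
      (p.factorial / i.factorial : ℝ) *
        (∏ k : Fin n, a ![q (pairIndex n (k, 0)), q (pairIndex n (k, 1))]) * wedgePow a i w := by
  induction n generalizing p with
  | zero =>
    obtain rfl : p = i := by omega
    have hp : (p.factorial : ℝ) ≠ 0 := by positivity
    show wedgePow a p w = _
    rw [div_self hp]
    simp
  | succ n ih =>
    obtain ⟨p, rfl⟩ : ∃ p', p = p' + 1 := ⟨p - 1, by omega⟩
    have h' : 2 * p = 2 * i + 2 * n := by omega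
    have hrec := ih p h' (fun x => q (x.succ.succ : Fin (2 * n + 1 + 1)))
      (fun k l hkl b c => by
        have := hq k.succ l.succ (fun h => hkl (Fin.succ_injective _ h)) b c
        have e : ∀ (k : Fin n) (b : Fin 2), pairIndex (n + 1) (k.succ, b) =
            ((pairIndex n (k, b)).succ.succ : Fin (2 * n + 1 + 1)) := fun k b => Fin.ext (by
          simp only [pairIndex_val, Fin.val_succ]; ring)
        rwa [e, e] at this)
      (fun k l => hw _ l)
    rw [contract_apply, castDegree_apply] at hrec ⊢
    set w' : Fin (2 * p) → E := fun x =>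
      Fin.append (fun x => q (x.succ.succ : Fin (2 * n + 1 + 1))) w
        (Fin.cast (Nat.add_comm (2 * i) (2 * n)) (Fin.cast h' x)) with hw'
    have htup : (fun x : Fin (2 * (p + 1)) => Fin.append q w
        (Fin.cast (Nat.add_comm (2 * i) (2 * (n + 1))) (Fin.cast h x))) =
        (Fin.cons (q (0 : Fin (2 * n + 1 + 1)))
          (Fin.cons (q (0 : Fin (2 * n + 1)).succ) w') : Fin (2 * p + 1 + 1) → E) := by
      funext x
      refine Fin.cases ?_ (fun x => ?_) (x : Fin (2 * p + 1 + 1))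
      · rw [Fin.cons_zero]
        exact Fin.append_left q w (0 : Fin (2 * n + 1 + 1))
      refine Fin.cases ?_ (fun x => ?_) x
      · rw [Fin.cons_succ, Fin.cons_zero]
        have e1 : Fin.cast (Nat.add_comm (2 * i) (2 * (n + 1))) (Fin.cast h
            ((0 : Fin (2 * p + 1)).succ : Fin (2 * p + 1 + 1))) =
            Fin.castAdd (2 * i) ((0 : Fin (2 * n + 1)).succ : Fin (2 * n + 1 + 1)) := Fin.ext (by
          simp only [Fin.val_cast, Fin.val_castAdd, Fin.val_succ, Fin.val_zero])
        rw [e1, Fin.append_left]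
      · rw [Fin.cons_succ, Fin.cons_succ, hw']
        dsimp only
        by_cases hx : (x : ℕ) < 2 * n
        · have e1 : Fin.cast (Nat.add_comm (2 * i) (2 * (n + 1))) (Fin.cast h
              (x.succ.succ : Fin (2 * p + 1 + 1))) =
              Fin.castAdd (2 * i) (⟨x + 2, by omega⟩ : Fin (2 * n + 1 + 1)) := Fin.ext (by simp)
          have e2 : Fin.cast (Nat.add_comm (2 * i) (2 * n)) (Fin.cast h' x) =
              Fin.castAdd (2 * i) ⟨x, hx⟩ := Fin.ext (by simp)
          rw [e1, e2, Fin.append_left, Fin.append_left]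
          rfl
        · have hx2 : (x : ℕ) < 2 * p := x.isLt
          have e1 : Fin.cast (Nat.add_comm (2 * i) (2 * (n + 1))) (Fin.cast h
              (x.succ.succ : Fin (2 * p + 1 + 1))) =
              Fin.natAdd (2 * n + 1 + 1) ⟨x - 2 * n, by omega⟩ := Fin.ext (by simp; omega)
          have e2 : Fin.cast (Nat.add_comm (2 * i) (2 * n)) (Fin.cast h' x) =
              Fin.natAdd (2 * n) ⟨x - 2 * n, by omega⟩ := Fin.ext (by simp; omega)
          rw [e1, e2, Fin.append_right]
          exact Fin.append_right q w _
    rw [htup]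
    have horth : ∀ x, a ![q (0 : Fin (2 * n + 1 + 1)), w' x] = 0 := by
      intro x
      rw [hw']
      dsimp only
      refine Fin.addCases (fun y => ?_) (fun y => ?_)
        (Fin.cast (Nat.add_comm (2 * i) (2 * n)) (Fin.cast h' x))
      · rw [Fin.append_left]
        obtain ⟨⟨k, b⟩, rfl⟩ := (pairIndex n).surjective y
        have := hq 0 k.succ (Fin.succ_ne_zero k).symm 0 b
        have e : pairIndex (n + 1) (k.succ, b) =
            ((pairIndex n (k, b)).succ.succ : Fin (2 * n + 1 + 1)) := Fin.ext (by
          simp only [pairIndex_val, Fin.val_succ]; ring)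
        rwa [e] at this
      · rw [Fin.append_right]
        exact hw _ _
    rw [wedgePow_succ_of_orthogonal a p _ _ w' horth, hrec, Fin.prod_univ_succ]
    have e : ∀ (k : Fin n) (b : Fin 2), pairIndex (n + 1) (k.succ, b) =
        ((pairIndex n (k, b)).succ.succ : Fin (2 * n + 1 + 1)) := fun k b => Fin.ext (by
      simp only [pairIndex_val, Fin.val_succ]; ring)
    have e0 : pairIndex (n + 1) (0, 0) = (0 : Fin (2 * n + 1 + 1)) := rfl
    have e1 : pairIndex (n + 1) (0, 1) = (0 : Fin (2 * n + 1)).succ := Fin.ext (by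
      rw [pairIndex_val, Fin.val_succ, Fin.val_zero]; rfl)
    simp only [e, e0, e1, Nat.factorial_succ]
    push_cast
    ring

/-! ### Forms of the kind `A (b_1, …, b_j, ·)` -/

/-- In the multilinear expansion of `B (w' + (w - w'))`, every term other than `B w'` has an
argument in `W`. -/
theorem alternating_congr_of_sub_mem {k : ℕ} (B : E [⋀^Fin k]→L[ℝ] ℝ) (W : Submodule ℝ E)
    (hB : ∀ (w : Fin k → E) (l : Fin k), w l ∈ W → B w = 0) (w w' : Fin k → E)
    (h : ∀ l, w l - w' l ∈ W) : B w = B w' := by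
  have hw : w = w' + fun l => w l - w' l := by
    funext l
    simp
  rw [hw, B.map_add_univ, Finset.sum_eq_single Finset.univ]
  · simp
  · intro s _ hs
    obtain ⟨l, hl⟩ : ∃ l, l ∉ s := by
      by_contra! hcon
      exact hs (Finset.eq_univ_iff_forall.2 hcon)
    refine hB _ l ?_
    rw [Finset.piecewise_eq_of_notMem _ _ _ hl]
    exact h l
  · simp

theorem contract_eq_zero_of_mem_span {k : ℕ} (j : ℕ) (b : Fin j → E)
    (A : E [⋀^Fin (k + j)]→L[ℝ] ℝ) (w : Fin k → E) (l : Fin k)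
    (hl : w l ∈ Submodule.span ℝ (Set.range b)) : contract j b A w = 0 := by
  have key : ∀ x ∈ Submodule.span ℝ (Set.range b),
      contract j b A (Function.update w l x) = 0 := by
    intro x hx
    induction hx using Submodule.span_induction with
    | mem x hx =>
      obtain ⟨i, rfl⟩ := hx
      rw [contract_apply]
      refine A.map_eq_zero_of_eq _
        (i := Fin.cast (Nat.add_comm j k) (Fin.castAdd k i))
        (j := Fin.cast (Nat.add_comm j k) (Fin.natAdd j l)) ?_ ?_
      · simp
      · intro h
        have := congrArg Fin.val h
        simp at this
        omega
    | zero => exact ContinuousAlternatingMap.map_update_zero _ _ _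
    | add x y _ _ hx hy => rw [ContinuousAlternatingMap.map_update_add, hx, hy, add_zero]
    | smul c x _ hx => rw [ContinuousAlternatingMap.map_update_smul, hx, smul_zero]
  have := key _ hl
  rwa [Function.update_eq_self] at this

/-- Once all fibre directions are inserted, only the projection of the other vectors to the base
matters. A vector of the base may thus be replaced by its horizontal lift. -/
theorem contract_congr {k : ℕ} (j : ℕ) (b : Fin j → E) (A : E [⋀^Fin (k + j)]→L[ℝ] ℝ)
    (w w' : Fin k → E) (h : ∀ l, w l - w' l ∈ Submodule.span ℝ (Set.range b)) :
    contract j b A w = contract j b A w' :=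
  alternating_congr_of_sub_mem _ _ (fun w l hl => contract_eq_zero_of_mem_span j b A w l hl) w w' h

/-- `contract j b A w` as an alternating function of `b`. -/
def contractFirst {k j : ℕ} (A : E [⋀^Fin (k + j)]→L[ℝ] ℝ) (w : Fin k → E) :
    E [⋀^Fin j]→ₗ[ℝ] ℝ where
  toFun b := contract j b A w
  map_update_add' := by
    intro inst b i x y
    obtain rfl : inst = instDecidableEqFin _ := Subsingleton.elim _ _
    have h : ∀ z, (fun l => Fin.append (Function.update b i z) w (Fin.cast (Nat.add_comm k j) l)) =
        Function.update (fun l => Fin.append b w (Fin.cast (Nat.add_comm k j) l))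
          (Fin.cast (Nat.add_comm j k) (Fin.castAdd k i)) z := by
      intro z
      funext l
      obtain ⟨l, rfl⟩ := (finCongr (Nat.add_comm j k)).surjective l
      refine Fin.addCases (fun l => ?_) (fun l => ?_) l
      · by_cases hl : l = i
        · subst hl
          simp
        · simp [hl]
      · simp [Function.update_apply, Fin.ext_iff]
        omega
    simp only [contract_apply, h, ContinuousAlternatingMap.map_update_add]
  map_update_smul' := by
    intro inst b i c x
    obtain rfl : inst = instDecidableEqFin _ := Subsingleton.elim _ _
    have h : ∀ z, (fun l => Fin.append (Function.update b i z) w (Fin.cast (Nat.add_comm k j) l)) =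
        Function.update (fun l => Fin.append b w (Fin.cast (Nat.add_comm k j) l))
          (Fin.cast (Nat.add_comm j k) (Fin.castAdd k i)) z := by
      intro z
      funext l
      obtain ⟨l, rfl⟩ := (finCongr (Nat.add_comm j k)).surjective l
      refine Fin.addCases (fun l => ?_) (fun l => ?_) l
      · by_cases hl : l = i
        · subst hl
          simp
        · simp [hl]
      · simp [Function.update_apply, Fin.ext_iff]
        omega
    simp only [contract_apply, h, ContinuousAlternatingMap.map_update_smul]
  map_eq_zero_of_eq' := by
    intro b i i' hb hi
    rw [contract_apply]
    refine A.map_eq_zero_of_eq _ (i := Fin.cast (Nat.add_comm j k) (Fin.castAdd k i))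
      (j := Fin.cast (Nat.add_comm j k) (Fin.castAdd k i')) ?_ ?_
    · simpa using hb
    · intro h
      exact hi (Fin.ext (by simpa using congrArg Fin.val h))

theorem contract_comp {k : ℕ} (j : ℕ) (b : Fin j → F) (A : E [⋀^Fin (k + j)]→L[ℝ] ℝ)
    (f : F →L[ℝ] E) (w : Fin k → F) :
    contract j b (A.compContinuousLinearMap f) w =
      contract j (fun i => f (b i)) A (fun l => f (w l)) := by
  rw [contract_apply, contract_apply, ContinuousAlternatingMap.compContinuousLinearMap_apply]
  congr 1
  funext i
  simp only [Function.comp_apply]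
  refine Fin.addCases (fun l => ?_) (fun l => ?_) (Fin.cast (Nat.add_comm k j) i)
  · simp
  · simp

/-! ### The standard real basis of `ℂ^d` -/

/-- `realBasis` as a basis. -/
def realBasisBasis (d : ℕ) : Module.Basis (Fin (2 * d)) ℝ (CVec d) :=
  (Pi.basis fun _ : Fin d => Complex.basisOneI).reindex
    ((Equiv.sigmaEquivProd (Fin d) (Fin 2)).trans (pairIndex d))

theorem realBasis_pairIndex (d : ℕ) (i : Fin d) (b : Fin 2) :
    realBasis d (pairIndex d (i, b)) = Pi.single i (if b = 0 then 1 else Complex.I) := by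
  unfold realBasis
  have h1 : (⟨(pairIndex d (i, b) : ℕ) / 2, by omega⟩ : Fin d) = i := Fin.ext (by
    show (pairIndex d (i, b) : ℕ) / 2 = i
    rw [pairIndex_val]; omega)
  have h2 : (pairIndex d (i, b) : ℕ) % 2 = 0 ↔ b = 0 := by
    rw [pairIndex_val]
    fin_cases b <;> simp
  rw [h1]
  simp only [h2]

theorem coe_realBasisBasis (d : ℕ) : ⇑(realBasisBasis d) = realBasis d := by
  funext k
  obtain ⟨⟨i, b⟩, rfl⟩ := (pairIndex d).surjective k
  rw [realBasis_pairIndex]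
  unfold realBasisBasis
  rw [Module.Basis.reindex_apply]
  have : ((Equiv.sigmaEquivProd (Fin d) (Fin 2)).trans (pairIndex d)).symm (pairIndex d (i, b)) =
      ⟨i, b⟩ := by
    simp
  rw [this, Pi.basis_apply]
  congr 1
  fin_cases b <;> simp

/-- A form of top degree is a multiple of the determinant in the given basis. -/
theorem alternating_map_realBasis {d : ℕ} (f : CVec d [⋀^Fin (2 * d)]→ₗ[ℝ] ℝ)
    (L : CVec d →ₗ[ℝ] CVec d) :
    f (fun i => L (realBasis d i)) = LinearMap.det L * f (realBasis d) := by
  rw [← coe_realBasisBasis]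
  conv_lhs => rw [f.eq_smul_basis_det (realBasisBasis d)]
  have := (realBasisBasis d).det_comp L (realBasisBasis d)
  rw [Module.Basis.det_self, mul_one] at this
  rw [AlternatingMap.smul_apply, show (fun i => L (realBasisBasis d i)) = L ∘ realBasisBasis d
    from rfl, this, smul_eq_mul, mul_comm]

/-- The real determinant of a complex-linear map is the squared modulus of its complex determinant.
All statements about orientation rest on this. -/
theorem det_restrictScalars_pos {V : Type*} [AddCommGroup V] [Module ℂ V] [Module ℝ V]
    [IsScalarTower ℝ ℂ V] [FiniteDimensional ℂ V] (L : V →ₗ[ℂ] V) (hL : LinearMap.det L ≠ 0) :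
    0 < LinearMap.det (L.restrictScalars ℝ) := by
  rw [LinearMap.det_restrictScalars, Algebra.norm_complex_apply]
  exact Complex.normSq_pos.2 hL

end AlternatingAlgebra

end

/-! ### Real (1,1)-forms: Hermitian coefficients, horizontal splitting, intersection form. -/

section

section Hermitian

variable {E : Type*} [NormedAddCommGroup E] [NormedSpace ℂ E] [NormedSpace ℝ E]
  [IsScalarTower ℝ ℂ E]

/-- A real two-form is of type `(1,1)` when it is invariant under multiplication by `i`. -/
def IsTypeOneOne (a : E [⋀^Fin 2]→L[ℝ] ℝ) : Prop :=
  ∀ u v : E, a ![Complex.I • u, Complex.I • v] = a ![u, v]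

section TwoForm

variable {V : Type*} [NormedAddCommGroup V] [NormedSpace ℝ V]

theorem two_form_add_left (a : V [⋀^Fin 2]→L[ℝ] ℝ) (u u' v : V) :
    a ![u + u', v] = a ![u, v] + a ![u', v] := a.vecCons_add ![v] u u'

theorem two_form_smul_left (a : V [⋀^Fin 2]→L[ℝ] ℝ) (c : ℝ) (u v : V) :
    a ![c • u, v] = c * a ![u, v] := a.vecCons_smul ![v] c u

theorem two_form_smul_right (a : V [⋀^Fin 2]→L[ℝ] ℝ) (c : ℝ) (u v : V) :
    a ![u, c • v] = c * a ![u, v] := by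
  rw [two_form_swap, two_form_smul_left, two_form_swap a v]
  ring

end TwoForm

variable {a : E [⋀^Fin 2]→L[ℝ] ℝ}

theorem IsTypeOneOne.I_left (ha : IsTypeOneOne a) (u v : E) :
    a ![Complex.I • u, v] = -a ![u, Complex.I • v] := by
  have h := ha u (Complex.I • v)
  rw [smul_smul, Complex.I_mul_I, neg_one_smul] at h
  have h2 := two_form_smul_right a (-1) (Complex.I • u) v
  rw [neg_one_smul] at h2
  linarith

theorem hermCoeff_add_left (a : E [⋀^Fin 2]→L[ℝ] ℝ) (u u' v : E) :
    hermCoeff a (u + u') v = hermCoeff a u v + hermCoeff a u' v := by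
  simp only [hermCoeff, two_form_add_left]
  push_cast
  ring

theorem complex_smul_eq (c : ℂ) (u : E) : c • u = c.re • u + c.im • (Complex.I • u) := by
  have h : ∀ (r : ℝ) (w : E), r • w = (r : ℂ) • w := fun r w => by
    rw [← smul_one_smul ℂ r w, Complex.real_smul, mul_one]
  rw [h, h, smul_smul, ← add_smul, Complex.re_add_im]

/-- Additivity in the first argument holds for every real two-form; linearity over `ℂ` is where type
(1,1) is needed. -/
theorem hermCoeff_smul_left (ha : IsTypeOneOne a) (c : ℂ) (u v : E) :
    hermCoeff a (c • u) v = c * hermCoeff a u v := by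
  have h1 : a ![c • u, v] = c.re * a ![u, v] - c.im * a ![u, Complex.I • v] := by
    rw [complex_smul_eq, two_form_add_left, two_form_smul_left, two_form_smul_left, ha.I_left]
    ring
  have h2 : a ![c • u, Complex.I • v] = c.re * a ![u, Complex.I • v] + c.im * a ![u, v] := by
    rw [complex_smul_eq, two_form_add_left, two_form_smul_left, two_form_smul_left, ha]
  simp only [hermCoeff, h1, h2]
  apply Complex.ext
  · simp
    ring
  · simp
    ring

theorem hermCoeff_conj (ha : IsTypeOneOne a) (u v : E) :
    (starRingEnd ℂ) (hermCoeff a u v) = hermCoeff a v u := by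
  have h1 : a ![v, Complex.I • u] = a ![u, Complex.I • v] := by
    rw [two_form_swap, ha.I_left]
    ring
  have h2 : (starRingEnd ℂ) 2 = 2 := Complex.conj_ofNat 2
  simp only [hermCoeff, h1, two_form_swap a v u, map_div₀, h2]
  apply Complex.ext <;> simp

theorem hermCoeff_zero_left (a : E [⋀^Fin 2]→L[ℝ] ℝ) (v : E) : hermCoeff a 0 v = 0 := by
  have := hermCoeff_add_left a 0 0 v
  rw [add_zero] at this
  simpa using this

theorem hermCoeff_sum_left {ι : Type*} (s : Finset ι) (f : ι → E) (v : E) :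
    hermCoeff a (∑ i ∈ s, f i) v = ∑ i ∈ s, hermCoeff a (f i) v := by
  classical
  induction s using Finset.induction_on with
  | empty => simp [hermCoeff_zero_left]
  | insert i s hi ih => rw [Finset.sum_insert hi, Finset.sum_insert hi, hermCoeff_add_left, ih]

theorem hermCoeff_add_right (ha : IsTypeOneOne a) (u v v' : E) :
    hermCoeff a u (v + v') = hermCoeff a u v + hermCoeff a u v' := by
  rw [← hermCoeff_conj ha, hermCoeff_add_left, map_add, hermCoeff_conj ha, hermCoeff_conj ha]

theorem hermCoeff_smul_right (ha : IsTypeOneOne a) (c : ℂ) (u v : E) :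
    hermCoeff a u (c • v) = (starRingEnd ℂ) c * hermCoeff a u v := by
  rw [← hermCoeff_conj ha, hermCoeff_smul_left ha, map_mul, hermCoeff_conj ha]

theorem hermCoeff_sum_right (ha : IsTypeOneOne a) {ι : Type*} (s : Finset ι) (u : E) (f : ι → E) :
    hermCoeff a u (∑ i ∈ s, f i) = ∑ i ∈ s, hermCoeff a u (f i) := by
  rw [← hermCoeff_conj ha, hermCoeff_sum_left, map_sum]
  simp only [hermCoeff_conj ha]

theorem hermCoeff_self (a : E [⋀^Fin 2]→L[ℝ] ℝ) (u : E) :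
    hermCoeff a u u = ((a ![u, Complex.I • u] / 2 : ℝ) : ℂ) := by
  simp only [hermCoeff, two_form_self]
  push_cast
  ring

theorem two_form_eq_im_hermCoeff (a : E [⋀^Fin 2]→L[ℝ] ℝ) (u v : E) :
    a ![u, v] = -2 * (hermCoeff a u v).im := by
  simp [hermCoeff]
  ring

theorem two_form_eq_re_hermCoeff (a : E [⋀^Fin 2]→L[ℝ] ℝ) (u v : E) :
    a ![u, Complex.I • v] = 2 * (hermCoeff a u v).re := by
  simp [hermCoeff]
  ring

theorem IsTypeOneOne.comp {E' : Type*} [NormedAddCommGroup E'] [NormedSpace ℂ E']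
    [NormedSpace ℝ E'] (ha : IsTypeOneOne a) (f : E' →L[ℝ] E)
    (hf : ∀ v, f (Complex.I • v) = Complex.I • f v) :
    IsTypeOneOne (a.compContinuousLinearMap f) := by
  intro u v
  have := ha (f u) (f v)
  have e : ∀ x y : E', a.compContinuousLinearMap f ![x, y] = a ![f x, f y] := fun x y => by
    rw [ContinuousAlternatingMap.compContinuousLinearMap_apply]
    congr 1
    funext i
    fin_cases i <;> rfl
  rw [e, e, hf, hf, this]

theorem two_form_comp_apply {V W : Type*} [NormedAddCommGroup V] [NormedSpace ℝ V]
    [NormedAddCommGroup W] [NormedSpace ℝ W] (a : V [⋀^Fin 2]→L[ℝ] ℝ) (f : W →L[ℝ] V) (x y : W) :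
    a.compContinuousLinearMap f ![x, y] = a ![f x, f y] := by
  rw [ContinuousAlternatingMap.compContinuousLinearMap_apply]
  congr 1
  funext i
  fin_cases i <;> rfl

end Hermitian

/-! ### Orthogonal bases -/

theorem exists_orthogonal_basis {V : Type*} [AddCommGroup V] [Module ℂ V] [FiniteDimensional ℂ V]
    (c : InnerProductSpace.Core ℂ V) :
    ∃ b : Module.Basis (Fin (Module.finrank ℂ V)) ℂ V, ∀ i j, i ≠ j → c.inner (b i) (b j) = 0 := by
  let _ : NormedAddCommGroup V := c.toNormedAddCommGroup
  let _ : InnerProductSpace ℂ V := InnerProductSpace.ofCore c.toCore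
  let b := stdOrthonormalBasis ℂ V
  refine ⟨b.toBasis, fun i j hij => ?_⟩
  have := b.orthonormal.2 hij
  rw [OrthonormalBasis.coe_toBasis]
  exact this

/-- An orthogonal basis of the Hermitian inner product defined by `a`, presented as a complex-linear
map, because its real determinant is then positive and measures the change of frame. -/
theorem exists_orthogonal_linearMap {n : ℕ} (a : CVec n [⋀^Fin 2]→L[ℝ] ℝ) (ha : IsTypeOneOne a)
    (hpos : ∀ v : CVec n, v ≠ 0 → 0 < a ![v, Complex.I • v]) :
    ∃ L : CVec n →ₗ[ℂ] CVec n, LinearMap.det L ≠ 0 ∧ ∀ k l : Fin n, k ≠ l →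
      hermCoeff a (L (Pi.single k 1)) (L (Pi.single l 1)) = 0 := by
  let c : InnerProductSpace.Core ℂ (CVec n) :=
    -- The arguments are exchanged because `hermCoeff` is conjugate-linear in the second one and
    -- `inner` in the first one.
    { inner := fun x y => hermCoeff a y x
      conj_inner_symm := fun x y => hermCoeff_conj ha x y
      re_inner_nonneg := fun x => by
        show 0 ≤ (hermCoeff a x x).re
        rw [hermCoeff_self _, Complex.ofReal_re]
        rcases eq_or_ne x 0 with rfl | hx
        · rw [smul_zero, two_form_self]
          simp
        · have := hpos x hx
          linarith
      add_left := fun x y z => hermCoeff_add_right ha z x y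
      smul_left := fun x y r => hermCoeff_smul_right ha r y x
      definite := fun x hx => by
        by_contra hne
        have h1 : hermCoeff a x x = 0 := hx
        rw [hermCoeff_self _, Complex.ofReal_eq_zero] at h1
        have := hpos x hne
        linarith }
  obtain ⟨b, hb⟩ := exists_orthogonal_basis c
  have hfin : Module.finrank ℂ (CVec n) = n := by simp
  let b' : Module.Basis (Fin n) ℂ (CVec n) := b.reindex (finCongr hfin)
  let L : CVec n ≃ₗ[ℂ] CVec n := (Pi.basisFun ℂ (Fin n)).equiv b' (Equiv.refl _)
  refine ⟨L, (LinearEquiv.isUnit_det' L).ne_zero, fun k l hkl => ?_⟩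
  have hL : ∀ k, L (Pi.single k 1) = b' k := fun k => by
    have := (Pi.basisFun ℂ (Fin n)).equiv_apply k b' (Equiv.refl _)
    rwa [Pi.basisFun_apply] at this
  show hermCoeff a (L (Pi.single k 1)) (L (Pi.single l 1)) = 0
  rw [hL, hL, Module.Basis.reindex_apply, Module.Basis.reindex_apply]
  exact hb _ _ fun h => hkl ((finCongr hfin).symm.injective h).symm

/-! ### Horizontal lift -/

section Horizontal

variable {m n : ℕ}

/-- The coefficients of the `(1,1)`-form in the directions of `z` and `v`. -/
def mixedMatrix (a : (CVec m × CVec n) [⋀^Fin 2]→L[ℝ] ℝ) : Matrix (Fin m) (Fin n) ℂ :=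
  Matrix.of fun α j => hermCoeff a (Pi.single α 1, 0) (0, Pi.single j 1)

/-- The coefficients of the `(1,1)`-form in the directions of `v`. -/
def fibreMatrix (a : (CVec m × CVec n) [⋀^Fin 2]→L[ℝ] ℝ) : Matrix (Fin n) (Fin n) ℂ :=
  Matrix.of fun i j => hermCoeff a (0, Pi.single i 1) (0, Pi.single j 1)

/-- The horizontal lift `w ↦ (w, -w B D⁻¹)`, as a complex-linear map. -/
def horizontalLift (a : (CVec m × CVec n) [⋀^Fin 2]→L[ℝ] ℝ) : CVec m →L[ℂ] CVec m × CVec n :=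
  LinearMap.toContinuousLinearMap
    (LinearMap.prod LinearMap.id (-(mixedMatrix a * (fibreMatrix a)⁻¹).vecMulLinear))

theorem horizontalLift_apply (a : (CVec m × CVec n) [⋀^Fin 2]→L[ℝ] ℝ) (w : CVec m) :
    horizontalLift a w = (w, -(Matrix.vecMul w (mixedMatrix a * (fibreMatrix a)⁻¹))) := rfl

variable {a : (CVec m × CVec n) [⋀^Fin 2]→L[ℝ] ℝ}

theorem prod_eq_sum (w : CVec m) (x : CVec n) : ((w, x) : CVec m × CVec n) =
    ∑ α, w α • ((Pi.single α 1, 0) : CVec m × CVec n)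
      + ∑ i, x i • ((0, Pi.single i 1) : CVec m × CVec n) := by
  refine Prod.ext ?_ ?_
  · funext β
    simp [Prod.fst_sum, Finset.sum_apply, Pi.single_apply]
  · funext β
    simp [Prod.snd_sum, Finset.sum_apply, Pi.single_apply]

theorem hermCoeff_vertical_right (ha : IsTypeOneOne a) (w : CVec m) (x : CVec n) (j : Fin n) :
    hermCoeff a (w, x) (0, Pi.single j 1) =
      Matrix.vecMul w (mixedMatrix a) j + Matrix.vecMul x (fibreMatrix a) j := by
  rw [prod_eq_sum w x, hermCoeff_add_left, hermCoeff_sum_left, hermCoeff_sum_left]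
  simp only [hermCoeff_smul_left ha]
  rfl

/-- A left null vector of the fibre matrix would be a nonzero vertical vector of length zero. -/
theorem det_fibreMatrix_ne_zero (ha : IsTypeOneOne a)
    (hpos : ∀ v : CVec n, v ≠ 0 →
      0 < a ![((0, v) : CVec m × CVec n), Complex.I • ((0, v) : CVec m × CVec n)]) :
    (fibreMatrix a).det ≠ 0 := by
  intro hdet
  obtain ⟨x, hx, hxD⟩ := Matrix.exists_vecMul_eq_zero_iff.2 hdet
  have h0 : hermCoeff a ((0, x) : CVec m × CVec n) (0, x) = 0 := by
    have e : ((0, x) : CVec m × CVec n) = ∑ i, x i • ((0, Pi.single i 1) : CVec m × CVec n) := by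
      rw [prod_eq_sum 0 x]
      simp
    conv_lhs => rw [show hermCoeff a ((0, x) : CVec m × CVec n) (0, x) =
      hermCoeff a ((0, x) : CVec m × CVec n) (∑ i, x i • ((0, Pi.single i 1) : CVec m × CVec n))
      from by rw [← e]]
    rw [hermCoeff_sum_right ha]
    refine Finset.sum_eq_zero fun j _ => ?_
    rw [hermCoeff_smul_right ha, hermCoeff_vertical_right ha, hxD]
    simp
  rw [hermCoeff_self _, Complex.ofReal_eq_zero] at h0
  have := hpos x hx
  linarith

/-- The vertical component of the lift is chosen so that `w B - w B D⁻¹ D = 0`. -/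
theorem hermCoeff_horizontalLift (ha : IsTypeOneOne a) (hdet : (fibreMatrix a).det ≠ 0)
    (w : CVec m) (x : CVec n) : hermCoeff a (horizontalLift a w) (0, x) = 0 := by
  have e : ((0, x) : CVec m × CVec n) = ∑ i, x i • ((0, Pi.single i 1) : CVec m × CVec n) := by
    rw [prod_eq_sum 0 x]
    simp
  rw [e, hermCoeff_sum_right ha]
  refine Finset.sum_eq_zero fun j _ => ?_
  rw [hermCoeff_smul_right ha, horizontalLift_apply, hermCoeff_vertical_right ha,
    Matrix.neg_vecMul, Matrix.vecMul_vecMul, Matrix.mul_assoc,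
    Matrix.nonsing_inv_mul _ (isUnit_iff_ne_zero.2 hdet), Matrix.mul_one]
  simp

/-- The Schur complement `A - B D⁻¹ B'` of the coefficient matrix. -/
def schurMatrix (a : (CVec m × CVec n) [⋀^Fin 2]→L[ℝ] ℝ) : Matrix (Fin m) (Fin m) ℂ :=
  (Matrix.of fun α β => hermCoeff a (Pi.single α 1, 0) (Pi.single β 1, 0)) -
    mixedMatrix a * (fibreMatrix a)⁻¹ *
      Matrix.of fun i β => hermCoeff a (0, Pi.single i 1) (Pi.single β 1, 0)

/-- The restriction of the form to the horizontal directions, as a form on the base. -/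
def horizontalForm (a : (CVec m × CVec n) [⋀^Fin 2]→L[ℝ] ℝ) : CVec m [⋀^Fin 2]→L[ℝ] ℝ :=
  a.compContinuousLinearMap ((horizontalLift a).restrictScalars ℝ)

theorem horizontalForm_typeOneOne (ha : IsTypeOneOne a) : IsTypeOneOne (horizontalForm a) :=
  ha.comp _ fun v => (horizontalLift a).map_smul Complex.I v

theorem hermCoeff_horizontalForm (a : (CVec m × CVec n) [⋀^Fin 2]→L[ℝ] ℝ) (w w' : CVec m) :
    hermCoeff (horizontalForm a) w w' =
      hermCoeff a (horizontalLift a w) (horizontalLift a w') := by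
  simp only [hermCoeff, horizontalForm, two_form_comp_apply]
  have : ((horizontalLift a).restrictScalars ℝ) (Complex.I • w') =
    Complex.I • horizontalLift a w' := (horizontalLift a).map_smul Complex.I w'
  rw [this]
  rfl

/-- The lift of a base vector `e_β` differs from `(e_β, 0)` by a vertical vector, to which every
lift is orthogonal. What remains is the pairing of the lift of `e_α` with `(e_β, 0)`, which is the
entry of `A - B D⁻¹ B'`. This identifies the horizontal form with the geodesic curvature. -/
theorem hermCoeff_horizontalForm_single (ha : IsTypeOneOne a) (hdet : (fibreMatrix a).det ≠ 0)
    (α β : Fin m) :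
    hermCoeff (horizontalForm a) (Pi.single α 1) (Pi.single β 1) = schurMatrix a α β := by
  rw [hermCoeff_horizontalForm]
  have e1 : horizontalLift a (Pi.single β 1) = ((Pi.single β 1, 0) : CVec m × CVec n) +
      (0, -(Matrix.vecMul (Pi.single β 1) (mixedMatrix a * (fibreMatrix a)⁻¹))) := by
    rw [horizontalLift_apply]
    simp
  rw [e1, hermCoeff_add_right ha, hermCoeff_horizontalLift ha hdet, add_zero, horizontalLift_apply,
    prod_eq_sum, hermCoeff_add_left, hermCoeff_sum_left, hermCoeff_sum_left]
  simp only [hermCoeff_smul_left ha]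
  rw [Finset.sum_eq_single α]
  · simp only [Pi.single_eq_same, one_mul, Matrix.single_one_vecMul]
    simp [schurMatrix, Matrix.mul_apply (M := mixedMatrix a * (fibreMatrix a)⁻¹), sub_eq_add_neg]
  · intro b _ hb
    rw [Pi.single_eq_of_ne hb, zero_mul]
  · simp

theorem horizontalForm_pos (hpos : ∀ v : CVec m × CVec n, v ≠ 0 → 0 < a ![v, Complex.I • v])
    (w : CVec m) (hw : w ≠ 0) : 0 < horizontalForm a ![w, Complex.I • w] := by
  rw [horizontalForm, two_form_comp_apply]
  have : ((horizontalLift a).restrictScalars ℝ) (Complex.I • w) =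
    Complex.I • horizontalLift a w := (horizontalLift a).map_smul Complex.I w
  rw [this]
  refine hpos _ fun h => hw ?_
  exact congrArg Prod.fst h

theorem span_vertical_realBasis (x : CVec n) : ((0, x) : CVec m × CVec n) ∈
    Submodule.span ℝ (Set.range fun i => ((0 : CVec m), realBasis n i)) := by
  have h : x ∈ Submodule.span ℝ (Set.range (realBasis n)) := by
    rw [← coe_realBasisBasis, Module.Basis.span_eq]
    exact Submodule.mem_top
  have h2 := Submodule.mem_map_of_mem (f := LinearMap.inr ℝ (CVec m) (CVec n)) h
  rw [Submodule.map_span, ← Set.range_comp] at h2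
  exact h2

/-- Contraction with the fibre directions of the powers of a `(1,1)`-form that is positive on the
fibre: they are the powers of its horizontal part, up to one positive density. -/
theorem exists_density_contract_wedgePow (ha : IsTypeOneOne a)
    (hpos : ∀ v : CVec n, v ≠ 0 →
      0 < a ![((0, v) : CVec m × CVec n), Complex.I • ((0, v) : CVec m × CVec n)]) :
    ∃ D : ℝ, 0 < D ∧ ∀ (i : ℕ) (p : ℕ) (h : 2 * p = 2 * i + 2 * n) (w : Fin (2 * i) → CVec m),
      contract (2 * n) (fun j => ((0 : CVec m), realBasis n j)) (castDegree h (wedgePow a p))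
        (fun l => (w l, 0)) = (p.factorial / i.factorial : ℝ) * D * wedgePow (horizontalForm a) i w := by
  have hdet := det_fibreMatrix_ne_zero ha hpos
  set av : CVec n [⋀^Fin 2]→L[ℝ] ℝ :=
    a.compContinuousLinearMap (ContinuousLinearMap.inr ℝ (CVec m) (CVec n)) with hav
  have hI : ∀ v : CVec n, ContinuousLinearMap.inr ℝ (CVec m) (CVec n) (Complex.I • v) =
      Complex.I • ContinuousLinearMap.inr ℝ (CVec m) (CVec n) v := fun v => by
    simp
  have hav1 : IsTypeOneOne av := ha.comp _ hI
  have hav2 : ∀ v : CVec n, v ≠ 0 → 0 < av ![v, Complex.I • v] := by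
    intro v hv
    rw [hav, two_form_comp_apply, hI]
    exact hpos v hv
  obtain ⟨L, hL, horth⟩ := exists_orthogonal_linearMap av hav1 hav2
  have hherm : ∀ x y : CVec n, hermCoeff av x y = hermCoeff a (0, x) (0, y) := by
    intro x y
    simp only [hermCoeff, hav, two_form_comp_apply, hI]
    rfl
  set q : Fin (2 * n) → CVec m × CVec n := fun j => (0, L (realBasis n j)) with hqdef
  have hLsingle : ∀ (k : Fin n) (b : Fin 2), L (realBasis n (pairIndex n (k, b))) =
      (if b = 0 then (1 : ℂ) else Complex.I) • L (Pi.single k 1) := by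
    intro k b
    rw [realBasis_pairIndex, ← map_smul]
    congr 1
    funext x
    simp [Pi.single_apply]
  have hdetpos := det_restrictScalars_pos L hL
  -- The density is the volume of the real frame `q` adapted to an orthogonal complex basis, divided
  -- by the real determinant of the map `L` that carries the standard frame to it. Neither depends
  -- on the degree `i`.
  refine ⟨(∏ k : Fin n, a ![q (pairIndex n (k, 0)), q (pairIndex n (k, 1))]) /
    LinearMap.det (L.restrictScalars ℝ), ?_, ?_⟩
  · refine div_pos (Finset.prod_pos fun k _ => ?_) hdetpos
    have hk : L (Pi.single k 1) ≠ 0 := by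
      intro h0
      have hinj : Function.Injective L := by
        have := LinearMap.isUnit_iff_isUnit_det L
        exact ((Module.End.isUnit_iff L).1 (this.2 (isUnit_iff_ne_zero.2 hL))).1
      have := hinj (h0.trans (map_zero L).symm)
      simpa using congrFun this k
    have := hpos _ hk
    simp only [hqdef, hLsingle]
    simpa using this
  · intro i p h w
    -- The vector `(w l, 0)` and the horizontal lift of `w l` differ by a vertical vector, which the
    -- contraction kills.
    have h1 : contract (2 * n) (fun j => ((0 : CVec m), realBasis n j))
        (castDegree h (wedgePow a p)) (fun l => (w l, 0)) =
        contract (2 * n) (fun j => ((0 : CVec m), realBasis n j))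
        (castDegree h (wedgePow a p)) (fun l => horizontalLift a (w l)) := by
      refine contract_congr _ _ _ _ _ fun l => ?_
      have : ((w l, 0) : CVec m × CVec n) - horizontalLift a (w l) =
          (0, Matrix.vecMul (w l) (mixedMatrix a * (fibreMatrix a)⁻¹)) := by
        rw [horizontalLift_apply]
        simp
      rw [this]
      exact span_vertical_realBasis _
    have h2 := alternating_map_realBasis
      ((contractFirst (castDegree h (wedgePow a p)) fun l => horizontalLift a (w l)).compLinearMap
        (LinearMap.inr ℝ (CVec m) (CVec n))) (L.restrictScalars ℝ)
    have h3 : contract (2 * n) q (castDegree h (wedgePow a p))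
        (fun l => horizontalLift a (w l)) = LinearMap.det (L.restrictScalars ℝ) *
        contract (2 * n) (fun j => ((0 : CVec m), realBasis n j))
        (castDegree h (wedgePow a p)) (fun l => horizontalLift a (w l)) := h2
    have hzero : ∀ x y, hermCoeff a x y = 0 → a ![x, y] = 0 := by
      intro x y hxy
      rw [two_form_eq_im_hermCoeff, hxy]
      simp
    have h4 := contract_wedgePow_of_orthogonal a n p i h q (fun l => horizontalLift a (w l))
      (fun k l hkl b c => by
        refine hzero _ _ ?_
        simp only [hqdef]
        rw [← hherm, hLsingle, hLsingle, hermCoeff_smul_left hav1, hermCoeff_smul_right hav1,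
          horth k l hkl]
        simp)
      (fun k l => by
        refine hzero _ _ ?_
        rw [← hermCoeff_conj ha]
        simp only [hqdef]
        rw [hermCoeff_horizontalLift ha hdet, map_zero])
    have h5 : wedgePow a i (fun l => horizontalLift a (w l)) = wedgePow (horizontalForm a) i w := by
      rw [horizontalForm, ← wedgePow_comp]
      rfl
    rw [h1]
    rw [h5] at h4
    rw [h4] at h3
    have h6 : ∀ x y : ℝ, y = LinearMap.det (L.restrictScalars ℝ) * x →
        x = y / LinearMap.det (L.restrictScalars ℝ) := fun x y hxy => by
      rw [hxy, mul_div_cancel_left₀ _ hdetpos.ne']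
    rw [h6 _ _ h3]
    ring

end Horizontal

/-! ### The intersection form of `(1,1)`-forms in two dimensions -/

/-- The pairing `(a ∧ b)(e_1, i e_1, e_2, i e_2)`. -/
def pairing (a b : CVec 2 [⋀^Fin 2]→L[ℝ] ℝ) : ℝ := wedge a b (realBasis 2)

/-- Up to the factor 8, the pairing is the polarization of the determinant of Hermitian 2 × 2
matrices, a quadratic form of signature (1,3). -/
theorem pairing_eq {a b : CVec 2 [⋀^Fin 2]→L[ℝ] ℝ} (ha : IsTypeOneOne a) (hb : IsTypeOneOne b) :
    pairing a b = 4 * ((hermCoeff a (Pi.single 0 1) (Pi.single 0 1)).re *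
        (hermCoeff b (Pi.single 1 1) (Pi.single 1 1)).re +
      (hermCoeff a (Pi.single 1 1) (Pi.single 1 1)).re *
        (hermCoeff b (Pi.single 0 1) (Pi.single 0 1)).re
      - 2 * (hermCoeff a (Pi.single 0 1) (Pi.single 1 1) *
        (starRingEnd ℂ) (hermCoeff b (Pi.single 0 1) (Pi.single 1 1))).re) := by
  have r0 : realBasis 2 0 = Pi.single 0 1 := realBasis_pairIndex 2 0 0
  have hI : ∀ k : Fin 2, (Pi.single k Complex.I : CVec 2) = Complex.I • Pi.single k 1 := fun k => by
    funext x
    simp [Pi.single_apply]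
  have r1 : realBasis 2 1 = Complex.I • Pi.single 0 1 := by
    rw [← hI]
    exact realBasis_pairIndex 2 0 1
  have r2 : realBasis 2 2 = Pi.single 1 1 := realBasis_pairIndex 2 1 0
  have r3 : realBasis 2 3 = Complex.I • Pi.single 1 1 := by
    rw [← hI]
    exact realBasis_pairIndex 2 1 1
  rw [pairing]
  have hw := wedge_two_two_apply a b (realBasis 2)
  rw [r0, r1, r2, r3] at hw
  rw [show wedge a b (realBasis 2) = _ from hw, ha, hb]
  simp only [ha.I_left (Pi.single 0 1) (Pi.single 1 1), hb.I_left (Pi.single 0 1) (Pi.single 1 1)]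
  simp only [two_form_eq_re_hermCoeff, two_form_eq_im_hermCoeff a (Pi.single 0 1) (Pi.single 1 1),
    two_form_eq_im_hermCoeff b (Pi.single 0 1) (Pi.single 1 1)]
  simp
  ring

theorem hermCoeff_two_pos {b : CVec 2 [⋀^Fin 2]→L[ℝ] ℝ} (hb : IsTypeOneOne b)
    (hpos : ∀ v : CVec 2, v ≠ 0 → 0 < b ![v, Complex.I • v]) :
    0 < (hermCoeff b (Pi.single 0 1) (Pi.single 0 1)).re ∧
    0 < (hermCoeff b (Pi.single 1 1) (Pi.single 1 1)).re ∧
    (hermCoeff b (Pi.single 0 1) (Pi.single 1 1)).re ^ 2 +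
      (hermCoeff b (Pi.single 0 1) (Pi.single 1 1)).im ^ 2 <
      (hermCoeff b (Pi.single 0 1) (Pi.single 0 1)).re *
        (hermCoeff b (Pi.single 1 1) (Pi.single 1 1)).re := by
  have hre : ∀ v : CVec 2, v ≠ 0 → 0 < (hermCoeff b v v).re := by
    intro v hv
    rw [hermCoeff_self _, Complex.ofReal_re]
    have := hpos v hv
    linarith
  have h0 := hre (Pi.single 0 1) (by simp)
  have h1 := hre (Pi.single 1 1) (by simp)
  refine ⟨h0, h1, ?_⟩
  set e : CVec 2 := Pi.single 0 1 with he
  set f : CVec 2 := Pi.single 1 1 with hf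
  have hff : hermCoeff b f f = ((hermCoeff b f f).re : ℂ) := by
    rw [hermCoeff_self _, Complex.ofReal_re]
  have hee : hermCoeff b e e = ((hermCoeff b e e).re : ℂ) := by
    rw [hermCoeff_self _, Complex.ofReal_re]
  have hfe : hermCoeff b f e = (starRingEnd ℂ) (hermCoeff b e f) := (hermCoeff_conj hb e f).symm
  set Y := (hermCoeff b f f).re
  set X := (hermCoeff b e e).re
  set z := hermCoeff b e f
  -- On this test vector the Hermitian form takes the value `Y (X Y - |z|²)`, so positivity gives
  -- the determinant inequality.
  have hv : ((Y : ℂ) • e + (-z) • f : CVec 2) ≠ 0 := by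
    intro h
    have := congrFun h 0
    simp [he, hf] at this
    exact h1.ne' this
  have := hre _ hv
  rw [hermCoeff_add_left, hermCoeff_add_right hb, hermCoeff_add_right hb] at this
  simp only [hermCoeff_smul_left hb, hermCoeff_smul_right hb, hfe, hff, hee] at this
  simp at this
  have h3 : 0 < Y * (X * Y - (z.re ^ 2 + z.im ^ 2)) := by nlinarith
  have := (mul_pos_iff_of_pos_left h1).1 h3
  linarith

theorem pairing_self_pos {b : CVec 2 [⋀^Fin 2]→L[ℝ] ℝ} (hb : IsTypeOneOne b)
    (hpos : ∀ v : CVec 2, v ≠ 0 → 0 < b ![v, Complex.I • v]) : 0 < pairing b b := by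
  obtain ⟨_, _, h⟩ := hermCoeff_two_pos hb hpos
  rw [pairing_eq hb hb]
  simp
  nlinarith

/-- The pairing is negative on the orthogonal complement of a positive form. -/
theorem pairing_self_nonpos {a b : CVec 2 [⋀^Fin 2]→L[ℝ] ℝ} (ha : IsTypeOneOne a)
    (hb : IsTypeOneOne b) (hpos : ∀ v : CVec 2, v ≠ 0 → 0 < b ![v, Complex.I • v])
    (hab : pairing a b = 0) : pairing a a ≤ 0 := by
  obtain ⟨hX, hY, h⟩ := hermCoeff_two_pos hb hpos
  rw [pairing_eq ha hb] at hab
  rw [pairing_eq ha ha]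
  simp at hab ⊢
  generalize (hermCoeff b (Pi.single 0 1) (Pi.single 0 1)).re = X at *
  generalize (hermCoeff b (Pi.single 1 1) (Pi.single 1 1)).re = Y at *
  generalize (hermCoeff a (Pi.single 0 1) (Pi.single 0 1)).re = x at *
  generalize (hermCoeff a (Pi.single 1 1) (Pi.single 1 1)).re = y at *
  generalize (hermCoeff b (Pi.single 0 1) (Pi.single 1 1)).re = P at *
  generalize (hermCoeff b (Pi.single 0 1) (Pi.single 1 1)).im = Q at *
  generalize (hermCoeff a (Pi.single 0 1) (Pi.single 1 1)).re = p at *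
  generalize (hermCoeff a (Pi.single 0 1) (Pi.single 1 1)).im = q at *
  have hXY : 0 < X * Y := mul_pos hX hY
  have hlin : x * Y + y * X = 2 * (p * P + q * Q) := by linarith
  -- Orthogonality and the Cauchy-Schwarz inequality bound `xY + yX` from above; the inequality of
  -- arithmetic and geometric means bounds it from below. Since `P² + Q² < X Y`, the chain gives `x
  -- y ≤ p² + q²`, that is, a nonpositive determinant for `a`.
  have h1 : (x * Y + y * X) ^ 2 ≤ 4 * ((p ^ 2 + q ^ 2) * (P ^ 2 + Q ^ 2)) := by
    rw [hlin]
    nlinarith [sq_nonneg (p * Q - q * P)]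
  have h2 : 4 * (x * y) * (X * Y) ≤ (x * Y + y * X) ^ 2 := by
    nlinarith [sq_nonneg (x * Y - y * X)]
  have h3 : (p ^ 2 + q ^ 2) * (P ^ 2 + Q ^ 2) ≤ (p ^ 2 + q ^ 2) * (X * Y) :=
    mul_le_mul_of_nonneg_left h.le (by positivity)
  have h4 : (x * y) * (X * Y) ≤ (p ^ 2 + q ^ 2) * (X * Y) := by linarith
  have h5 := le_of_mul_le_mul_right h4 hXY
  nlinarith

/-- The trace `g^{α β̄} c_{α β̄}` through the pairing. -/
theorem pairing_of_trace {c b : CVec 2 [⋀^Fin 2]→L[ℝ] ℝ} (hc : IsTypeOneOne c)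
    (hb : IsTypeOneOne b) (hpos : ∀ v : CVec 2, v ≠ 0 → 0 < b ![v, Complex.I • v]) (lam : ℝ)
    (h : ((Matrix.of fun α β : Fin 2 => hermCoeff b (Pi.single α 1) (Pi.single β 1))⁻¹ *
      (Matrix.of fun α β : Fin 2 => hermCoeff c (Pi.single α 1) (Pi.single β 1))).trace
        = (lam : ℂ)) :
    pairing c b = lam / 2 * pairing b b := by
  obtain ⟨hX, hY, hlt⟩ := hermCoeff_two_pos hb hpos
  have real : ∀ {d : CVec 2 [⋀^Fin 2]→L[ℝ] ℝ} (hd : IsTypeOneOne d) (u : CVec 2),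
      hermCoeff d u u = ((hermCoeff d u u).re : ℂ) := fun hd u => by
    rw [hermCoeff_self _, Complex.ofReal_re]
  have hb10 := (hermCoeff_conj hb (Pi.single 0 1) (Pi.single 1 1)).symm
  have hc10 := (hermCoeff_conj hc (Pi.single 0 1) (Pi.single 1 1)).symm
  rw [pairing_eq hc hb, pairing_eq hb hb]
  set G : Matrix (Fin 2) (Fin 2) ℂ :=
    Matrix.of fun α β : Fin 2 => hermCoeff b (Pi.single α 1) (Pi.single β 1) with hG
  set C : Matrix (Fin 2) (Fin 2) ℂ :=
    Matrix.of fun α β : Fin 2 => hermCoeff c (Pi.single α 1) (Pi.single β 1) with hC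
  have hdet : G.det = (((hermCoeff b (Pi.single 0 1) (Pi.single 0 1)).re *
        (hermCoeff b (Pi.single 1 1) (Pi.single 1 1)).re -
      ((hermCoeff b (Pi.single 0 1) (Pi.single 1 1)).re *
        (hermCoeff b (Pi.single 0 1) (Pi.single 1 1)).re +
      (hermCoeff b (Pi.single 0 1) (Pi.single 1 1)).im *
        (hermCoeff b (Pi.single 0 1) (Pi.single 1 1)).im) : ℝ) : ℂ) := by
    rw [Matrix.det_fin_two]
    simp only [hG, Matrix.of_apply]
    rw [hb10, real hb (Pi.single 0 1), real hb (Pi.single 1 1), Complex.mul_conj, Complex.normSq_apply]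
    push_cast
    simp
  have hdet0 : G.det ≠ 0 := by
    rw [hdet, Complex.ofReal_ne_zero, ← sq, ← sq]
    exact (sub_pos.2 hlt).ne'
  -- Multiplication by the determinant replaces the inverse by the adjugate. The resulting trace is
  -- the polarized determinant of `G` and `C`, hence a multiple of the pairing.
  have htr : (G.adjugate * C).trace = lam * G.det := by
    rw [← h, Matrix.inv_def, Matrix.smul_mul, Matrix.trace_smul, Ring.inverse_eq_inv', smul_eq_mul]
    field_simp
  rw [hdet, Matrix.adjugate_fin_two, Matrix.trace_fin_two, Matrix.mul_apply, Matrix.mul_apply,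
    Fin.sum_univ_two, Fin.sum_univ_two] at htr
  simp only [hG, hC, Matrix.of_apply, Matrix.cons_val', Matrix.cons_val_zero, Matrix.cons_val_one,
    Matrix.cons_val_fin_one] at htr
  rw [hb10, hc10, real hb (Pi.single 0 1), real hb (Pi.single 1 1), real hc (Pi.single 0 1),
    real hc (Pi.single 1 1)] at htr
  have hre := congrArg Complex.re htr
  simp at hre ⊢
  linarith

end

/-! ### Compactly supported forms on vector spaces and integration along the fibres of a product. -/

section

open MeasureTheory

/-! ### Functions with compact support -/

section Extension

variable {V W : Type*} [NormedAddCommGroup V] [NormedSpace ℝ V] [NormedAddCommGroup W]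
  [NormedSpace ℝ W]

theorem indicator_eq_of_compact {U K : Set V} {f : V → W}
    (hK : ∀ u ∈ U, u ∉ K → f u = 0) {u : V} (hu : u ∉ K) : U.indicator f u = 0 := by
  by_cases h : u ∈ U
  · rw [Set.indicator_of_mem h, hK u h hu]
  · rw [Set.indicator_of_notMem h]

/-- Outside `U` the extension vanishes on the open complement of the compact set `K`, so no
regularity is lost at the boundary of `U`. -/
theorem contDiff_indicator {U K : Set V} (hU : IsOpen U) (hK : IsCompact K) (hKU : K ⊆ U)
    {f : V → W} (hf : ContDiffOn ℝ ∞ f U) (h0 : ∀ u ∈ U, u ∉ K → f u = 0) :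
    ContDiff ℝ ∞ (U.indicator f) := by
  rw [contDiff_iff_contDiffAt]
  intro u
  by_cases hu : u ∈ U
  · refine (hf.contDiffAt (hU.mem_nhds hu)).congr_of_eventuallyEq ?_
    filter_upwards [hU.mem_nhds hu] with y hy using Set.indicator_of_mem hy f
  · have : Kᶜ ∈ 𝓝 u := hK.isClosed.isOpen_compl.mem_nhds fun h => hu (hKU h)
    refine contDiffAt_const (c := (0 : W)) |>.congr_of_eventuallyEq ?_
    filter_upwards [this] with y hy using indicator_eq_of_compact h0 hy

theorem hasCompactSupport_indicator {U K : Set V} (hK : IsCompact K) {f : V → W}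
    (h0 : ∀ u ∈ U, u ∉ K → f u = 0) : HasCompactSupport (U.indicator f) :=
  HasCompactSupport.intro hK fun _ hu => indicator_eq_of_compact h0 hu

theorem fderiv_alternating_apply {k : ℕ} {T : V → W [⋀^Fin k]→L[ℝ] ℝ} {x : V}
    (hT : DifferentiableAt ℝ T x) (y : V) (w : Fin k → W) :
    fderiv ℝ (fun u => T u w) x y = fderiv ℝ T x y w := by
  have h := ((ContinuousAlternatingMap.apply ℝ W ℝ w).hasFDerivAt.comp x hT.hasFDerivAt).fderiv
  have h2 : fderiv ℝ (fun u => T u w) x =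
    (ContinuousAlternatingMap.apply ℝ W ℝ w).comp (fderiv ℝ T x) := h
  rw [h2]
  rfl

variable [FiniteDimensional ℝ V] [MeasurableSpace V] [BorelSpace V] {μ : Measure V}
  [μ.IsAddHaarMeasure]

/-- Integration by parts against the constant function 1. -/
theorem integral_fderiv_eq_zero {f : V → ℝ} (hf : ContDiff ℝ ∞ f) (hc : HasCompactSupport f)
    (v : V) : ∫ x, fderiv ℝ f x v ∂μ = 0 := by
  have hd : Continuous fun x => fderiv ℝ f x v :=
    (hf.continuous_fderiv (by simp)).clm_apply continuous_const
  have hdc : HasCompactSupport fun x => fderiv ℝ f x v := hc.fderiv_apply ℝ v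
  have h := integral_mul_fderiv_eq_neg_fderiv_mul_of_integrable (μ := μ) (f := fun _ : V => (1 : ℝ))
    (g := f) (v := v) (by simp) (by simpa using hd.integrable_of_hasCompactSupport hdc)
    (by simpa using hf.continuous.integrable_of_hasCompactSupport hc)
    (fun x _ => differentiableAt_const _)
    (fun x _ => (hf.differentiable (by simp)) x)
  simpa using h

/-- Stokes' formula for forms with compact support on a vector space. -/
theorem integral_extDeriv_eq_zero {k : ℕ} {T : V → V [⋀^Fin k]→L[ℝ] ℝ} (hT : ContDiff ℝ ∞ T)
    (hc : HasCompactSupport T) (v : Fin (k + 1) → V) : ∫ x, extDeriv T x v ∂μ = 0 := by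
  have hd : ∀ x, DifferentiableAt ℝ T x := hT.differentiable (by simp)
  have h1 : ∀ x, extDeriv T x v =
      ∑ i : Fin (k + 1), (-1 : ℝ) ^ (i : ℕ) * fderiv ℝ (fun u => T u (i.removeNth v)) x (v i) := by
    intro x
    rw [extDeriv_apply (hd x)]
    refine Finset.sum_congr rfl fun i _ => ?_
    rw [fderiv_alternating_apply (hd x)]
    simp
  have hs : ∀ w : Fin k → V, ContDiff ℝ ∞ fun u => T u w := contDiff_alternating_iff.1 hT
  have hsc : ∀ w : Fin k → V, HasCompactSupport fun u => T u w := fun w =>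
    hc.comp_left (g := fun a : V [⋀^Fin k]→L[ℝ] ℝ => a w) rfl
  simp only [h1]
  rw [integral_finsetSum]
  · refine Finset.sum_eq_zero fun i _ => ?_
    rw [integral_const_mul, integral_fderiv_eq_zero (hs _) (hsc _), mul_zero]
  · intro i _
    refine Integrable.const_mul ?_ _
    exact (((hs _).continuous_fderiv (by simp)).clm_apply
      continuous_const).integrable_of_hasCompactSupport ((hsc _).fderiv_apply ℝ _)

end Extension

/-! ### Integrals that depend on a parameter -/

section Parametric

variable {P V W : Type*} [NormedAddCommGroup P] [NormedSpace ℝ P] [FiniteDimensional ℝ P]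
  [NormedAddCommGroup V] [NormedSpace ℝ V] [FiniteDimensional ℝ V] [MeasurableSpace V]
  [BorelSpace V] {μ : Measure V} [μ.IsAddHaarMeasure]
  [NormedAddCommGroup W] [NormedSpace ℝ W]

theorem hasCompactSupport_slice {G : P × V → W} (hc : HasCompactSupport G) (z : P) :
    HasCompactSupport fun v => G (z, v) := by
  refine HasCompactSupport.intro (hc.isCompact.image continuous_snd) fun v hv => ?_
  by_contra h
  exact hv ⟨(z, v), subset_tsupport _ h, rfl⟩

theorem integrable_slice {G : P × V → W} (hG : Continuous G) (hc : HasCompactSupport G) (z : P) :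
    Integrable (fun v => G (z, v)) μ :=
  (hG.comp (by fun_prop)).integrable_of_hasCompactSupport (hasCompactSupport_slice hc z)

/-- Differentiation under the integral sign. The derivative in the parameter is bounded and vanishes
unless `v` lies in the projection of its support, so a constant on that compact projection dominates
it for all parameters at once. -/
theorem hasFDerivAt_integral_slice {G : P × V → ℝ} (hG : ContDiff ℝ ∞ G)
    (hc : HasCompactSupport G) (z : P) :
    HasFDerivAt (fun z => ∫ v, G (z, v) ∂μ)
      (∫ v, (fderiv ℝ G (z, v)).comp (ContinuousLinearMap.inl ℝ P V) ∂μ) z := by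
  have hdc : Continuous fun u => (fderiv ℝ G u).comp (ContinuousLinearMap.inl ℝ P V) :=
    (hG.continuous_fderiv (by simp)).clm_comp continuous_const
  have hds : HasCompactSupport fun u => (fderiv ℝ G u).comp (ContinuousLinearMap.inl ℝ P V) :=
    (hc.fderiv ℝ).comp_left (g := fun L : P × V →L[ℝ] ℝ =>
      L.comp (ContinuousLinearMap.inl ℝ P V)) (by simp)
  obtain ⟨C, hC⟩ := hds.exists_bound_of_continuous hdc
  set K := Prod.snd '' tsupport fun u => (fderiv ℝ G u).comp (ContinuousLinearMap.inl ℝ P V)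
    with hK
  have hKc : IsCompact K := hds.isCompact.image continuous_snd
  refine hasFDerivAt_integral_of_dominated_of_fderiv_le (s := Set.univ)
    (bound := K.indicator fun _ => C) (F' := fun z v =>
      (fderiv ℝ G (z, v)).comp (ContinuousLinearMap.inl ℝ P V)) Filter.univ_mem ?_ ?_ ?_ ?_ ?_ ?_
  · exact Filter.Eventually.of_forall fun z =>
      (hG.continuous.comp (by fun_prop : Continuous fun v : V => (z, v))).aestronglyMeasurable
  · exact integrable_slice hG.continuous hc z
  · exact (hdc.comp (by fun_prop : Continuous fun v : V => (z, v))).aestronglyMeasurable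
  · refine Filter.Eventually.of_forall fun v z _ => ?_
    by_cases hv : v ∈ K
    · rw [Set.indicator_of_mem hv]
      exact hC _
    · rw [Set.indicator_of_notMem hv]
      have : (fderiv ℝ G (z, v)).comp (ContinuousLinearMap.inl ℝ P V) = 0 := by
        by_contra h
        exact hv ⟨(z, v), subset_tsupport _ h, rfl⟩
      rw [this, norm_zero]
  · exact (integrable_indicator_iff hKc.measurableSet).2
      (integrableOn_const hKc.measure_lt_top.ne)
  · refine Filter.Eventually.of_forall fun v z _ => ?_
    have h1 := ((hG.differentiable (by simp)) (z, v)).hasFDerivAt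
    have h2 : HasFDerivAt (fun z : P => (z, v)) (ContinuousLinearMap.inl ℝ P V) z :=
      hasFDerivAt_prodMk_left z v
    exact h1.comp z h2

theorem fderiv_integral_slice {G : P × V → ℝ} (hG : ContDiff ℝ ∞ G) (hc : HasCompactSupport G)
    (z w : P) : fderiv ℝ (fun z => ∫ v, G (z, v) ∂μ) z w = ∫ v, fderiv ℝ G (z, v) (w, 0) ∂μ := by
  rw [(hasFDerivAt_integral_slice hG hc z).fderiv, ContinuousLinearMap.integral_apply]
  · rfl
  · have hdc : Continuous fun u => (fderiv ℝ G u).comp (ContinuousLinearMap.inl ℝ P V) :=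
      (hG.continuous_fderiv (by simp)).clm_comp continuous_const
    have hds : HasCompactSupport fun u => (fderiv ℝ G u).comp (ContinuousLinearMap.inl ℝ P V) :=
      (hc.fderiv ℝ).comp_left (g := fun L : P × V →L[ℝ] ℝ =>
        L.comp (ContinuousLinearMap.inl ℝ P V)) (by simp)
    exact integrable_slice hdc hds z

/-- A directional derivative of the integral is the integral of a function of the same kind, so the
induction on the order runs over all `G` simultaneously. -/
theorem contDiff_integral_slice {G : P × V → ℝ} (hG : ContDiff ℝ ∞ G) (hc : HasCompactSupport G) :
    ContDiff ℝ ∞ fun z => ∫ v, G (z, v) ∂μ := by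
  rw [contDiff_infty]
  intro n
  induction n generalizing G with
  | zero =>
    have hd : Differentiable ℝ fun z => ∫ v, G (z, v) ∂μ := fun z =>
      (hasFDerivAt_integral_slice hG hc z).differentiableAt
    exact contDiff_zero.2 hd.continuous
  | succ n ih =>
    have hcast : ((n + 1 : ℕ) : WithTop ℕ∞) = (n : WithTop ℕ∞) + 1 := by norm_cast
    rw [hcast, contDiff_succ_iff_fderiv_apply]
    refine ⟨fun z => (hasFDerivAt_integral_slice hG hc z).differentiableAt, by simp, fun w => ?_⟩
    simp only [fderiv_integral_slice hG hc]
    refine ih (G := fun u => fderiv ℝ G u (w, 0)) ?_ (hc.fderiv_apply ℝ _)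
    exact (hG.fderiv_right (m := ∞) (by simp)).clm_apply contDiff_const

end Parametric

/-! ### Integration along the fibres of `ℂ^m × ℂ^n → ℂ^m` -/

section FibreInt

variable {m n : ℕ} {k : ℕ}

/-- The vectors `∂_{v,1}, …, ∂_{v,2n}`. -/
def verticalBasis (m n : ℕ) (i : Fin (2 * n)) : CVec m × CVec n := (0, realBasis n i)

/-- The form `A(∂_{v,1}, …, ∂_{v,2n}, ·)` on the base. -/
def contractFibre (A : (CVec m × CVec n) [⋀^Fin (k + 2 * n)]→L[ℝ] ℝ) :
    CVec m [⋀^Fin k]→L[ℝ] ℝ :=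
  (contract (2 * n) (verticalBasis m n) A).compContinuousLinearMap
    (ContinuousLinearMap.inl ℝ (CVec m) (CVec n))

/-- The tuple of the vertical basis followed by vectors of the base. -/
def fibreTuple (w : Fin k → CVec m) (i : Fin (k + 2 * n)) : CVec m × CVec n :=
  Fin.append (verticalBasis m n) (fun l => (w l, 0)) (Fin.cast (Nat.add_comm k (2 * n)) i)

theorem contractFibre_apply (A : (CVec m × CVec n) [⋀^Fin (k + 2 * n)]→L[ℝ] ℝ)
    (w : Fin k → CVec m) : contractFibre A w = A (fibreTuple w) := by
  show contract (2 * n) (verticalBasis m n) A (fun l => (w l, 0)) = _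
  rw [contract_apply]
  rfl

/-- Fibre integral of a form on `ℂ^m × ℂ^n`. -/
def fibreInt (T : CVec m × CVec n → (CVec m × CVec n) [⋀^Fin (k + 2 * n)]→L[ℝ] ℝ) (z : CVec m) :
    CVec m [⋀^Fin k]→L[ℝ] ℝ :=
  ∫ v : CVec n, contractFibre (T (z, v))

variable {T : CVec m × CVec n → (CVec m × CVec n) [⋀^Fin (k + 2 * n)]→L[ℝ] ℝ}

theorem contDiff_contractFibre (hT : ContDiff ℝ ∞ T) : ContDiff ℝ ∞ fun u => contractFibre (T u) := by
  rw [contDiff_alternating_iff]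
  intro w
  simp only [contractFibre_apply]
  exact contDiff_alternating_iff.1 hT _

theorem contractFibre_zero :
    contractFibre (0 : (CVec m × CVec n) [⋀^Fin (k + 2 * n)]→L[ℝ] ℝ) = 0 := by
  ext w
  rw [contractFibre_apply]
  rfl

theorem hasCompactSupport_contractFibre (hc : HasCompactSupport T) :
    HasCompactSupport fun u => contractFibre (T u) :=
  hc.comp_left (g := contractFibre) contractFibre_zero

theorem integrable_contractFibre (hT : ContDiff ℝ ∞ T) (hc : HasCompactSupport T) (z : CVec m) :
    Integrable fun v : CVec n => contractFibre (T (z, v)) :=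
  integrable_slice (G := fun u => contractFibre (T u)) (contDiff_contractFibre hT).continuous
    (hasCompactSupport_contractFibre hc) z

theorem fibreInt_apply (hT : ContDiff ℝ ∞ T) (hc : HasCompactSupport T) (z : CVec m)
    (w : Fin k → CVec m) : fibreInt T z w = ∫ v : CVec n, T (z, v) (fibreTuple w) := by
  have h := (ContinuousAlternatingMap.apply ℝ (CVec m) ℝ w).integral_comp_comm
    (integrable_contractFibre hT hc z)
  rw [fibreInt]
  refine h.symm.trans ?_
  refine integral_congr_ae (Filter.Eventually.of_forall fun v => ?_)
  exact contractFibre_apply _ _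

theorem contDiff_eval {q : ℕ} {T : CVec m × CVec n → (CVec m × CVec n) [⋀^Fin q]→L[ℝ] ℝ}
    (hT : ContDiff ℝ ∞ T) (t : Fin q → CVec m × CVec n) : ContDiff ℝ ∞ fun u => T u t :=
  contDiff_alternating_iff.1 hT t

theorem hasCompactSupport_eval {q : ℕ}
    {T : CVec m × CVec n → (CVec m × CVec n) [⋀^Fin q]→L[ℝ] ℝ}
    (hc : HasCompactSupport T) (t : Fin q → CVec m × CVec n) : HasCompactSupport fun u => T u t :=
  hc.comp_left (g := fun a : (CVec m × CVec n) [⋀^Fin q]→L[ℝ] ℝ => a t) rfl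

theorem contDiff_fibreInt (hT : ContDiff ℝ ∞ T) (hc : HasCompactSupport T) :
    ContDiff ℝ ∞ (fibreInt T) := by
  rw [contDiff_alternating_iff]
  intro w
  simp only [fibreInt_apply hT hc]
  exact contDiff_integral_slice (contDiff_eval hT _) (hasCompactSupport_eval hc _)

theorem fibreInt_eq_zero {K : Set (CVec m × CVec n)} (hK : ∀ u, u ∉ K → T u = 0) {z : CVec m}
    (hz : z ∉ Prod.fst '' K) : fibreInt T z = 0 := by
  have : ∀ v : CVec n, contractFibre (T (z, v)) = 0 := fun v => by
    rw [hK _ fun h => hz ⟨_, h, rfl⟩, contractFibre_zero]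
  simp [fibreInt, this]

theorem integral_fderiv_vertical {f : CVec m × CVec n → ℝ} (hf : ContDiff ℝ ∞ f)
    (hc : HasCompactSupport f) (z : CVec m) (b : CVec n) :
    ∫ v : CVec n, fderiv ℝ f (z, v) (0, b) = 0 := by
  have hs : ContDiff ℝ ∞ fun v : CVec n => f (z, v) := hf.comp (by fun_prop)
  have h := integral_fderiv_eq_zero (μ := volume) hs (hasCompactSupport_slice hc z) b
  refine Eq.trans (integral_congr_ae (Filter.Eventually.of_forall fun v => ?_)) h
  have h1 := ((hf.differentiable (by simp)) (z, v)).hasFDerivAt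
  have h2 : HasFDerivAt (fun v : CVec n => (z, v)) (ContinuousLinearMap.inr ℝ (CVec m) (CVec n)) v :=
    hasFDerivAt_prodMk_right z v
  have h3 := (h1.comp v h2).fderiv
  show fderiv ℝ f (z, v) (0, b) = fderiv ℝ (fun v : CVec n => f (z, v)) v b
  have h4 : fderiv ℝ (fun v : CVec n => f (z, v)) v =
    (fderiv ℝ f (z, v)).comp (ContinuousLinearMap.inr ℝ (CVec m) (CVec n)) := h3
  rw [h4]
  rfl

theorem integrable_fderiv_eval {q : ℕ}
    {T : CVec m × CVec n → (CVec m × CVec n) [⋀^Fin q]→L[ℝ] ℝ} (hT : ContDiff ℝ ∞ T)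
    (hc : HasCompactSupport T) (z : CVec m) (y : CVec m × CVec n) (t : Fin q → CVec m × CVec n) :
    Integrable fun v : CVec n => fderiv ℝ (fun u => T u t) (z, v) y :=
  integrable_slice (G := fun u => fderiv ℝ (fun u => T u t) u y)
    (((contDiff_eval hT t).continuous_fderiv (by simp)).clm_apply continuous_const)
    ((hasCompactSupport_eval hc t).fderiv_apply ℝ y) z

theorem extDeriv_eq_sum {V : Type*} [NormedAddCommGroup V] [NormedSpace ℝ V] {q : ℕ}
    {T : V → V [⋀^Fin q]→L[ℝ] ℝ} {x : V} (hT : DifferentiableAt ℝ T x) (t : Fin (q + 1) → V) :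
    extDeriv T x t = ∑ i : Fin (q + 1),
      (-1 : ℝ) ^ (i : ℕ) * fderiv ℝ (fun u => T u (i.removeNth t)) x (t i) := by
  rw [extDeriv_apply hT]
  refine Finset.sum_congr rfl fun i _ => ?_
  rw [fderiv_alternating_apply hT]
  simp

theorem contDiff_extDeriv {V : Type*} [NormedAddCommGroup V] [NormedSpace ℝ V]
    [FiniteDimensional ℝ V] {q : ℕ} {T : V → V [⋀^Fin q]→L[ℝ] ℝ} {s : Set V} (hs : IsOpen s)
    (hT : ContDiffOn ℝ ∞ T s) : ContDiffOn ℝ ∞ (extDeriv T) s := by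
  rw [contDiffOn_alternating_iff]
  intro t
  have h1 : ContDiffOn ℝ ∞ (fun x => ∑ i : Fin (q + 1),
      (-1 : ℝ) ^ (i : ℕ) * fderiv ℝ (fun u => T u (i.removeNth t)) x (t i)) s := by
    refine ContDiffOn.sum fun i _ => contDiffOn_const.mul ?_
    have h2 := contDiffOn_alternating_iff.1 hT (i.removeNth t)
    exact (h2.fderiv_of_isOpen hs (m := ∞) (by simp)).clm_apply contDiffOn_const
  refine h1.congr fun x hx => ?_
  exact extDeriv_eq_sum ((hT.contDiffAt (hs.mem_nhds hx)).differentiableAt (by simp)) t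

theorem fibreTuple_castAdd (w : Fin k → CVec m) (j : Fin (2 * n)) :
    fibreTuple w (Fin.cast (Nat.add_comm (2 * n) k) (Fin.castAdd k j)) = verticalBasis m n j := by
  simp [fibreTuple]

theorem fibreTuple_natAdd (w : Fin k → CVec m) (l : Fin k) :
    fibreTuple (n := n) w (Fin.cast (Nat.add_comm (2 * n) k) (Fin.natAdd (2 * n) l)) = (w l, 0) := by
  simp [fibreTuple]

/-- The vertical vectors fill the first `2n` slots, so that the base vector of index `l` stands in
the slot `2n + l`. -/
theorem removeNth_fibreTuple (h : k + 2 * n + 1 = k + 1 + 2 * n) (w : Fin (k + 1) → CVec m)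
    (l : Fin (k + 1)) :
    Fin.removeNth (α := fun _ => CVec m × CVec n)
      (Fin.cast ((Nat.add_comm (2 * n) (k + 1)).trans h.symm) (Fin.natAdd (2 * n) l))
      (fun i => fibreTuple w (Fin.cast h i)) = fibreTuple (l.removeNth w) := by
  funext x
  obtain ⟨x, rfl⟩ := (finCongr (Nat.add_comm (2 * n) k)).surjective x
  refine Fin.addCases (fun j => ?_) (fun y => ?_) x
  · have e : Fin.cast h ((Fin.cast ((Nat.add_comm (2 * n) (k + 1)).trans h.symm)
        (Fin.natAdd (2 * n) l)).succAbove (finCongr (Nat.add_comm (2 * n) k) (Fin.castAdd k j))) =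
        Fin.cast (Nat.add_comm (2 * n) (k + 1)) (Fin.castAdd (k + 1) j) := by
      apply Fin.ext
      simp only [Fin.succAbove, Fin.lt_def, Fin.val_cast, finCongr_apply, Fin.val_castSucc,
        Fin.val_natAdd, Fin.val_castAdd, apply_ite Fin.val, Fin.val_succ]
      split_ifs <;> omega
    rw [Fin.removeNth_apply, e, fibreTuple_castAdd]
    exact (fibreTuple_castAdd _ j).symm
  · have e : Fin.cast h ((Fin.cast ((Nat.add_comm (2 * n) (k + 1)).trans h.symm)
        (Fin.natAdd (2 * n) l)).succAbove (finCongr (Nat.add_comm (2 * n) k)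
          (Fin.natAdd (2 * n) y))) =
        Fin.cast (Nat.add_comm (2 * n) (k + 1)) (Fin.natAdd (2 * n) (l.succAbove y)) := by
      apply Fin.ext
      simp only [Fin.succAbove, Fin.lt_def, Fin.val_cast, finCongr_apply, Fin.val_castSucc,
        Fin.val_natAdd, apply_ite Fin.val, Fin.val_succ]
      split_ifs <;> omega
    rw [Fin.removeNth_apply, e, fibreTuple_natAdd]
    exact (fibreTuple_natAdd (l.removeNth w) y).symm

/-- Integration along the fibres commutes with the exterior derivative. -/
theorem fibreInt_extDeriv (hT : ContDiff ℝ ∞ T) (hc : HasCompactSupport T)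
    (h : k + 2 * n + 1 = k + 1 + 2 * n) (z : CVec m) :
    fibreInt (fun u => castDegree h (extDeriv T u)) z = extDeriv (fibreInt T) z := by
  have hTd : ∀ x, DifferentiableAt ℝ T x := hT.differentiable (by simp)
  have hdT : ContDiff ℝ ∞ fun u => castDegree h (extDeriv T u) := by
    have := contDiff_extDeriv isOpen_univ hT.contDiffOn
    rw [contDiff_alternating_iff]
    intro v
    exact contDiff_alternating_iff.1 (contDiffOn_univ.1 this) _
  have hdc : HasCompactSupport fun u => castDegree h (extDeriv T u) := by
    refine HasCompactSupport.intro hc fun u hu => ?_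
    have h1 : T =ᶠ[𝓝 u] fun _ => 0 := by
      filter_upwards [(isClosed_tsupport T).isOpen_compl.mem_nhds hu] with y hy
      exact image_eq_zero_of_notMem_tsupport hy
    ext v
    rw [castDegree_apply, h1.extDeriv_eq, extDeriv_apply (differentiableAt_const _)]
    simp
  ext w
  rw [fibreInt_apply hdT hdc,
    extDeriv_eq_sum (((contDiff_fibreInt hT hc).differentiable (by simp)) z)]
  simp only [castDegree_apply, extDeriv_eq_sum (hTd _)]
  rw [integral_finsetSum _ fun i _ => (integrable_fderiv_eval hT hc z _ _).const_mul _]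
  simp only [integral_const_mul]
  -- The sum in the exterior derivative splits into vertical and base directions. Vertical
  -- derivatives integrate to zero along the fibre. The base terms carry the sign `(-1)^(2n + l) =
  -- (-1)^l`, so they form the exterior derivative on the base with no extra sign.
  rw [← Equiv.sum_comp (finCongr ((Nat.add_comm (2 * n) (k + 1)).trans h.symm)), Fin.sum_univ_add,
    Finset.sum_eq_zero, zero_add]
  · refine Finset.sum_congr rfl fun l _ => ?_
    have h1 := removeNth_fibreTuple (n := n) h w l
    have h2 : fibreTuple w (Fin.cast h (finCongr ((Nat.add_comm (2 * n) (k + 1)).trans h.symm)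
      (Fin.natAdd (2 * n) l))) = (w l, (0 : CVec n)) := fibreTuple_natAdd w l
    rw [h2]
    simp only [finCongr_apply]
    rw [h1]
    simp only [fibreInt_apply hT hc]
    rw [fderiv_integral_slice (contDiff_eval hT _) (hasCompactSupport_eval hc _)]
    congr 1
    simp [pow_add]
  · intro j _
    have h2 : fibreTuple w (Fin.cast h (finCongr ((Nat.add_comm (2 * n) (k + 1)).trans h.symm)
      (Fin.castAdd (k + 1) j))) = ((0 : CVec m), realBasis n j) := fibreTuple_castAdd w j
    rw [h2, integral_fderiv_vertical (contDiff_eval hT _) (hasCompactSupport_eval hc _), mul_zero]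

/-- In this degree all the arguments are vertical, so every term integrates to zero. The case is
separate from the commutation with `d` because a primitive on the base would have degree -1; it
serves for `S_0`. -/
theorem fibreInt_extDeriv_top {q : ℕ} {T : CVec m × CVec n → (CVec m × CVec n) [⋀^Fin q]→L[ℝ] ℝ}
    (hT : ContDiff ℝ ∞ T) (hc : HasCompactSupport T) (h : q + 1 = 0 + 2 * n) (z : CVec m)
    (w : Fin 0 → CVec m) :
    ∫ v : CVec n, castDegree h (extDeriv T (z, v)) (fibreTuple w) = 0 := by
  have hTd : ∀ x, DifferentiableAt ℝ T x := hT.differentiable (by simp)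
  simp only [castDegree_apply, extDeriv_eq_sum (hTd _)]
  rw [integral_finsetSum _ fun i _ => (integrable_fderiv_eval hT hc z _ _).const_mul _]
  simp only [integral_const_mul]
  refine Finset.sum_eq_zero fun i _ => ?_
  obtain ⟨j, rfl⟩ := (finCongr ((Nat.add_comm (2 * n) 0).trans h.symm)).surjective i
  have h2 : fibreTuple w (Fin.cast h (finCongr ((Nat.add_comm (2 * n) 0).trans h.symm) j)) =
      ((0 : CVec m), realBasis n j) := fibreTuple_castAdd w j
  rw [h2, integral_fderiv_vertical (contDiff_eval hT _) (hasCompactSupport_eval hc _), mul_zero]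

end FibreInt

end

/-! ### Differential forms on complex manifolds, read in charts. -/

section

theorem two_le_infty : (2 : WithTop ℕ∞) ≤ ∞ :=
  WithTop.coe_le_coe.2 (le_top : (2 : ℕ∞) ≤ ⊤)

section FormCalculus

variable {V E F : Type*} [NormedAddCommGroup V] [NormedSpace ℝ V] [NormedAddCommGroup E]
  [NormedSpace ℝ E] [FiniteDimensional ℝ E] [NormedAddCommGroup F] [NormedSpace ℝ F]
  [FiniteDimensional ℝ F]

/-- Expanding each `L u (v i)` in a basis of `E` makes the pull-back a polynomial in the coordinates
of `L u` and finitely many values of `f u`. -/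
theorem contDiffWithinAt_comp_form {k : ℕ} {f : V → E [⋀^Fin k]→L[ℝ] ℝ} {L : V → F →L[ℝ] E}
    {s : Set V} {x : V} (hf : ContDiffWithinAt ℝ ∞ f s x) (hL : ContDiffWithinAt ℝ ∞ L s x) :
    ContDiffWithinAt ℝ ∞ (fun u => (f u).compContinuousLinearMap (L u)) s x := by
  rw [contDiffWithinAt_alternating_iff]
  intro v
  let b := Module.finBasis ℝ E
  have hexp : ∀ u, (f u).compContinuousLinearMap (L u) v =
      ∑ r : Fin k → Fin (Module.finrank ℝ E),
        (∏ i, b.repr (L u (v i)) (r i)) * f u (fun i => b (r i)) := by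
    intro u
    have h1 : (⇑(L u) ∘ v) = fun i => ∑ j, b.repr (L u (v i)) j • b j := by
      funext i
      exact (b.sum_repr (L u (v i))).symm
    rw [ContinuousAlternatingMap.compContinuousLinearMap_apply, h1]
    have h2 := (f u).toContinuousMultilinearMap.toMultilinearMap.map_sum
      (fun (i : Fin k) (j : Fin (Module.finrank ℝ E)) => b.repr (L u (v i)) j • b j)
    refine h2.trans (Finset.sum_congr rfl fun r _ => ?_)
    exact (f u).map_smul_univ (fun i => b.repr (L u (v i)) (r i)) fun i => b (r i)
  simp only [hexp]
  refine ContDiffWithinAt.sum fun r _ => ?_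
  refine ContDiffWithinAt.mul ?_ (contDiffWithinAt_alternating_iff.1 hf _)
  refine contDiffWithinAt_prod fun i _ => ?_
  have h3 : ContDiffWithinAt ℝ ∞ (fun u => L u (v i)) s x := hL.clm_apply contDiffWithinAt_const
  exact (LinearMap.toContinuousLinearMap
    (b.coord (r i))).contDiff.contDiffAt.comp_contDiffWithinAt x h3

theorem contDiffWithinAt_wedge {k l : ℕ} {f : V → E [⋀^Fin k]→L[ℝ] ℝ}
    {g : V → E [⋀^Fin l]→L[ℝ] ℝ} {s : Set V} {x : V} (hf : ContDiffWithinAt ℝ ∞ f s x)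
    (hg : ContDiffWithinAt ℝ ∞ g s x) :
    ContDiffWithinAt ℝ ∞ (fun u => wedge (f u) (g u)) s x := by
  rw [contDiffWithinAt_alternating_iff]
  intro v
  simp only [wedge_apply]
  refine contDiffWithinAt_const.mul (ContDiffWithinAt.sum fun σ _ => contDiffWithinAt_const.mul ?_)
  exact (contDiffWithinAt_alternating_iff.1 hf _).mul (contDiffWithinAt_alternating_iff.1 hg _)

theorem contDiffWithinAt_wedgePow {f : V → E [⋀^Fin 2]→L[ℝ] ℝ} {s : Set V} {x : V}
    (hf : ContDiffWithinAt ℝ ∞ f s x) (p : ℕ) :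
    ContDiffWithinAt ℝ ∞ (fun u => wedgePow (f u) p) s x := by
  induction p with
  | zero => exact contDiffWithinAt_const
  | succ p ih => exact contDiffWithinAt_wedge ih hf

theorem contDiffWithinAt_castDegree {p q : ℕ} (h : p = q) {f : V → E [⋀^Fin p]→L[ℝ] ℝ}
    {s : Set V} {x : V} (hf : ContDiffWithinAt ℝ ∞ f s x) :
    ContDiffWithinAt ℝ ∞ (fun u => castDegree h (f u)) s x := by
  rw [contDiffWithinAt_alternating_iff] at hf ⊢
  intro v
  exact hf _

end FormCalculus

/-! ### Transition maps -/

section Charts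

variable {E : Type*} [NormedAddCommGroup E] [NormedSpace ℂ E] [NormedSpace ℝ E]
  [IsScalarTower ℝ ℂ E] {X : Type*} [TopologicalSpace X] [ChartedSpace E X]

/-- The holomorphic charts. -/
abbrev IsHolChart (e : OpenPartialHomeomorph X E) : Prop :=
  e ∈ IsManifold.maximalAtlas 𝓘(ℂ, E) ω X

theorem contDiffOn_transition {e e' : OpenPartialHomeomorph X E}
    (he : IsHolChart e)
    (he' : IsHolChart e') :
    ContDiffOn ℂ ω (e' ∘ e.symm) (e.symm.trans e').source := by
  have h := (contDiffGroupoid ω 𝓘(ℂ, E)).compatible_of_mem_maximalAtlas he he'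
  rw [contDiffGroupoid, mem_groupoid_of_pregroupoid] at h
  have h1 := h.1
  simp only [contDiffPregroupoid] at h1
  simpa using h1

variable {e e' e'' : OpenPartialHomeomorph X E}

theorem contDiffAt_transition_complex (he : IsHolChart e) (he' : IsHolChart e')
    {x : X} (hx : x ∈ e.source) (hx' : x ∈ e'.source) :
    ContDiffAt ℂ ω (e' ∘ e.symm) (e x) := by
  refine (contDiffOn_transition he he').contDiffAt
    ((e.symm.trans e').open_source.mem_nhds ?_)
  rw [OpenPartialHomeomorph.trans_source]
  exact ⟨e.map_source hx, by simpa [e.left_inv hx] using hx'⟩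

theorem contDiffAt_transition (he : IsHolChart e) (he' : IsHolChart e')
    {x : X} (hx : x ∈ e.source) (hx' : x ∈ e'.source) :
    ContDiffAt ℝ ∞ (e' ∘ e.symm) (e x) :=
  ((contDiffAt_transition_complex he he' hx hx').restrict_scalars ℝ).of_le (by simp)

/-- The derivative at `x` of the transition from the chart `e` to the chart `e'`. -/
def trD (e e' : OpenPartialHomeomorph X E) (x : X) : E →L[ℝ] E :=
  fderiv ℝ (e' ∘ e.symm) (e x)

theorem trD_eq_restrictScalars (he : IsHolChart e) (he' : IsHolChart e')
    {x : X} (hx : x ∈ e.source) (hx' : x ∈ e'.source) :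
    trD e e' x = (fderiv ℂ (e' ∘ e.symm) (e x)).restrictScalars ℝ :=
  ((((contDiffAt_transition_complex he he' hx hx').differentiableAt
    (by simp)).hasFDerivAt).restrictScalars ℝ).fderiv

theorem trD_I (he : IsHolChart e) (he' : IsHolChart e')
    {x : X} (hx : x ∈ e.source) (hx' : x ∈ e'.source) (v : E) :
    trD e e' x (Complex.I • v) = Complex.I • trD e e' x v := by
  rw [trD_eq_restrictScalars he he' hx hx']
  exact (fderiv ℂ (e' ∘ e.symm) (e x)).map_smul Complex.I v

theorem trD_self {x : X} (hx : x ∈ e.source) : trD e e x = ContinuousLinearMap.id ℝ E := by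
  have h : (e ∘ e.symm) =ᶠ[𝓝 (e x)] id := by
    filter_upwards [e.open_target.mem_nhds (e.map_source hx)] with u hu
    exact e.right_inv hu
  rw [trD, h.fderiv_eq, fderiv_id]

theorem trD_comp (he : IsHolChart e) (he' : IsHolChart e') (he'' : IsHolChart e'')
    {x : X} (hx : x ∈ e.source) (hx' : x ∈ e'.source) (hx'' : x ∈ e''.source) :
    trD e e'' x = (trD e' e'' x).comp (trD e e' x) := by
  have h1 := ((contDiffAt_transition he he' hx hx').differentiableAt (by simp)).hasFDerivAt
  have h2 := ((contDiffAt_transition he' he'' hx' hx'').differentiableAt (by simp)).hasFDerivAt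
  have hpt : (e' ∘ e.symm) (e x) = e' x := by simp [e.left_inv hx]
  rw [← hpt] at h2
  have h3 := h2.comp (e x) h1
  have h4 : (e'' ∘ e.symm) =ᶠ[𝓝 (e x)] (e'' ∘ e'.symm) ∘ (e' ∘ e.symm) := by
    have : ContinuousAt e.symm (e x) := e.continuousAt_symm (e.map_source hx)
    have h5 : e.symm ⁻¹' e'.source ∈ 𝓝 (e x) := this.preimage_mem_nhds (by
      rw [e.left_inv hx]
      exact e'.open_source.mem_nhds hx')
    filter_upwards [h5] with u hu
    simp [e'.left_inv hu]
  rw [trD, h4.fderiv_eq, h3.fderiv, trD, trD, hpt]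

theorem trD_symm (he : IsHolChart e) (he' : IsHolChart e')
    {x : X} (hx : x ∈ e.source) (hx' : x ∈ e'.source) :
    (trD e' e x).comp (trD e e' x) = ContinuousLinearMap.id ℝ E := by
  rw [← trD_comp he he' he hx hx' hx, trD_self hx]

theorem trD_trD (he : IsHolChart e) (he' : IsHolChart e')
    {x : X} (hx : x ∈ e.source) (hx' : x ∈ e'.source) (v : E) :
    trD e' e x (trD e e' x v) = v :=
  congrArg (fun L : E →L[ℝ] E => L v) (trD_symm he he' hx hx')

/-- The tangent space at `x` is the model space through the preferred chart, so the manifold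
derivative of `e.symm` is the derivative of the transition from `e` to that chart. This reduces all
pull-backs to the cocycle `trD`. -/
theorem mfderiv_chart_symm (he : IsHolChart e)
    [IsManifold 𝓘(ℂ, E) ω X] {x : X} (hx : x ∈ e.source) :
    (mfderiv 𝓘(ℝ, E) 𝓘(ℝ, E) e.symm (e x) : E →L[ℝ] E) = trD e (chartAt E x) x := by
  have hc : IsHolChart (chartAt E x) :=
    IsManifold.chart_mem_maximalAtlas x
  have hd := (contDiffAt_transition he hc hx (mem_chart_source E x)).differentiableAt (by simp)
  have hmd : MDifferentiableAt 𝓘(ℝ, E) 𝓘(ℝ, E) e.symm (e x) := by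
    rw [mdifferentiableAt_iff]
    refine ⟨e.continuousAt_symm (e.map_source hx), ?_⟩
    simp only [writtenInExtChartAt, mfld_simps]
    rw [e.left_inv hx]
    exact hd.differentiableWithinAt
  unfold mfderiv
  refine (if_pos hmd).trans ?_
  simp only [writtenInExtChartAt, mfld_simps, fderivWithin_univ]
  rw [e.left_inv hx]
  rfl

theorem mfderiv_chart (he : IsHolChart e) [IsManifold 𝓘(ℂ, E) ω X] {x : X} (hx : x ∈ e.source) :
    (mfderiv 𝓘(ℝ, E) 𝓘(ℝ, E) e x : E →L[ℝ] E) = trD (chartAt E x) e x := by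
  have hc : IsHolChart (chartAt E x) :=
    IsManifold.chart_mem_maximalAtlas x
  have hd := (contDiffAt_transition hc he (mem_chart_source E x) hx).differentiableAt (by simp)
  have hmd : MDifferentiableAt 𝓘(ℝ, E) 𝓘(ℝ, E) e x := by
    rw [mdifferentiableAt_iff]
    refine ⟨e.continuousAt hx, ?_⟩
    simp only [writtenInExtChartAt, mfld_simps]
    exact hd.differentiableWithinAt
  unfold mfderiv
  refine (if_pos hmd).trans ?_
  simp only [writtenInExtChartAt, mfld_simps, fderivWithin_univ]
  rfl

/-! ### Operations on forms -/

instance (k : ℕ) : AddCommGroup (DForm E X k) :=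
  inferInstanceAs (AddCommGroup (X → E [⋀^Fin k]→L[ℝ] ℝ))

instance (k : ℕ) : Module ℝ (DForm E X k) :=
  inferInstanceAs (Module ℝ (X → E [⋀^Fin k]→L[ℝ] ℝ))

namespace DForm

variable {k : ℕ}

theorem smul_apply (c : ℝ) (α : DForm E X k) (x : X) : (c • α) x = c • α x := rfl

theorem sum_apply {ι : Type*} (s : Finset ι) (A : ι → DForm E X k) (x : X) :
    (∑ i ∈ s, A i) x = ∑ i ∈ s, A i x :=
  Finset.sum_apply (M := fun _ : X => E [⋀^Fin k]→L[ℝ] ℝ) x s A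

/-- The product of a function and a form. -/
def mul (w : X → ℝ) (α : DForm E X k) : DForm E X k := fun x => w x • α x

theorem mul_apply (w : X → ℝ) (α : DForm E X k) (x : X) : mul w α x = w x • α x := rfl

/-- The wedge product of forms. -/
def wedge {l : ℕ} (α : DForm E X k) (γ : DForm E X l) : DForm E X (k + l) :=
  fun x => GeodesicEinstein.wedge (α x) (γ x)

/-- The powers of a two-form. -/
def wedgePow (F : DForm E X 2) (p : ℕ) : DForm E X (2 * p) :=
  fun x => GeodesicEinstein.wedgePow (F x) p

/-- A form of degree `k` seen as a form of degree `q`. -/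
def cast {q : ℕ} (h : k = q) (α : DForm E X k) : DForm E X q := fun x => castDegree h (α x)

theorem cast_apply {q : ℕ} (h : k = q) (α : DForm E X k) (x : X) :
    cast h α x = castDegree h (α x) := rfl

end DForm

/-! ### Forms in charts -/

theorem compContinuousLinearMap_comp {k : ℕ} {F G : Type*} [NormedAddCommGroup F] [NormedSpace ℝ F]
    [NormedAddCommGroup G] [NormedSpace ℝ G] (a : E [⋀^Fin k]→L[ℝ] ℝ) (f : F →L[ℝ] E)
    (g : G →L[ℝ] F) : (a.compContinuousLinearMap f).compContinuousLinearMap g =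
      a.compContinuousLinearMap (f.comp g) := rfl

variable {k : ℕ} {α β : DForm E X k}

theorem inChart_apply (he : IsHolChart e)
    [IsManifold 𝓘(ℂ, E) ω X] {x : X} (hx : x ∈ e.source) (α : DForm E X k) :
    inChart α e (e x) = (α x).compContinuousLinearMap (trD e (chartAt E x) x) := by
  unfold inChart
  rw [mfderiv_chart_symm he hx, e.left_inv hx]

theorem inChart_transition (he : IsHolChart e) (he' : IsHolChart e')
    [IsManifold 𝓘(ℂ, E) ω X] {x : X} (hx : x ∈ e.source)
    (hx' : x ∈ e'.source) (α : DForm E X k) :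
    inChart α e (e x) = (inChart α e' (e' x)).compContinuousLinearMap (trD e e' x) := by
  rw [inChart_apply he hx, inChart_apply he' hx', compContinuousLinearMap_comp,
    ← trD_comp he he' (IsManifold.chart_mem_maximalAtlas x) hx hx' (mem_chart_source E x)]

theorem inChart_chartAt [IsManifold 𝓘(ℂ, E) ω X] (x : X) (α : DForm E X k) :
    inChart α (chartAt E x) (chartAt E x x) = α x := by
  rw [inChart_apply (IsManifold.chart_mem_maximalAtlas x) (mem_chart_source E x),
    trD_self (mem_chart_source E x)]
  rfl

theorem eq_inChart_comp (he : IsHolChart e)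
    [IsManifold 𝓘(ℂ, E) ω X] {x : X} (hx : x ∈ e.source) (α : DForm E X k) :
    α x = (inChart α e (e x)).compContinuousLinearMap (trD (chartAt E x) e x) := by
  rw [← inChart_chartAt x α,
    inChart_transition (IsManifold.chart_mem_maximalAtlas x) he (mem_chart_source E x) hx]

theorem inChart_congr {u : E} (h : α (e.symm u) = β (e.symm u)) :
    inChart α e u = inChart β e u := by
  unfold inChart
  rw [h]

theorem inChart_eq_zero {u : E} (h : α (e.symm u) = 0) : inChart α e u = 0 := by
  unfold inChart
  rw [h]
  rfl

theorem inChart_smul (w : X → ℝ) (u : E) :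
    inChart (DForm.mul w α) e u = w (e.symm u) • inChart α e u := rfl

theorem inChart_sum {ι : Type*} (s : Finset ι) (A : ι → DForm E X k) (u : E) :
    inChart (∑ i ∈ s, A i) e u = ∑ i ∈ s, inChart (A i) e u := by
  have h : ∀ (a : ι → E [⋀^Fin k]→L[ℝ] ℝ) (f : E →L[ℝ] E),
      (∑ i ∈ s, a i).compContinuousLinearMap f = ∑ i ∈ s, (a i).compContinuousLinearMap f := by
    intro a f
    ext v
    simp
  unfold inChart
  rw [DForm.sum_apply]
  exact h (fun i => A i (e.symm u)) _

theorem inChart_wedge {l : ℕ} (γ : DForm E X l) (u : E) :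
    inChart (DForm.wedge α γ) e u =
      wedge (inChart α e u) (inChart γ e u) := wedge_comp _ _ _

theorem inChart_wedgePow (F : DForm E X 2) (p : ℕ) (u : E) :
    inChart (DForm.wedgePow F p) e u = wedgePow (inChart F e u) p :=
  wedgePow_comp _ _ _

theorem inChart_castDegree {q : ℕ} (h : k = q) (u : E) :
    inChart (DForm.cast h α) e u = castDegree h (inChart α e u) := rfl

theorem eventually_symm {x : X} (hx : x ∈ e.source) {p : X → Prop} (h : ∀ᶠ y in 𝓝 x, p y) :
    ∀ᶠ u in 𝓝 (e x), u ∈ e.target ∧ p (e.symm u) := by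
  have h1 : Filter.Tendsto e.symm (𝓝 (e x)) (𝓝 x) := by
    have := e.continuousAt_symm (e.map_source hx)
    rwa [ContinuousAt, e.left_inv hx] at this
  exact Filter.Eventually.and (e.open_target.mem_nhds (e.map_source hx)) (h1.eventually h)

theorem inChart_eventuallyEq_of_eventuallyEq {x : X} (hx : x ∈ e.source) (h : α =ᶠ[𝓝 x] β) :
    inChart α e =ᶠ[𝓝 (e x)] inChart β e := by
  filter_upwards [eventually_symm hx h] with u hu
  exact inChart_congr hu.2

theorem inChart_eventuallyEq (he : IsHolChart e) (he' : IsHolChart e')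
    [IsManifold 𝓘(ℂ, E) ω X] {x : X} (hx : x ∈ e.source)
    (hx' : x ∈ e'.source) (α : DForm E X k) :
    inChart α e =ᶠ[𝓝 (e x)] fun u => (inChart α e' ((e' ∘ e.symm) u)).compContinuousLinearMap
      (fderiv ℝ (e' ∘ e.symm) u) := by
  filter_upwards [eventually_symm hx (e'.open_source.mem_nhds hx')] with u hu
  have h := inChart_transition he he' (e.map_target hu.1) hu.2 α
  rw [trD, e.right_inv hu.1] at h
  exact h

/-- A form is smooth at a point. -/
def SmoothFormAt (α : DForm E X k) (x : X) : Prop :=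
  ContDiffAt ℝ ∞ (inChart α (chartAt E x)) (chartAt E x x)

variable [FiniteDimensional ℝ E]

theorem contDiffAt_inChart_transition (he : IsHolChart e) (he' : IsHolChart e')
    [IsManifold 𝓘(ℂ, E) ω X] {x : X} (hx : x ∈ e.source)
    (hx' : x ∈ e'.source) (h : ContDiffAt ℝ ∞ (inChart α e') (e' x)) :
    ContDiffAt ℝ ∞ (inChart α e) (e x) := by
  have ht := contDiffAt_transition he he' hx hx'
  refine ContDiffAt.congr_of_eventuallyEq ?_ (inChart_eventuallyEq he he' hx hx' α)
  refine contDiffWithinAt_comp_form (s := Set.univ) ?_ ?_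
  · refine ContDiffAt.comp (e x) (g := inChart α e') ?_ ht
    simpa [e.left_inv hx] using h
  · exact ht.fderiv_right (m := ∞) (by simp)

theorem smoothFormAt_iff (he : IsHolChart e) [IsManifold 𝓘(ℂ, E) ω X] {x : X} (hx : x ∈ e.source) :
    SmoothFormAt α x ↔ ContDiffAt ℝ ∞ (inChart α e) (e x) :=
  ⟨contDiffAt_inChart_transition he (IsManifold.chart_mem_maximalAtlas x) hx (mem_chart_source E x),
    contDiffAt_inChart_transition (IsManifold.chart_mem_maximalAtlas x) he (mem_chart_source E x) hx⟩

theorem isSmoothForm_iff [IsManifold 𝓘(ℂ, E) ω X] :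
    IsSmoothForm α ↔ ∀ x, SmoothFormAt α x := by
  constructor
  · intro h x
    exact (h x).contDiffAt ((chartAt E x).open_target.mem_nhds (mem_chart_target E x))
  · intro h x u hu
    have h1 := (smoothFormAt_iff (IsManifold.chart_mem_maximalAtlas x)
      ((chartAt E x).map_target hu)).1 (h ((chartAt E x).symm u))
    rw [(chartAt E x).right_inv hu] at h1
    exact h1.contDiffWithinAt

theorem IsSmoothForm.contDiffOn_inChart (he : IsHolChart e)
    [IsManifold 𝓘(ℂ, E) ω X] (h : IsSmoothForm α) :
    ContDiffOn ℝ ∞ (inChart α e) e.target := by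
  intro u hu
  have h1 := (smoothFormAt_iff he (e.map_target hu)).1 (isSmoothForm_iff.1 h (e.symm u))
  rw [e.right_inv hu] at h1
  exact h1.contDiffWithinAt

theorem SmoothFormAt.congr {x : X} (h : SmoothFormAt α x) (hb : β =ᶠ[𝓝 x] α) : SmoothFormAt β x :=
  ContDiffAt.congr_of_eventuallyEq h (inChart_eventuallyEq_of_eventuallyEq (mem_chart_source E x) hb)

theorem extD_congr {x : X} (hb : α =ᶠ[𝓝 x] β) : extD α x = extD β x :=
  (inChart_eventuallyEq_of_eventuallyEq (mem_chart_source E x) hb).extDeriv_eq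

/-- The exterior derivative commutes with the pull-back by a transition map; hence `extD`, defined
with the preferred chart at each point, is computed in any chart. -/
theorem inChart_extD (he : IsHolChart e)
    [IsManifold 𝓘(ℂ, E) ω X] {x : X} (hx : x ∈ e.source) (h : SmoothFormAt α x) :
    inChart (extD α) e (e x) = extDeriv (inChart α e) (e x) := by
  have hc : IsHolChart (chartAt E x) := IsManifold.chart_mem_maximalAtlas x
  have hxc := mem_chart_source E x
  rw [inChart_apply he hx, (inChart_eventuallyEq he hc hx hxc α).extDeriv_eq]
  have h2 : (chartAt E x ∘ e.symm) (e x) = chartAt E x x := by simp [e.left_inv hx]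
  have h3 : DifferentiableAt ℝ (inChart α (chartAt E x)) ((chartAt E x ∘ e.symm) (e x)) := by
    rw [h2]
    exact ContDiffAt.differentiableAt h (by simp)
  rw [extDeriv_pullback h3 (contDiffAt_transition he hc hx hxc) (by simpa using two_le_infty), h2]
  rfl

theorem IsSmoothForm.extD [IsManifold 𝓘(ℂ, E) ω X] (h : IsSmoothForm α) :
    IsSmoothForm (extD α) := by
  intro x
  have h1 := contDiff_extDeriv (chartAt E x).open_target (h x)
  refine h1.congr fun u hu => ?_
  have h2 := inChart_extD (α := α) (IsManifold.chart_mem_maximalAtlas x)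
    ((chartAt E x).map_target hu) (isSmoothForm_iff.1 h _)
  rwa [(chartAt E x).right_inv hu] at h2

theorem SmoothFormAt.add {x : X} (ha : SmoothFormAt α x) (hb : SmoothFormAt β x) :
    SmoothFormAt (α + β) x :=
  ContDiffAt.add ha hb

theorem SmoothFormAt.sum {ι : Type*} {s : Finset ι} {A : ι → DForm E X k} {x : X}
    (ha : ∀ i ∈ s, SmoothFormAt (A i) x) : SmoothFormAt (∑ i ∈ s, A i) x := by
  have h := ContDiffAt.sum ha
  refine h.congr_of_eventuallyEq (Filter.Eventually.of_forall fun u => ?_)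
  exact inChart_sum s A u

theorem contDiffAt_comp_chartAt_symm {w : X → ℝ} {x : X}
    (hw : ContMDiffAt 𝓘(ℝ, E) 𝓘(ℝ, ℝ) ∞ w x) :
    ContDiffAt ℝ ∞ (w ∘ (chartAt E x).symm) (chartAt E x x) := by
  have h := (contMDiffAt_iff.1 hw).2
  simp only [mfld_simps, contDiffWithinAt_univ] at h
  exact h

theorem contDiffAt_comp_chart_symm (he : IsHolChart e) [IsManifold 𝓘(ℂ, E) ω X] {w : X → ℝ} {x : X}
    (hx : x ∈ e.source) (hw : ContMDiffAt 𝓘(ℝ, E) 𝓘(ℝ, ℝ) ∞ w x) :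
    ContDiffAt ℝ ∞ (w ∘ e.symm) (e x) := by
  have hc : IsHolChart (chartAt E x) := IsManifold.chart_mem_maximalAtlas x
  have hxc := mem_chart_source E x
  have h1 := contDiffAt_transition he hc hx hxc
  have h2 : ContDiffAt ℝ ∞ ((w ∘ (chartAt E x).symm) ∘ (chartAt E x ∘ e.symm)) (e x) := by
    refine ContDiffAt.comp (e x) ?_ h1
    simpa [e.left_inv hx] using contDiffAt_comp_chartAt_symm hw
  refine h2.congr_of_eventuallyEq ?_
  filter_upwards [eventually_symm hx ((chartAt E x).open_source.mem_nhds hxc)] with u hu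
  simp [(chartAt E x).left_inv hu.2]

theorem SmoothFormAt.smul {w : X → ℝ} {x : X} (hw : ContMDiffAt 𝓘(ℝ, E) 𝓘(ℝ, ℝ) ∞ w x)
    (ha : SmoothFormAt α x) : SmoothFormAt (DForm.mul w α) x :=
  ContDiffAt.smul (contDiffAt_comp_chartAt_symm hw) ha

theorem SmoothFormAt.const_smul (c : ℝ) {x : X}
    (ha : SmoothFormAt α x) : SmoothFormAt (c • α) x :=
  SmoothFormAt.smul contMDiffAt_const ha

theorem SmoothFormAt.wedge {l : ℕ} {γ : DForm E X l} {x : X} (ha : SmoothFormAt α x)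
    (hc : SmoothFormAt γ x) : SmoothFormAt (DForm.wedge α γ) x := by
  refine ContDiffAt.congr_of_eventuallyEq (contDiffWithinAt_wedge (s := Set.univ) ha hc)
    (Filter.Eventually.of_forall fun u => inChart_wedge γ u)

theorem SmoothFormAt.wedgePow {F : DForm E X 2} {x : X} (ha : SmoothFormAt F x) (p : ℕ) :
    SmoothFormAt (DForm.wedgePow F p) x := by
  refine ContDiffAt.congr_of_eventuallyEq (contDiffWithinAt_wedgePow (s := Set.univ) ha p)
    (Filter.Eventually.of_forall fun u => inChart_wedgePow F p u)

theorem SmoothFormAt.castDegree {q : ℕ} (h : k = q) {x : X} (ha : SmoothFormAt α x) :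
    SmoothFormAt (DForm.cast h α) x :=
  contDiffWithinAt_castDegree (s := Set.univ) h ha

theorem smoothFormAt_zero {x : X} : SmoothFormAt (0 : DForm E X k) x :=
  contDiffAt_const.congr_of_eventuallyEq (f := fun _ => 0)
    (Filter.Eventually.of_forall fun _ => inChart_eq_zero rfl)

/-! ### Extension by zero -/

/-- The expression of a form in a chart, extended by zero. -/
def extForm (α : DForm E X k) (e : OpenPartialHomeomorph X E) : E → E [⋀^Fin k]→L[ℝ] ℝ :=
  e.target.indicator (inChart α e)

theorem extForm_of_mem {u : E} (hu : u ∈ e.target) : extForm α e u = inChart α e u :=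
  Set.indicator_of_mem hu _

theorem extForm_of_notMem {u : E} (hu : u ∉ e.target) : extForm α e u = 0 :=
  Set.indicator_of_notMem hu _

theorem inChart_eq_zero_of_image {K : Set X} (hK : ∀ x, x ∉ K → α x = 0) (u : E)
    (hu : u ∈ e.target) (huK : u ∉ e '' K) : inChart α e u = 0 :=
  inChart_eq_zero (hK _ fun h => huK ⟨_, h, e.right_inv hu⟩)

theorem isCompact_image_chart {K : Set X} (hKc : IsCompact K) (hKe : K ⊆ e.source) :
    IsCompact (e '' K) := hKc.image_of_continuousOn (e.continuousOn.mono hKe)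

theorem image_chart_subset {K : Set X} (hKe : K ⊆ e.source) : e '' K ⊆ e.target := by
  rintro _ ⟨x, hx, rfl⟩
  exact e.map_source (hKe hx)

theorem extForm_eq_zero {K : Set X} (hK : ∀ x, x ∉ K → α x = 0) {u : E} (huK : u ∉ e '' K) :
    extForm α e u = 0 :=
  indicator_eq_of_compact (inChart_eq_zero_of_image hK) huK

theorem contDiff_extForm (he : IsHolChart e)
    [IsManifold 𝓘(ℂ, E) ω X] {K : Set X} (hKc : IsCompact K)
    (hKe : K ⊆ e.source) (hK : ∀ x, x ∉ K → α x = 0) (hα : IsSmoothForm α) :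
    ContDiff ℝ ∞ (extForm α e) :=
  contDiff_indicator e.open_target (isCompact_image_chart hKc hKe) (image_chart_subset hKe)
    (hα.contDiffOn_inChart he) (inChart_eq_zero_of_image hK)

theorem hasCompactSupport_extForm {K : Set X} (hKc : IsCompact K)
    (hKe : K ⊆ e.source) (hK : ∀ x, x ∉ K → α x = 0) : HasCompactSupport (extForm α e) :=
  hasCompactSupport_indicator (isCompact_image_chart hKc hKe) (inChart_eq_zero_of_image hK)

theorem extD_eq_zero {K : Set X} (hKc : IsClosed K) (hK : ∀ x, x ∉ K → α x = 0) (x : X)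
    (hx : x ∉ K) : extD α x = 0 := by
  have h : α =ᶠ[𝓝 x] (0 : DForm E X k) := by
    filter_upwards [hKc.isOpen_compl.mem_nhds hx] with y hy
    exact hK y hy
  rw [extD_congr h]
  have h2 : inChart (0 : DForm E X k) (chartAt E x) = fun _ => 0 :=
    funext fun u => inChart_eq_zero rfl
  show extDeriv (inChart _ _) _ = 0
  rw [h2]
  ext v
  rw [extDeriv_eq_sum (differentiableAt_const _)]
  simp

/-- Inside the target of the chart the identity is local. At the other points the extension vanishes
in a neighbourhood, as the image of the support is compact. -/
theorem extForm_extD (he : IsHolChart e) [IsManifold 𝓘(ℂ, E) ω X] {K : Set X} (hKc : IsCompact K)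
    (hKe : K ⊆ e.source) (hK : ∀ x, x ∉ K → α x = 0) (hα : IsSmoothForm α) (u : E) :
    extForm (extD α) e u = extDeriv (extForm α e) u := by
  by_cases hu : u ∈ e.target
  · have h1 : extForm α e =ᶠ[𝓝 u] inChart α e := by
      filter_upwards [e.open_target.mem_nhds hu] with y hy
      exact extForm_of_mem hy
    rw [extForm_of_mem hu, h1.extDeriv_eq]
    have := inChart_extD he (e.map_target hu) (isSmoothForm_iff.1 hα (e.symm u))
    rwa [e.right_inv hu] at this
  · have h1 : extForm α e =ᶠ[𝓝 u] fun _ => 0 := by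
      have hu' : u ∉ e '' K := fun h => hu (image_chart_subset hKe h)
      filter_upwards [(isCompact_image_chart hKc hKe).isClosed.isOpen_compl.mem_nhds hu'] with y hy
      exact extForm_eq_zero hK hy
    rw [extForm_of_notMem hu, h1.extDeriv_eq]
    ext v
    rw [extDeriv_eq_sum (differentiableAt_const _)]
    simp

open Classical in
/-- The form on the manifold with a given expression in a chart, extended by zero. -/
def ofChart (e : OpenPartialHomeomorph X E) (τ : E → E [⋀^Fin k]→L[ℝ] ℝ) : DForm E X k := fun x =>
  if x ∈ e.source then (τ (e x)).compContinuousLinearMap (trD (chartAt E x) e x) else 0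

variable {τ : E → E [⋀^Fin k]→L[ℝ] ℝ}

theorem ofChart_of_mem {x : X} (hx : x ∈ e.source) :
    ofChart e τ x = (τ (e x)).compContinuousLinearMap (trD (chartAt E x) e x) := if_pos hx

theorem ofChart_of_notMem {x : X} (hx : x ∉ e.source) : ofChart e τ x = 0 := if_neg hx

theorem ofChart_eq_zero {x : X} (hx : x ∈ e.source → τ (e x) = 0) : ofChart e τ x = 0 := by
  by_cases h : x ∈ e.source
  · rw [ofChart_of_mem h, hx h]
    rfl
  · exact ofChart_of_notMem h

theorem inChart_ofChart (he : IsHolChart e) [IsManifold 𝓘(ℂ, E) ω X] {u : E} (hu : u ∈ e.target) :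
    inChart (ofChart e τ) e u = τ u := by
  have hx := e.map_target hu
  have h := inChart_apply he hx (ofChart e τ)
  rw [e.right_inv hu, ofChart_of_mem hx, compContinuousLinearMap_comp,
    trD_symm he (IsManifold.chart_mem_maximalAtlas _) hx (mem_chart_source E _),
    e.right_inv hu] at h
  exact h

theorem smoothFormAt_ofChart (he : IsHolChart e)
    [IsManifold 𝓘(ℂ, E) ω X] {x : X} (hx : x ∈ e.source)
    (hτ : ContDiffAt ℝ ∞ τ (e x)) : SmoothFormAt (ofChart e τ) x := by
  rw [smoothFormAt_iff he hx]
  refine hτ.congr_of_eventuallyEq ?_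
  filter_upwards [e.open_target.mem_nhds (e.map_source hx)] with u hu
  exact inChart_ofChart he hu

theorem image_symm_subset {K : Set E} (hKe : K ⊆ e.target) : e.symm '' K ⊆ e.source := by
  rintro _ ⟨x, hx, rfl⟩
  exact e.map_target (hKe hx)

theorem isCompact_image_symm {K : Set E} (hK : IsCompact K) (hKe : K ⊆ e.target) :
    IsCompact (e.symm '' K) :=
  hK.image_of_continuousOn (e.continuousOn_symm.mono hKe)

theorem ofChart_eq_zero_of_image {K : Set E} (h0 : ∀ u, u ∉ K → τ u = 0) (x : X)
    (hx : x ∉ e.symm '' K) : ofChart e τ x = 0 :=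
  ofChart_eq_zero fun h => h0 _ fun hk => hx ⟨_, hk, e.left_inv h⟩

/-- The carrier is compact, hence closed in the Hausdorff manifold, so the form vanishes near every
point outside the chart. -/
theorem isSmoothForm_ofChart (he : IsHolChart e)
    [IsManifold 𝓘(ℂ, E) ω X] [T2Space X] {K : Set E} (hKc : IsCompact K)
    (hKe : K ⊆ e.target) (h0 : ∀ u, u ∉ K → τ u = 0) (hτ : ContDiff ℝ ∞ τ) :
    IsSmoothForm (ofChart e τ) := by
  rw [isSmoothForm_iff]
  intro x
  by_cases hx : x ∈ e.source
  · exact smoothFormAt_ofChart he hx hτ.contDiffAt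
  · have hx' : x ∉ e.symm '' K := fun h => hx (image_symm_subset hKe h)
    refine SmoothFormAt.congr (smoothFormAt_zero (x := x)) ?_
    filter_upwards [(isCompact_image_symm hKc hKe).isClosed.isOpen_compl.mem_nhds hx'] with y hy
    exact ofChart_eq_zero_of_image h0 y hy

theorem extD_ofChart (he : IsHolChart e)
    [IsManifold 𝓘(ℂ, E) ω X] [T2Space X] {K : Set E} (hKc : IsCompact K)
    (hKe : K ⊆ e.target) (h0 : ∀ u, u ∉ K → τ u = 0) (hτ : ContDiff ℝ ∞ τ) (x : X) :
    extD (ofChart e τ) x = ofChart e (extDeriv τ) x := by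
  by_cases hx : x ∈ e.source
  · rw [eq_inChart_comp he hx (extD (ofChart e τ)), inChart_extD he hx (smoothFormAt_ofChart he hx hτ.contDiffAt),
      ofChart_of_mem hx]
    congr 1
    refine Filter.EventuallyEq.extDeriv_eq ?_
    filter_upwards [e.open_target.mem_nhds (e.map_source hx)] with u hu
    exact inChart_ofChart he hu
  · rw [ofChart_of_notMem hx]
    exact extD_eq_zero (isCompact_image_symm hKc hKe).isClosed (ofChart_eq_zero_of_image h0) x
      fun h => hx (image_symm_subset hKe h)

end Charts

end

/-! ### Integration of top-degree forms on a compact complex manifold. -/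

section

open MeasureTheory

section SmoothForms

variable {E : Type*} [NormedAddCommGroup E] [NormedSpace ℂ E] [NormedSpace ℝ E]
  [IsScalarTower ℝ ℂ E] [FiniteDimensional ℝ E] {X : Type*} [TopologicalSpace X] [ChartedSpace E X]
  [IsManifold 𝓘(ℂ, E) ω X] {k : ℕ} {α β : DForm E X k}

theorem IsSmoothForm.smul {w : X → ℝ} (hw : ContMDiff 𝓘(ℝ, E) 𝓘(ℝ, ℝ) ∞ w)
    (h : IsSmoothForm α) : IsSmoothForm (DForm.mul w α) :=
  isSmoothForm_iff.2 fun x => SmoothFormAt.smul (hw x) (isSmoothForm_iff.1 h x)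

theorem IsSmoothForm.add (h : IsSmoothForm α) (h' : IsSmoothForm β) :
    IsSmoothForm (α + β) :=
  isSmoothForm_iff.2 fun x => (isSmoothForm_iff.1 h x).add (isSmoothForm_iff.1 h' x)

theorem IsSmoothForm.sum {ι : Type*} {s : Finset ι} {A : ι → DForm E X k}
    (h : ∀ i ∈ s, IsSmoothForm (A i)) : IsSmoothForm (∑ i ∈ s, A i) :=
  isSmoothForm_iff.2 fun x => SmoothFormAt.sum fun i hi => isSmoothForm_iff.1 (h i hi) x

theorem IsSmoothForm.const_smul (c : ℝ) (h : IsSmoothForm α) :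
    IsSmoothForm (c • α) :=
  h.smul contMDiff_const

theorem IsSmoothForm.wedge {l : ℕ} {γ : DForm E X l} (h : IsSmoothForm α) (h' : IsSmoothForm γ) :
    IsSmoothForm (DForm.wedge α γ) :=
  isSmoothForm_iff.2 fun x => (isSmoothForm_iff.1 h x).wedge (isSmoothForm_iff.1 h' x)

theorem IsSmoothForm.wedgePow {F : DForm E X 2} (h : IsSmoothForm F) (p : ℕ) :
    IsSmoothForm (DForm.wedgePow F p) :=
  isSmoothForm_iff.2 fun x => (isSmoothForm_iff.1 h x).wedgePow p

theorem IsSmoothForm.castDegree {q : ℕ} (hq : k = q) (h : IsSmoothForm α) :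
    IsSmoothForm (DForm.cast hq α) :=
  isSmoothForm_iff.2 fun x => (isSmoothForm_iff.1 h x).castDegree hq

theorem extD_add {x : X} (h : SmoothFormAt α x) (h' : SmoothFormAt β x) :
    extD (α + β) x = extD α x + extD β x :=
  extDeriv_fun_add (ContDiffAt.differentiableAt h (by simp))
    (ContDiffAt.differentiableAt h' (by simp))

theorem extD_const_smul (c : ℝ) (x : X) :
    extD (c • α) x = c • extD α x :=
  extDeriv_smul (x := chartAt E x x) c (inChart α (chartAt E x))

theorem extD_zero (x : X) : extD (0 : DForm E X k) x = 0 := by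
  have := extD_const_smul (α := (0 : DForm E X k)) 0 x
  simpa using this

theorem extD_sum {ι : Type*} (s : Finset ι) {A : ι → DForm E X k} {x : X}
    (h : ∀ i ∈ s, SmoothFormAt (A i) x) :
    extD (∑ i ∈ s, A i) x = ∑ i ∈ s, extD (A i) x := by
  classical
  induction s using Finset.induction_on with
  | empty => simpa using extD_zero x
  | insert i s hi ih =>
    rw [Finset.sum_insert hi, Finset.sum_insert hi,
      ← ih fun j hj => h j (Finset.mem_insert_of_mem hj)]
    exact extD_add (h i (Finset.mem_insert_self i s))
      (SmoothFormAt.sum fun j hj => h j (Finset.mem_insert_of_mem hj))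

theorem extD_extD (h : IsSmoothForm α) (x : X) :
    extD (extD α) x = 0 := by
  have h1 : inChart (extD α) (chartAt E x) =ᶠ[𝓝 (chartAt E x x)]
      extDeriv (inChart α (chartAt E x)) := by
    filter_upwards [(chartAt E x).open_target.mem_nhds (mem_chart_target E x)] with u hu
    have h2 := inChart_extD (α := α) (IsManifold.chart_mem_maximalAtlas x)
      ((chartAt E x).map_target hu) (isSmoothForm_iff.1 h _)
    rwa [(chartAt E x).right_inv hu] at h2
  show extDeriv _ _ = 0
  rw [h1.extDeriv_eq]
  exact extDeriv_extDeriv_apply (isSmoothForm_iff.1 h x) (by simpa using two_le_infty)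

end SmoothForms

section Integral

variable {d : ℕ} {M : Type*} [TopologicalSpace M] [ChartedSpace (CVec d) M]

/-- The integral of a top degree form in a chart. -/
def chartInt (e : OpenPartialHomeomorph M (CVec d)) (α : DForm (CVec d) M (2 * d)) : ℝ :=
  ∫ u, extForm α e u (realBasis d)

/-- The partition chosen in the definition is the same for all forms, which gives linearity
directly. -/
theorem exists_integral_eq (h : Nonempty (ChartPartition (CVec d) M)) :
    ∃ P : ChartPartition (CVec d) M, ∀ α : DForm (CVec d) M (2 * d),
      integral α = ∑ j, chartInt (P.chart j) (DForm.mul (P.weight j) α) := by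
  refine ⟨h.some, fun α => ?_⟩
  unfold integral
  rw [dif_pos h]
  refine Finset.sum_congr rfl fun j _ => ?_
  refine integral_congr_ae (Filter.Eventually.of_forall fun u => ?_)
  by_cases hu : u ∈ (h.some.chart j).target
  · simp only [if_pos hu]
    rw [extForm_of_mem hu]
    rfl
  · simp only [if_neg hu]
    rw [extForm_of_notMem hu]
    rfl

variable [IsManifold 𝓘(ℂ, CVec d) ω M]
  {e e' : OpenPartialHomeomorph M (CVec d)} {α β : DForm (CVec d) M (2 * d)}

theorem trD_realBasis_det (he : IsHolChart e) (he' : IsHolChart e') {x : M} (hx : x ∈ e.source)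
    (hx' : x ∈ e'.source) : 0 < (trD e e' x).det := by
  rw [trD_eq_restrictScalars he he' hx hx']
  refine det_restrictScalars_pos ((fderiv ℂ (e' ∘ e.symm) (e x) : CVec d →ₗ[ℂ] CVec d)) ?_
  intro h0
  have h1 : LinearMap.det (trD e e' x : CVec d →ₗ[ℝ] CVec d) = 0 := by
    rw [trD_eq_restrictScalars he he' hx hx']
    have h3 : LinearMap.det ((fderiv ℂ (e' ∘ e.symm) (e x) : CVec d →ₗ[ℂ] CVec d).restrictScalars ℝ)
        = 0 := by
      rw [LinearMap.det_restrictScalars, h0]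
      exact Algebra.norm_zero
    exact h3
  have h2 := congrArg (fun L : CVec d →L[ℝ] CVec d => LinearMap.det (L : CVec d →ₗ[ℝ] CVec d))
    (trD_symm he he' hx hx')
  simp only [ContinuousLinearMap.toLinearMap_comp, LinearMap.det_comp, h1, mul_zero] at h2
  simp at h2

theorem inChart_realBasis (he : IsHolChart e) (he' : IsHolChart e') {x : M} (hx : x ∈ e.source)
    (hx' : x ∈ e'.source) (α : DForm (CVec d) M (2 * d)) :
    inChart α e (e x) (realBasis d) = (trD e e' x).det * inChart α e' (e' x) (realBasis d) := by
  rw [inChart_transition he he' hx hx']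
  exact alternating_map_realBasis (inChart α e' (e' x)).toAlternatingMap
    (trD e e' x : CVec d →ₗ[ℝ] CVec d)

/-- Change of variables on the overlap of the two charts, off which the form vanishes. The
transition is holomorphic, so its Jacobian is positive and equals its absolute value. -/
theorem chartInt_eq (he : IsHolChart e) (he' : IsHolChart e')
    (h0 : ∀ x, ¬ (x ∈ e.source ∧ x ∈ e'.source) → α x = 0) : chartInt e α = chartInt e' α := by
  set t := e.symm.trans e' with ht
  have hS : ∀ u, u ∈ t.source ↔ u ∈ e.target ∧ e.symm u ∈ e'.source := fun u => by
    rw [ht, OpenPartialHomeomorph.trans_source]; rfl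
  have hT : ∀ u, u ∈ t.target ↔ u ∈ e'.target ∧ e'.symm u ∈ e.source := fun u => by
    rw [ht, OpenPartialHomeomorph.trans_target]; rfl
  have hz : ∀ u, u ∉ t.source → extForm α e u (realBasis d) = 0 := by
    intro u hu
    by_cases hut : u ∈ e.target
    · rw [extForm_of_mem hut, inChart_eq_zero (h0 _ fun h => hu ((hS u).2 ⟨hut, h.2⟩))]
      rfl
    · rw [extForm_of_notMem hut]
      rfl
  have hz' : ∀ u, u ∉ t.target → extForm α e' u (realBasis d) = 0 := by
    intro u hu
    by_cases hut : u ∈ e'.target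
    · rw [extForm_of_mem hut, inChart_eq_zero (h0 _ fun h => hu ((hT u).2 ⟨hut, h.1⟩))]
      rfl
    · rw [extForm_of_notMem hut]
      rfl
  unfold chartInt
  rw [← setIntegral_eq_integral_of_forall_compl_eq_zero hz,
    ← setIntegral_eq_integral_of_forall_compl_eq_zero hz', ← t.image_source_eq_target]
  rw [integral_image_eq_integral_abs_det_fderiv_smul volume t.open_source.measurableSet
    (f := t) (f' := fun u => trD e e' (e.symm u)) ?_ t.injOn]
  · refine setIntegral_congr_fun t.open_source.measurableSet fun u hu => ?_
    obtain ⟨h1, h2⟩ := (hS u).1 hu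
    have h3 := inChart_realBasis he he' (e.map_target h1) h2 α
    rw [e.right_inv h1] at h3
    have h4 : t u = e' (e.symm u) := rfl
    simp only [h4, extForm_of_mem h1, extForm_of_mem (e'.map_source h2), h3, smul_eq_mul,
      abs_of_pos (trD_realBasis_det he he' (e.map_target h1) h2)]
  · intro u hu
    obtain ⟨h1, h2⟩ := (hS u).1 hu
    have h3 := ((contDiffAt_transition he he' (e.map_target h1) h2).differentiableAt
      (by simp)).hasFDerivAt
    refine HasFDerivAt.hasFDerivWithinAt ?_
    rw [e.right_inv h1] at h3
    rw [trD, e.right_inv h1]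
    exact h3

variable [T2Space M] [CompactSpace M]

theorem integrable_extForm (he : IsHolChart e) {K : Set M} (hKc : IsCompact K)
    (hKe : K ⊆ e.source) (hK : ∀ x, x ∉ K → α x = 0) (hα : IsSmoothForm α) :
    Integrable fun u => extForm α e u (realBasis d) :=
  (contDiff_alternating_iff.1 (contDiff_extForm he hKc hKe hK hα) _).continuous.integrable_of_hasCompactSupport
    ((hasCompactSupport_extForm hKc hKe hK).comp_left
      (g := fun a : CVec d [⋀^Fin (2 * d)]→L[ℝ] ℝ => a (realBasis d)) rfl)

theorem extForm_sum {E : Type*} [NormedAddCommGroup E] [NormedSpace ℂ E] [NormedSpace ℝ E]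
    [IsScalarTower ℝ ℂ E] {X : Type*} [TopologicalSpace X] [ChartedSpace E X] {k : ℕ}
    {ι : Type*} (s : Finset ι) (A : ι → DForm E X k) (e : OpenPartialHomeomorph X E) (u : E) :
    extForm (∑ i ∈ s, A i) e u = ∑ i ∈ s, extForm (A i) e u := by
  by_cases hu : u ∈ e.target
  · simp only [extForm, Set.indicator_of_mem hu]
    exact inChart_sum s A u
  · simp only [extForm, Set.indicator_of_notMem hu, Finset.sum_const_zero]

theorem chartInt_sum {ι : Type*} [Fintype ι] (he : IsHolChart e) {K : Set M} (hKc : IsCompact K)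
    (hKe : K ⊆ e.source) (A : ι → DForm (CVec d) M (2 * d)) (hK : ∀ i x, x ∉ K → A i x = 0)
    (hα : ∀ i, IsSmoothForm (A i)) :
    chartInt e (∑ i, A i) = ∑ i, chartInt e (A i) := by
  unfold chartInt
  rw [← integral_finsetSum _ fun i _ => integrable_extForm he hKc hKe (hK i) (hα i)]
  refine integral_congr_ae (Filter.Eventually.of_forall fun u => ?_)
  simp only [extForm_sum, ContinuousAlternatingMap.sum_apply]

theorem sum_weight_smul {E : Type*} [NormedAddCommGroup E] [NormedSpace ℂ E] [NormedSpace ℝ E]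
    {X : Type*} [TopologicalSpace X] [ChartedSpace E X] (P : ChartPartition E X) {k : ℕ}
    (α : DForm E X k) : ∑ j, DForm.mul (P.weight j) α = α := by
  funext x
  simp only [DForm.sum_apply, DForm.mul_apply]
  rw [← Finset.sum_smul, P.weight_sum, one_smul]

theorem weight_smul_eq_zero {E : Type*} [NormedAddCommGroup E] [NormedSpace ℂ E] [NormedSpace ℝ E]
    {X : Type*} [TopologicalSpace X] [ChartedSpace E X] (P : ChartPartition E X) {k : ℕ}
    (α : DForm E X k) (j : Fin P.size) (x : X) (hx : x ∉ tsupport (P.weight j)) :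
    DForm.mul (P.weight j) α x = 0 := by
  rw [DForm.mul_apply, image_eq_zero_of_notMem_tsupport hx, zero_smul]

/-- Each piece cut out by the chosen partition is supported in the overlap of its chart with `e`,
and may be integrated in `e` instead. The dependence on the partition disappears for forms supported
in one chart. -/
theorem integral_eq_chartInt (h : Nonempty (ChartPartition (CVec d) M)) (he : IsHolChart e)
    {K : Set M} (hKc : IsCompact K) (hKe : K ⊆ e.source) (hK : ∀ x, x ∉ K → α x = 0)
    (hα : IsSmoothForm α) : integral α = chartInt e α := by
  obtain ⟨P, hP⟩ := exists_integral_eq h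
  rw [hP]
  conv_rhs => rw [← sum_weight_smul P α]
  rw [chartInt_sum he hKc hKe (fun j => DForm.mul (P.weight j) α) (fun j x hx => by rw [DForm.mul_apply, hK x hx, smul_zero])
    fun j => hα.smul (P.weight_smooth j)]
  refine Finset.sum_congr rfl fun j _ => chartInt_eq (P.chart_mem j) he fun x hx => ?_
  by_cases h1 : x ∈ K
  · refine weight_smul_eq_zero P α j x fun h2 => hx ⟨P.weight_supp j h2, hKe h1⟩
  · rw [DForm.mul_apply, hK x h1, smul_zero]

theorem integral_sum (h : Nonempty (ChartPartition (CVec d) M)) {ι : Type*} [Fintype ι]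
    (A : ι → DForm (CVec d) M (2 * d)) (hα : ∀ i, IsSmoothForm (A i)) :
    integral (∑ i, A i) = ∑ i, integral (A i) := by
  obtain ⟨P, hP⟩ := exists_integral_eq h
  simp only [hP]
  refine Eq.trans ?_ Finset.sum_comm
  refine Finset.sum_congr rfl fun j _ => ?_
  rw [← chartInt_sum (P.chart_mem j) (isClosed_tsupport (P.weight j)).isCompact (P.weight_supp j)
    (fun i => DForm.mul (P.weight j) (A i)) (fun i x hx => weight_smul_eq_zero P (A i) j x hx)
    fun i => (hα i).smul (P.weight_smooth j)]
  congr 1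
  funext x
  simp only [DForm.sum_apply, DForm.mul_apply, Finset.smul_sum]

theorem integral_add (h : Nonempty (ChartPartition (CVec d) M)) (hα : IsSmoothForm α)
    (hβ : IsSmoothForm β) : integral (α + β) = integral α + integral β := by
  have := integral_sum h ![α, β] (fun i => by fin_cases i <;> assumption)
  rwa [Fin.sum_univ_two, Fin.sum_univ_two] at this

theorem integral_const_smul (h : Nonempty (ChartPartition (CVec d) M)) (c : ℝ) :
    integral (c • α) = c * integral α := by
  obtain ⟨P, hP⟩ := exists_integral_eq h
  simp only [hP]
  rw [Finset.mul_sum]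
  refine Finset.sum_congr rfl fun j _ => ?_
  unfold chartInt
  rw [← MeasureTheory.integral_const_mul]
  refine integral_congr_ae (Filter.Eventually.of_forall fun u => ?_)
  by_cases hu : u ∈ (P.chart j).target
  · beta_reduce
    rw [extForm_of_mem hu, extForm_of_mem hu]
    show P.weight j _ • (c • _) = c * (P.weight j _ • _)
    simp only [smul_eq_mul]
    exact mul_left_comm _ _ _
  · beta_reduce
    rw [extForm_of_notMem hu, extForm_of_notMem hu]
    exact (mul_zero c).symm

/-- Stokes' theorem. -/
theorem integral_extD (h : Nonempty (ChartPartition (CVec d) M)) {q : ℕ} (hq : q + 1 = 2 * d)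
    {γ : DForm (CVec d) M q} (hγ : IsSmoothForm γ) :
    integral (DForm.cast hq (extD γ)) = 0 := by
  obtain ⟨P⟩ := id h
  -- The partition cuts `γ` and not its derivative, so that each piece stays exact, with a primitive
  -- supported in one chart.
  have h1 : DForm.cast hq (extD γ) = ∑ j, DForm.cast hq (extD (DForm.mul (P.weight j) γ)) := by
    funext x
    have h2 := extD_sum Finset.univ (A := fun j => DForm.mul (P.weight j) γ) (x := x)
      fun j _ => isSmoothForm_iff.1 (hγ.smul (P.weight_smooth j)) x
    rw [sum_weight_smul P γ] at h2
    rw [DForm.cast_apply, h2, DForm.sum_apply]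
    ext v
    simp [castDegree_apply, DForm.cast_apply]
  rw [h1, integral_sum h _ fun j => ((hγ.smul (P.weight_smooth j)).extD).castDegree hq]
  refine Finset.sum_eq_zero fun j _ => ?_
  have hK := (isClosed_tsupport (P.weight j)).isCompact
  have hs := hγ.smul (P.weight_smooth j)
  have h0 := weight_smul_eq_zero P γ j
  rw [integral_eq_chartInt h (P.chart_mem j) hK (P.weight_supp j) ?_ (hs.extD.castDegree hq)]
  · have h3 := integral_extDeriv_eq_zero (μ := volume)
      (contDiff_extForm (P.chart_mem j) hK (P.weight_supp j) h0 hs)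
      (hasCompactSupport_extForm hK (P.weight_supp j) h0) (fun i => realBasis d (Fin.cast hq i))
    refine Eq.trans ?_ h3
    refine integral_congr_ae (Filter.Eventually.of_forall fun u => ?_)
    simp only [← extForm_extD (P.chart_mem j) hK (P.weight_supp j) h0 hs u]
    by_cases hu : u ∈ (P.chart j).target
    · rw [extForm_of_mem hu, extForm_of_mem hu]
      rfl
    · rw [extForm_of_notMem hu, extForm_of_notMem hu]
      rfl
  · intro x hx
    rw [DForm.cast_apply, extD_eq_zero hK.isClosed h0 x hx]
    rfl

/-- The sign of a top-degree form on the standard frame does not depend on the holomorphic chart. -/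
theorem inChart_realBasis_nonneg (he : IsHolChart e) (h0 : ∀ x, 0 ≤ α x (realBasis d)) {u : CVec d}
    (hu : u ∈ e.target) : 0 ≤ inChart α e u (realBasis d) := by
  have hx := e.map_target hu
  have h1 := inChart_realBasis he (IsManifold.chart_mem_maximalAtlas (e.symm u)) hx
    (mem_chart_source _ _) α
  rw [e.right_inv hu, inChart_chartAt] at h1
  rw [h1]
  exact mul_nonneg (trD_realBasis_det he (IsManifold.chart_mem_maximalAtlas _) hx
    (mem_chart_source _ _)).le (h0 _)

theorem inChart_realBasis_pos (he : IsHolChart e) {u : CVec d}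
    (hu : u ∈ e.target) (h0 : 0 < α (e.symm u) (realBasis d)) :
    0 < inChart α e u (realBasis d) := by
  have hx := e.map_target hu
  have h1 := inChart_realBasis he (IsManifold.chart_mem_maximalAtlas (e.symm u)) hx
    (mem_chart_source _ _) α
  rw [e.right_inv hu, inChart_chartAt] at h1
  rw [h1]
  exact mul_pos (trD_realBasis_det he (IsManifold.chart_mem_maximalAtlas _) hx
    (mem_chart_source _ _)) h0

theorem integral_nonneg (h : Nonempty (ChartPartition (CVec d) M))
    (h0 : ∀ x, 0 ≤ α x (realBasis d)) : 0 ≤ integral α := by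
  obtain ⟨P, hP⟩ := exists_integral_eq h
  rw [hP]
  refine Finset.sum_nonneg fun j _ => MeasureTheory.integral_nonneg fun u => ?_
  by_cases hu : u ∈ (P.chart j).target
  · show 0 ≤ extForm _ _ u _
    rw [extForm_of_mem hu]
    exact inChart_realBasis_nonneg (P.chart_mem j)
      (α := DForm.mul (P.weight j) α) (fun x => mul_nonneg (P.weight_nonneg j x) (h0 x)) hu
  · show 0 ≤ extForm _ _ u _
    rw [extForm_of_notMem hu]
    exact le_rfl

/-- Some weight is positive at a given point, and its summand is the integral of a continuous
nonnegative function that is positive there. -/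
theorem integral_pos [Nonempty M] (h : Nonempty (ChartPartition (CVec d) M)) (hα : IsSmoothForm α)
    (h0 : ∀ x, 0 < α x (realBasis d)) : 0 < integral α := by
  obtain ⟨P, hP⟩ := exists_integral_eq h
  obtain ⟨x⟩ := ‹Nonempty M›
  obtain ⟨i, hi⟩ : ∃ i, 0 < P.weight i x := by
    by_contra hcon
    push Not at hcon
    have := P.weight_sum x
    have h2 : ∑ j, P.weight j x ≤ 0 := Finset.sum_nonpos fun j _ => hcon j
    linarith
  have hnn : ∀ j u, 0 ≤ extForm (DForm.mul (P.weight j) α)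
      (P.chart j) u (realBasis d) := by
    intro j u
    by_cases hu : u ∈ (P.chart j).target
    · rw [extForm_of_mem hu]
      exact inChart_realBasis_nonneg (P.chart_mem j)
        (α := DForm.mul (P.weight j) α) (fun x => mul_nonneg (P.weight_nonneg j x) (h0 x).le) hu
    · rw [extForm_of_notMem hu]
      exact le_rfl
  rw [hP]
  refine Finset.sum_pos' (fun j _ => MeasureTheory.integral_nonneg fun u => hnn j u)
    ⟨i, Finset.mem_univ i, ?_⟩
  have hK := (isClosed_tsupport (P.weight i)).isCompact
  have hs := hα.smul (P.weight_smooth i)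
  have hz := weight_smul_eq_zero P α i
  have hx : x ∈ (P.chart i).source := P.weight_supp i (subset_tsupport _ hi.ne')
  refine Continuous.integral_pos_of_hasCompactSupport_nonneg_nonzero
    (x := P.chart i x) (contDiff_alternating_iff.1
      (contDiff_extForm (P.chart_mem i) hK (P.weight_supp i) hz hs) (realBasis d)).continuous
    ((hasCompactSupport_extForm hK (P.weight_supp i) hz).comp_left
      (g := fun a : CVec d [⋀^Fin (2 * d)]→L[ℝ] ℝ => a (realBasis d)) rfl) (hnn i) ?_
  rw [extForm_of_mem ((P.chart i).map_source hx)]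
  refine (inChart_realBasis_pos (P.chart_mem i) ((P.chart i).map_source hx) ?_).ne'
  rw [(P.chart i).left_inv hx]
  exact mul_pos hi (h0 x)

end Integral

end

/-! ### Integration along the fibres of a holomorphic fibration. -/

section

open MeasureTheory

section FibreIntegral

variable {m n : ℕ} {X M : Type*} [TopologicalSpace X] [ChartedSpace (CVec m × CVec n) X]
  [TopologicalSpace M] [ChartedSpace (CVec m) M]

/-! ### Linear algebra of a change of admissible coordinates -/

/-- The vertical block of a linear map. -/
def verticalBlock (T : CVec m × CVec n →L[ℝ] CVec m × CVec n) : CVec n →L[ℝ] CVec n :=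
  (ContinuousLinearMap.snd ℝ (CVec m) (CVec n)).comp
    (T.comp (ContinuousLinearMap.inr ℝ (CVec m) (CVec n)))

/-- The map `T` preserves the vertical directions, which are inserted in top degree and so produce
the determinant of the vertical block. The vertical component of `T (w, 0)` is killed by the
contraction, which leaves only `D w`. -/
theorem contractFibre_comp {k : ℕ} (A : (CVec m × CVec n) [⋀^Fin (k + 2 * n)]→L[ℝ] ℝ)
    (T : CVec m × CVec n →L[ℝ] CVec m × CVec n) (D : CVec m →L[ℝ] CVec m)
    (hT : ∀ u, (T u).1 = D u.1) :
    contractFibre (A.compContinuousLinearMap T) =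
      (verticalBlock T).det • (contractFibre A).compContinuousLinearMap D := by
  ext w
  show contract (2 * n) (verticalBasis m n) (A.compContinuousLinearMap T) (fun l => (w l, 0)) =
    (verticalBlock T).det • contract (2 * n) (verticalBasis m n) A (fun l => (D (w l), 0))
  rw [contract_comp]
  have h1 : (fun i => T (verticalBasis m n i)) =
      fun i => (ContinuousLinearMap.inr ℝ (CVec m) (CVec n)) (verticalBlock T (realBasis n i)) := by
    funext i
    refine Prod.ext ?_ rfl
    rw [hT]
    show D 0 = 0
    exact map_zero D
  have h2 := alternating_map_realBasis
    ((contractFirst A (fun l => T (w l, 0))).compLinearMap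
      (ContinuousLinearMap.inr ℝ (CVec m) (CVec n) : CVec n →ₗ[ℝ] CVec m × CVec n))
    (verticalBlock T : CVec n →ₗ[ℝ] CVec n)
  have h3 : contract (2 * n) (verticalBasis m n) A (fun l => T (w l, 0)) =
      contract (2 * n) (verticalBasis m n) A (fun l => (D (w l), 0)) := by
    refine contract_congr _ _ _ _ _ fun l => ?_
    have : T (w l, 0) - (D (w l), 0) = (0, (T (w l, 0)).2) := by
      refine Prod.ext ?_ ?_
      · simp [hT]
      · simp
    rw [this]
    exact span_vertical_realBasis _
  rw [h1, ← h3]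
  exact h2

variable {π : X → M} {e e' : OpenPartialHomeomorph X (CVec m × CVec n)}
  {f f' : OpenPartialHomeomorph M (CVec m)}

/-- A transition between admissible charts covers the transition of the base charts: its first
component is a function of `z` alone. -/
theorem trD_fst [IsManifold 𝓘(ℂ, CVec m × CVec n) ω X] [IsManifold 𝓘(ℂ, CVec m) ω M]
    (h : IsAdmissible π e f) (h' : IsAdmissible π e' f') {x : X}
    (hx : x ∈ e.source) (hx' : x ∈ e'.source) (u : CVec m × CVec n) :
    (trD e e' x u).1 = trD f f' (π x) u.1 := by
  have h1 := ((contDiffAt_transition h.top_mem h'.top_mem hx hx').differentiableAt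
    (by simp)).hasFDerivAt
  have h2 := ((contDiffAt_transition h.base_mem h'.base_mem (h.maps x hx)
    (h'.maps x hx')).differentiableAt (by simp)).hasFDerivAt
  rw [h.proj x hx] at h2
  have h3 := h2.comp (e x) (hasFDerivAt_fst (p := e x))
  have h4 : (fun u => ((e' ∘ e.symm) u).1) =ᶠ[𝓝 (e x)] (f' ∘ f.symm) ∘ Prod.fst := by
    filter_upwards [eventually_symm hx (e'.open_source.mem_nhds hx')] with u hu
    have h5 := h'.proj _ hu.2
    have h6 := h.proj _ (e.map_target hu.1)
    rw [e.right_inv hu.1] at h6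
    simp only [Function.comp_apply]
    rw [← h5, ← h6, f.left_inv (h.maps _ (e.map_target hu.1))]
  have h5 := (h1.fst.unique (h3.congr_of_eventuallyEq h4))
  have h6 := congrArg (fun L : CVec m × CVec n →L[ℝ] CVec m => L u) h5
  rw [trD, trD, h.proj x hx]
  exact h6

/-- The vertical block is complex-linear, and it is invertible because the block of the inverse
transition is a left inverse. -/
theorem det_verticalBlock_pos [IsManifold 𝓘(ℂ, CVec m × CVec n) ω X]
    [IsManifold 𝓘(ℂ, CVec m) ω M]
    (h : IsAdmissible π e f) (h' : IsAdmissible π e' f') {x : X}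
    (hx : x ∈ e.source) (hx' : x ∈ e'.source) : 0 < (verticalBlock (trD e e' x)).det := by
  let T := fderiv ℂ (e' ∘ e.symm) (e x)
  let G : CVec n →ₗ[ℂ] CVec n := (LinearMap.snd ℂ (CVec m) (CVec n)).comp
    ((T : CVec m × CVec n →ₗ[ℂ] CVec m × CVec n).comp (LinearMap.inr ℂ (CVec m) (CVec n)))
  have hG : (verticalBlock (trD e e' x) : CVec n →ₗ[ℝ] CVec n) = G.restrictScalars ℝ := by
    rw [trD_eq_restrictScalars h.top_mem h'.top_mem hx hx']
    rfl
  have hinv : (verticalBlock (trD e' e x) : CVec n →ₗ[ℝ] CVec n).comp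
      (verticalBlock (trD e e' x) : CVec n →ₗ[ℝ] CVec n) = LinearMap.id := by
    refine LinearMap.ext fun v => ?_
    have h1 : trD e e' x (0, v) = (0, verticalBlock (trD e e' x) v) := by
      refine Prod.ext ?_ rfl
      rw [trD_fst h h' hx hx']
      exact map_zero _
    have h2 := trD_trD h.top_mem h'.top_mem hx hx' (0, v)
    rw [h1] at h2
    exact congrArg Prod.snd h2
  have hdet : LinearMap.det G ≠ 0 := by
    intro h0
    have h3 : LinearMap.det (G.restrictScalars ℝ) = 0 := by
      rw [LinearMap.det_restrictScalars, h0]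
      exact Algebra.norm_zero
    have h4 := congrArg LinearMap.det hinv
    rw [LinearMap.det_comp, hG, h3, mul_zero, LinearMap.det_id] at h4
    exact zero_ne_one h4
  have := det_restrictScalars_pos G hdet
  rw [← hG] at this
  exact this

/-! ### The integral along the fibres in admissible coordinates -/

variable {k : ℕ}

/-- The integral along the fibres of a form supported in an admissible chart. -/
def chartFib (e : OpenPartialHomeomorph X (CVec m × CVec n)) (f : OpenPartialHomeomorph M (CVec m))
    (Θ : DForm (CVec m × CVec n) X (k + 2 * n)) : DForm (CVec m) M k :=
  ofChart f (fibreInt (extForm Θ e))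

theorem contractFibre_smul (c : ℝ) (A : (CVec m × CVec n) [⋀^Fin (k + 2 * n)]→L[ℝ] ℝ) :
    contractFibre (c • A) = c • contractFibre A := by
  ext w
  simp [contractFibre_apply]

theorem contractFibre_sum {ι : Type*} (s : Finset ι)
    (A : ι → (CVec m × CVec n) [⋀^Fin (k + 2 * n)]→L[ℝ] ℝ) :
    contractFibre (∑ i ∈ s, A i) = ∑ i ∈ s, contractFibre (A i) := by
  ext w
  simp [contractFibre_apply]

variable [IsManifold 𝓘(ℂ, CVec m × CVec n) ω X] [IsManifold 𝓘(ℂ, CVec m) ω M]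

theorem exists_fibreIntegral_eq (h : Nonempty (AdmissiblePartition (m := m) (n := n) π)) :
    ∃ P : AdmissiblePartition (m := m) (n := n) π, ∀ (k : ℕ)
      (Θ : DForm (CVec m × CVec n) X (k + 2 * n)),
      fibreIntegral π Θ = ∑ j, chartFib (P.chart j) (P.base j) (DForm.mul (P.weight j) Θ) := by
  refine ⟨h.some, fun k Θ => ?_⟩
  funext y
  rw [DForm.sum_apply]
  unfold fibreIntegral
  rw [dif_pos h]
  refine Finset.sum_congr rfl fun j _ => ?_
  unfold chartFib
  by_cases hy : y ∈ (h.some.base j).source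
  · rw [if_pos hy, ofChart_of_mem hy, mfderiv_chart (h.some.admissible j).base_mem hy]
    congr 1
    unfold fibreInt
    refine integral_congr_ae (Filter.Eventually.of_forall fun v => ?_)
    beta_reduce
    by_cases hv : (h.some.base j y, v) ∈ (h.some.chart j).target
    · rw [if_pos hv, extForm_of_mem hv]
      exact (contractFibre_smul _ _).symm
    · rw [if_neg hv, extForm_of_notMem hv, contractFibre_zero]
  · rw [if_neg hy, ofChart_of_notMem hy]

variable {K : Set X} {Θ : DForm (CVec m × CVec n) X (k + 2 * n)}

theorem fibreInt_extForm_eq_zero (h : IsAdmissible π e f) (hKe : K ⊆ e.source)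
    (hK : ∀ x, x ∉ K → Θ x = 0) {z : CVec m} (hz : z ∉ f '' (π '' K)) :
    fibreInt (extForm Θ e) z = 0 := by
  refine fibreInt_eq_zero (K := e '' K) (fun u hu => extForm_eq_zero hK hu) ?_
  rintro ⟨_, ⟨x, hx, rfl⟩, rfl⟩
  exact hz ⟨π x, ⟨x, hx, rfl⟩, h.proj x (hKe hx)⟩

theorem chartFib_eq_zero (h : IsAdmissible π e f) (hKe : K ⊆ e.source)
    (hK : ∀ x, x ∉ K → Θ x = 0) {y : M} (hy : y ∉ π '' K) : chartFib e f Θ y = 0 := by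
  refine ofChart_eq_zero fun hyf => fibreInt_extForm_eq_zero h hKe hK ?_
  rintro ⟨_, ⟨x, hx, rfl⟩, h2⟩
  exact hy ⟨x, hx, f.injOn (h.maps x (hKe hx)) hyf h2⟩

theorem IsAdmissible.proj_symm (h : IsAdmissible π e f) {y : M} (hy : y ∈ f.source) {v : CVec n}
    (hv : (f y, v) ∈ e.target) : π (e.symm (f y, v)) = y := by
  have h1 := h.proj _ (e.map_target hv)
  rw [e.right_inv hv] at h1
  exact f.injOn (h.maps _ (e.map_target hv)) hy h1

/-- For a fixed point `y` the two expressions are related by the change of variables between the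
fibre coordinates, whose Jacobian is the vertical block of the transition and is positive. The base
vectors are transported by the transition of the base charts. -/
theorem chartFib_eq (h : IsAdmissible π e f) (h' : IsAdmissible π e' f') (hKc : IsCompact K)
    (hKe : K ⊆ e.source) (hKe' : K ⊆ e'.source) (hK : ∀ x, x ∉ K → Θ x = 0)
    (hΘ : IsSmoothForm Θ) : chartFib e f Θ = chartFib e' f' Θ := by
  funext y
  by_cases hy : y ∈ π '' K
  swap
  · rw [chartFib_eq_zero h hKe hK hy, chartFib_eq_zero h' hKe' hK hy]
  have hyf : y ∈ f.source := by
    obtain ⟨x, hx, rfl⟩ := hy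
    exact h.maps x (hKe hx)
  have hyf' : y ∈ f'.source := by
    obtain ⟨x, hx, rfl⟩ := hy
    exact h'.maps x (hKe' hx)
  have hc : IsHolChart (chartAt (CVec m) y) := IsManifold.chart_mem_maximalAtlas y
  rw [chartFib, chartFib, ofChart_of_mem hyf, ofChart_of_mem hyf',
    trD_comp hc h.base_mem h'.base_mem (mem_chart_source _ y) hyf hyf',
    ← compContinuousLinearMap_comp]
  congr 1
  ext w
  rw [ContinuousAlternatingMap.compContinuousLinearMap_apply,
    fibreInt_apply (contDiff_extForm h.top_mem hKc hKe hK hΘ) (hasCompactSupport_extForm hKc hKe hK),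
    fibreInt_apply (contDiff_extForm h'.top_mem hKc hKe' hK hΘ)
      (hasCompactSupport_extForm hKc hKe' hK)]
  -- `S` is the part of the fibre over `y` seen by both charts, in the coordinates of `e`, and `g`
  -- is the transition restricted to it.
  set S : Set (CVec n) := {v | (f y, v) ∈ e.target ∧ e.symm (f y, v) ∈ e'.source} with hS
  set g : CVec n → CVec n := fun v => (e' (e.symm (f y, v))).2 with hg
  have hSo : IsOpen S :=
    (e.isOpen_inter_preimage_symm e'.open_source).preimage
      (by fun_prop : Continuous fun v : CVec n => (f y, v))
  have hpt : ∀ v ∈ S, e' (e.symm (f y, v)) = (f' y, g v) := by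
    intro v hv
    refine Prod.ext ?_ rfl
    rw [← h'.proj _ hv.2, h.proj_symm hyf hv.1]
  have himg : g '' S = {v | (f' y, v) ∈ e'.target ∧ e'.symm (f' y, v) ∈ e.source} := by
    ext v'
    constructor
    · rintro ⟨v, hv, rfl⟩
      have h1 := hpt v hv
      refine ⟨h1 ▸ e'.map_source hv.2, ?_⟩
      rw [← h1, e'.left_inv hv.2]
      exact e.map_target hv.1
    · rintro ⟨h1, h2⟩
      have h3 : e (e'.symm (f' y, v')) = (f y, (e (e'.symm (f' y, v'))).2) := by
        refine Prod.ext ?_ rfl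
        rw [← h.proj _ h2, h'.proj_symm hyf' h1]
      refine ⟨(e (e'.symm (f' y, v'))).2, ⟨h3 ▸ e.map_source h2, ?_⟩, ?_⟩
      · rw [← h3, e.left_inv h2]
        exact e'.map_target h1
      · rw [hg]
        beta_reduce
        rw [← h3, e.left_inv h2, e'.right_inv h1]
  have hinj : Set.InjOn g S := by
    intro v hv v1 hv1 h12
    have h1 : e' (e.symm (f y, v)) = e' (e.symm (f y, v1)) := by
      rw [hpt v hv, hpt v1 hv1, h12]
    have h2 := e.symm.injOn (show _ ∈ e.symm.source from hv.1) hv1.1 (e'.injOn hv.2 hv1.2 h1)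
    exact congrArg Prod.snd h2
  have hz : ∀ v ∉ S, extForm Θ e (f y, v) (fibreTuple w) = 0 := by
    intro v hv
    by_cases ht : (f y, v) ∈ e.target
    · rw [extForm_of_mem ht, inChart_eq_zero (hK _ fun hx => hv ⟨ht, hKe' hx⟩)]
      rfl
    · rw [extForm_of_notMem ht]
      rfl
  have hz' : ∀ v ∉ g '' S, extForm Θ e' (f' y, v) (fibreTuple (trD f f' y ∘ w)) = 0 := by
    intro v hv
    rw [himg] at hv
    by_cases ht : (f' y, v) ∈ e'.target
    · rw [extForm_of_mem ht, inChart_eq_zero (hK _ fun hx => hv ⟨ht, hKe hx⟩)]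
      rfl
    · rw [extForm_of_notMem ht]
      rfl
  rw [← setIntegral_eq_integral_of_forall_compl_eq_zero hz,
    ← setIntegral_eq_integral_of_forall_compl_eq_zero hz',
    integral_image_eq_integral_abs_det_fderiv_smul volume hSo.measurableSet
      (f' := fun v => verticalBlock (trD e e' (e.symm (f y, v)))) ?_ hinj]
  · refine setIntegral_congr_fun hSo.measurableSet fun v hv => ?_
    have hx := e.map_target hv.1
    have h1 := inChart_transition h.top_mem h'.top_mem hx hv.2 Θ
    rw [e.right_inv hv.1, hpt v hv] at h1
    have h2 := contractFibre_comp (inChart Θ e' (f' y, g v)) (trD e e' (e.symm (f y, v)))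
      (trD f f' y) fun u => by
        rw [trD_fst h h' hx hv.2, h.proj_symm hyf hv.1]
    rw [← h1] at h2
    have h3 := congrArg (fun A : CVec m [⋀^Fin k]→L[ℝ] ℝ => A w) h2
    have h4 : (f' y, g v) ∈ e'.target := hpt v hv ▸ e'.map_source hv.2
    rw [extForm_of_mem hv.1, extForm_of_mem h4, ← contractFibre_apply, ← contractFibre_apply,
      abs_of_pos (det_verticalBlock_pos h h' hx hv.2)]
    exact h3
  · intro v hv
    have hx := e.map_target hv.1
    have h1 := ((contDiffAt_transition h.top_mem h'.top_mem hx hv.2).differentiableAt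
      (by simp)).hasFDerivAt
    rw [e.right_inv hv.1] at h1
    rw [trD, e.right_inv hv.1]
    have h2 : HasFDerivAt (fun v : CVec n => (f y, v))
        (ContinuousLinearMap.inr ℝ (CVec m) (CVec n)) v := hasFDerivAt_prodMk_right _ _
    exact (h1.comp v h2).snd.hasFDerivWithinAt

theorem chartFib_sum {ι : Type*} [Fintype ι] (h : IsAdmissible π e f) (hKc : IsCompact K)
    (hKe : K ⊆ e.source) (A : ι → DForm (CVec m × CVec n) X (k + 2 * n))
    (hK : ∀ i x, x ∉ K → A i x = 0) (hA : ∀ i, IsSmoothForm (A i)) :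
    chartFib e f (∑ i, A i) = ∑ i, chartFib e f (A i) := by
  funext y
  rw [DForm.sum_apply]
  have h1 : fibreInt (extForm (∑ i, A i) e) (f y) = ∑ i, fibreInt (extForm (A i) e) (f y) := by
    unfold fibreInt
    rw [← integral_finsetSum _ fun i _ => integrable_contractFibre
      (contDiff_extForm h.top_mem hKc hKe (hK i) (hA i)) (hasCompactSupport_extForm hKc hKe (hK i)) _]
    refine integral_congr_ae (Filter.Eventually.of_forall fun v => ?_)
    simp only [extForm_sum, contractFibre_sum]
  unfold chartFib
  by_cases hy : y ∈ f.source
  · simp only [ofChart_of_mem hy]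
    rw [h1]
    ext w
    simp
  · simp only [ofChart_of_notMem hy, Finset.sum_const_zero]

variable [T2Space X] [CompactSpace X] [T2Space M]

/-- As for the integral over `M`: on each piece of the chosen partition, its chart may be replaced
by `e`. -/
theorem fibreIntegral_eq_chartFib (hP : Nonempty (AdmissiblePartition (m := m) (n := n) π))
    (h : IsAdmissible π e f) (hKc : IsCompact K) (hKe : K ⊆ e.source)
    (hK : ∀ x, x ∉ K → Θ x = 0) (hΘ : IsSmoothForm Θ) : fibreIntegral π Θ = chartFib e f Θ := by
  obtain ⟨P, hP⟩ := exists_fibreIntegral_eq hP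
  rw [hP]
  conv_rhs => rw [← sum_weight_smul P.toChartPartition Θ]
  have h0 : ∀ j x, x ∉ K → DForm.mul (P.weight j) Θ x = 0 := fun j x hx => by
    rw [DForm.mul_apply, hK x hx, smul_zero]
  have hs := fun j => hΘ.smul (P.weight_smooth j)
  rw [chartFib_sum h hKc hKe _ h0 hs]
  refine Finset.sum_congr rfl fun j _ => ?_
  refine chartFib_eq (P.admissible j) h (hKc.inter_right (isClosed_tsupport (P.weight j)))
    (Set.inter_subset_right.trans (P.weight_supp j)) (Set.inter_subset_left.trans hKe)
    (fun x hx => ?_) (hs j)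
  by_cases h1 : x ∈ K
  · exact weight_smul_eq_zero P.toChartPartition Θ j x fun h2 => hx ⟨h1, h2⟩
  · exact h0 j x h1

theorem fibreIntegral_sum (hP : Nonempty (AdmissiblePartition (m := m) (n := n) π)) {ι : Type*}
    [Fintype ι] (A : ι → DForm (CVec m × CVec n) X (k + 2 * n)) (hA : ∀ i, IsSmoothForm (A i)) :
    fibreIntegral π (∑ i, A i) = ∑ i, fibreIntegral π (A i) := by
  obtain ⟨P, hP⟩ := exists_fibreIntegral_eq hP
  simp only [hP]
  refine Eq.trans ?_ Finset.sum_comm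
  refine Finset.sum_congr rfl fun j _ => ?_
  rw [← chartFib_sum (P.admissible j) (isClosed_tsupport (P.weight j)).isCompact (P.weight_supp j)
    (fun i => DForm.mul (P.weight j) (A i))
    (fun i x hx => weight_smul_eq_zero P.toChartPartition (A i) j x hx)
    fun i => (hA i).smul (P.weight_smooth j)]
  congr 1
  funext x
  simp only [DForm.sum_apply, DForm.mul_apply, Finset.smul_sum]

theorem fibreIntegral_add (hP : Nonempty (AdmissiblePartition (m := m) (n := n) π))
    {Θ' : DForm (CVec m × CVec n) X (k + 2 * n)} (hΘ : IsSmoothForm Θ) (hΘ' : IsSmoothForm Θ') :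
    fibreIntegral π (Θ + Θ') = fibreIntegral π Θ + fibreIntegral π Θ' := by
  have := fibreIntegral_sum hP ![Θ, Θ'] (fun i => by fin_cases i <;> assumption)
  rwa [Fin.sum_univ_two, Fin.sum_univ_two] at this

theorem fibreInt_extForm_compact (h : IsAdmissible π e f) (hπ : Continuous π) (hKc : IsCompact K)
    (hKe : K ⊆ e.source) :
    IsCompact (f '' (π '' K)) ∧ f '' (π '' K) ⊆ f.target := by
  have h1 : π '' K ⊆ f.source := by
    rintro _ ⟨x, hx, rfl⟩
    exact h.maps x (hKe hx)
  exact ⟨isCompact_image_chart (hKc.image hπ) h1, image_chart_subset h1⟩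

theorem isSmoothForm_chartFib (h : IsAdmissible π e f) (hπ : Continuous π) (hKc : IsCompact K)
    (hKe : K ⊆ e.source) (hK : ∀ x, x ∉ K → Θ x = 0) (hΘ : IsSmoothForm Θ) :
    IsSmoothForm (chartFib e f Θ) := by
  obtain ⟨h1, h2⟩ := fibreInt_extForm_compact h hπ hKc hKe
  exact isSmoothForm_ofChart h.base_mem h1 h2 (fun z hz => fibreInt_extForm_eq_zero h hKe hK hz)
    (contDiff_fibreInt (contDiff_extForm h.top_mem hKc hKe hK hΘ)
      (hasCompactSupport_extForm hKc hKe hK))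

theorem isSmoothForm_fibreIntegral (hP : Nonempty (AdmissiblePartition (m := m) (n := n) π))
    (hπ : Continuous π) (hΘ : IsSmoothForm Θ) : IsSmoothForm (fibreIntegral π Θ) := by
  obtain ⟨P, hP⟩ := exists_fibreIntegral_eq hP
  rw [hP]
  exact IsSmoothForm.sum fun j _ => isSmoothForm_chartFib (P.admissible j) hπ
    (isClosed_tsupport (P.weight j)).isCompact (P.weight_supp j)
    (weight_smul_eq_zero P.toChartPartition Θ j) (hΘ.smul (P.weight_smooth j))

theorem extForm_cast {q : ℕ} {Y E : Type*} [NormedAddCommGroup E] [NormedSpace ℂ E]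
    [NormedSpace ℝ E] [IsScalarTower ℝ ℂ E] [TopologicalSpace Y] [ChartedSpace E Y]
    {e : OpenPartialHomeomorph Y E} {p : ℕ} (hq : p = q)
    (α : DForm E Y p) (u : E) : extForm (DForm.cast hq α) e u = castDegree hq (extForm α e u) := by
  unfold extForm
  by_cases hu : u ∈ e.target
  · rw [Set.indicator_of_mem hu, Set.indicator_of_mem hu]
    rfl
  · rw [Set.indicator_of_notMem hu, Set.indicator_of_notMem hu]
    rfl

theorem extD_chartFib (h : IsAdmissible π e f) (hπ : Continuous π) (hKc : IsCompact K)
    (hKe : K ⊆ e.source) (hK : ∀ x, x ∉ K → Θ x = 0) (hΘ : IsSmoothForm Θ)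
    (hk : k + 2 * n + 1 = k + 1 + 2 * n) :
    extD (chartFib e f Θ) = chartFib e f (DForm.cast hk (extD Θ)) := by
  obtain ⟨h1, h2⟩ := fibreInt_extForm_compact h hπ hKc hKe
  have hT := contDiff_extForm h.top_mem hKc hKe hK hΘ
  have hTc := hasCompactSupport_extForm hKc hKe hK
  funext y
  unfold chartFib
  rw [extD_ofChart h.base_mem h1 h2 (fun z hz => fibreInt_extForm_eq_zero h hKe hK hz)
    (contDiff_fibreInt hT hTc)]
  have h3 : extDeriv (fibreInt (extForm Θ e)) =
      fibreInt (extForm (DForm.cast hk (extD Θ)) e) := by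
    funext z
    rw [← fibreInt_extDeriv hT hTc hk]
    congr 1
    funext u
    rw [extForm_cast, extForm_extD h.top_mem hKc hKe hK hΘ]
  rw [h3]

/-- The exterior derivative commutes with the integration along the fibres. -/
theorem extD_fibreIntegral (hP : Nonempty (AdmissiblePartition (m := m) (n := n) π))
    (hπ : Continuous π) (hΘ : IsSmoothForm Θ) (hk : k + 2 * n + 1 = k + 1 + 2 * n) :
    extD (fibreIntegral π Θ) = fibreIntegral π (DForm.cast hk (extD Θ)) := by
  obtain ⟨P⟩ := id hP
  have hK := fun j => (isClosed_tsupport (P.weight j)).isCompact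
  have h0 := weight_smul_eq_zero P.toChartPartition Θ
  have hs := fun j => hΘ.smul (P.weight_smooth j)
  have h1 : fibreIntegral π Θ = ∑ j, fibreIntegral π (DForm.mul (P.weight j) Θ) := by
    rw [← fibreIntegral_sum hP _ hs, sum_weight_smul P.toChartPartition Θ]
  -- Again `Θ` is cut before differentiation, so that each summand is the derivative of a form
  -- supported in an admissible chart.
  have h2 : DForm.cast hk (extD Θ) = ∑ j, DForm.cast hk (extD (DForm.mul (P.weight j) Θ)) := by
    funext x
    have h3 := extD_sum Finset.univ (A := fun j => DForm.mul (P.weight j) Θ) (x := x)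
      fun j _ => isSmoothForm_iff.1 (hs j) x
    rw [sum_weight_smul P.toChartPartition Θ] at h3
    rw [DForm.cast_apply, h3, DForm.sum_apply]
    ext v
    simp [castDegree_apply, DForm.cast_apply]
  have h4 : ∀ j, ∀ x ∉ tsupport (P.weight j),
      DForm.cast hk (extD (DForm.mul (P.weight j) Θ)) x = 0 := by
    intro j x hx
    rw [DForm.cast_apply, extD_eq_zero (hK j).isClosed (h0 j) x hx]
    rfl
  funext y
  rw [h2, fibreIntegral_sum hP _ fun j => (hs j).extD.castDegree hk, h1,
    extD_sum _ fun j _ => isSmoothForm_iff.1 (isSmoothForm_fibreIntegral hP hπ (hs j)) y,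
    DForm.sum_apply]
  refine Finset.sum_congr rfl fun j _ => ?_
  rw [fibreIntegral_eq_chartFib hP (P.admissible j) (hK j) (P.weight_supp j) (h0 j) (hs j),
    fibreIntegral_eq_chartFib hP (P.admissible j) (hK j) (P.weight_supp j) (h4 j)
      ((hs j).extD.castDegree hk),
    extD_chartFib (P.admissible j) hπ (hK j) (P.weight_supp j) (h0 j) (hs j) hk]

/-- The integral along the fibres of an exact form of the degree of the fibre is zero. -/
theorem fibreIntegral_extD_top (hP : Nonempty (AdmissiblePartition (m := m) (n := n) π))
    (h : IsAdmissible π e f) (hKc : IsCompact K) (hKe : K ⊆ e.source)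
    {q : ℕ} {T : DForm (CVec m × CVec n) X q} (hK : ∀ x, x ∉ K → T x = 0) (hT : IsSmoothForm T)
    (hq : q + 1 = 0 + 2 * n) : fibreIntegral π (DForm.cast hq (extD T)) = 0 := by
  have h0 : ∀ x, x ∉ K → DForm.cast hq (extD T) x = 0 := by
    intro x hx
    rw [DForm.cast_apply, extD_eq_zero hKc.isClosed hK x hx]
    rfl
  have hs := hT.extD.castDegree hq
  rw [fibreIntegral_eq_chartFib hP h hKc hKe h0 hs]
  funext y
  refine ofChart_eq_zero fun hy => ?_
  ext w
  rw [fibreInt_apply (contDiff_extForm h.top_mem hKc hKe h0 hs)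
    (hasCompactSupport_extForm hKc hKe h0)]
  have h1 := fibreInt_extDeriv_top (contDiff_extForm h.top_mem hKc hKe hK hT)
    (hasCompactSupport_extForm hKc hKe hK) hq (f y) w
  refine Eq.trans ?_ h1
  refine integral_congr_ae (Filter.Eventually.of_forall fun v => ?_)
  beta_reduce
  rw [extForm_cast, extForm_extD h.top_mem hKc hKe hK hT]

end FibreIntegral

end

/-! ### The curvature of a Hermitian metric and its change with the metric. -/

section

/-! ### The operator `i ∂∂̄` -/

section Iddbar

variable {E : Type*} [NormedAddCommGroup E] [NormedSpace ℂ E] [NormedSpace ℝ E]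
  [IsScalarTower ℝ ℂ E] [FiniteDimensional ℝ E]

/-- The one-form `- (1/2) df ∘ J`, a primitive of `i ∂∂̄ f`. -/
def dcForm (f : E → ℝ) (u : E) : E [⋀^Fin 1]→L[ℝ] ℝ :=
  ContinuousAlternatingMap.ofSubsingleton ℝ E ℝ (0 : Fin 1)
    ((-(1 / 2) : ℝ) • (fderiv ℝ f u).comp (complexStr E))

theorem dcForm_apply (f : E → ℝ) (u : E) (w : Fin 1 → E) :
    dcForm f u w = -(1 / 2) * fderiv ℝ f u (Complex.I • w 0) := rfl

theorem iddbar_eq (f : E → ℝ) (u : E) : iddbar f u = extDeriv (dcForm f) u := by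
  unfold iddbar
  exact (extDeriv_smul (x := u) (-(1 / 2) : ℝ) (fun w => ContinuousAlternatingMap.ofSubsingleton ℝ
    E ℝ (0 : Fin 1) ((fderiv ℝ f w).comp (complexStr E)))).symm

theorem contDiffAt_extDeriv {V : Type*} [NormedAddCommGroup V] [NormedSpace ℝ V]
    {k : ℕ} {T : V → V [⋀^Fin k]→L[ℝ] ℝ} {u : V}
    (hT : ContDiffAt ℝ ∞ T u) : ContDiffAt ℝ ∞ (extDeriv T) u :=
  ContDiffAt.comp u (g := ContinuousAlternatingMap.alternatizeUncurryFinCLM ℝ V ℝ (n := k))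
    (ContinuousLinearMap.contDiff _).contDiffAt (hT.fderiv_right (m := ∞) (by simp))

variable {f g : E → ℝ} {u : E}

theorem contDiffAt_dcForm (hf : ContDiffAt ℝ ∞ f u) : ContDiffAt ℝ ∞ (dcForm f) u := by
  refine (contDiffWithinAt_alternating_iff (s := Set.univ)).2 fun w => ?_
  simp only [dcForm_apply]
  have h1 : ContDiffAt ℝ ∞ (fderiv ℝ f) u := hf.fderiv_right (m := ∞) (by simp)
  have h2 : ContDiffAt ℝ ∞ (fun w' => fderiv ℝ f w' (Complex.I • w 0)) u :=
    h1.clm_apply contDiffAt_const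
  exact (contDiffAt_const.mul h2).contDiffWithinAt

theorem contDiffAt_iddbar (hf : ContDiffAt ℝ ∞ f u) : ContDiffAt ℝ ∞ (iddbar f) u := by
  have : iddbar f = extDeriv (dcForm f) := funext fun u => iddbar_eq f u
  rw [this]
  exact contDiffAt_extDeriv (contDiffAt_dcForm hf)

theorem iddbar_congr (h : f =ᶠ[𝓝 u] g) : iddbar f u = iddbar g u := by
  rw [iddbar_eq, iddbar_eq]
  refine Filter.EventuallyEq.extDeriv_eq ?_
  filter_upwards [h.fderiv (𝕜 := ℝ)] with w hw
  rw [dcForm, dcForm, hw]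

theorem eventually_differentiableAt (hf : ContDiffAt ℝ ∞ f u) :
    ∀ᶠ w in 𝓝 u, DifferentiableAt ℝ f w := by
  have h := (hf.of_le (m := 1) (by simp)).eventually (by simp)
  filter_upwards [h] with w hw
  exact hw.differentiableAt (by simp)

theorem dcForm_add (hf : DifferentiableAt ℝ f u) (hg : DifferentiableAt ℝ g u) :
    dcForm (fun w => f w + g w) u = dcForm f u + dcForm g u := by
  ext w
  rw [ContinuousAlternatingMap.add_apply, dcForm_apply, dcForm_apply, dcForm_apply,
    fderiv_fun_add hf hg, add_apply, mul_add]

theorem iddbar_add (hf : ContDiffAt ℝ ∞ f u) (hg : ContDiffAt ℝ ∞ g u) :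
    iddbar (fun w => f w + g w) u = iddbar f u + iddbar g u := by
  rw [iddbar_eq, iddbar_eq, iddbar_eq, ← extDeriv_fun_add
    ((contDiffAt_dcForm hf).differentiableAt (by simp))
    ((contDiffAt_dcForm hg).differentiableAt (by simp))]
  refine Filter.EventuallyEq.extDeriv_eq ?_
  filter_upwards [eventually_differentiableAt hf, eventually_differentiableAt hg] with w h1 h2
  exact dcForm_add h1 h2

theorem iddbar_apply (hf : ContDiffAt ℝ ∞ f u) (v w : E) : iddbar f u ![v, w] =
    -(1 / 2) * (fderiv ℝ (fderiv ℝ f) u v (Complex.I • w)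
      - fderiv ℝ (fderiv ℝ f) u w (Complex.I • v)) := by
  have hd : DifferentiableAt ℝ (fderiv ℝ f) u :=
    (hf.fderiv_right (m := ∞) (by simp)).differentiableAt (by simp)
  have h1 : ∀ a b : E, fderiv ℝ (fun x => fderiv ℝ f x b) u a = fderiv ℝ (fderiv ℝ f) u a b := by
    intro a b
    rw [fderiv_clm_apply hd (differentiableAt_const b)]
    simp
  have h2 : ∀ a b : E, fderiv ℝ (fun x => -(1 / 2) * fderiv ℝ f x b) u a =
      -(1 / 2) * fderiv ℝ (fderiv ℝ f) u a b := by
    intro a b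
    rw [fderiv_const_mul (hd.clm_apply (differentiableAt_const b)), ← h1]
    rfl
  rw [iddbar_eq, extDeriv_eq_sum ((contDiffAt_dcForm hf).differentiableAt (by simp)),
    Fin.sum_univ_two]
  simp only [dcForm_apply, h2, Fin.removeNth]
  simp
  ring

/-- This follows from the symmetry of the second derivative and `i² = -1`. -/
theorem iddbar_typeOneOne (hf : ContDiffAt ℝ ∞ f u) : IsTypeOneOne (iddbar f u) := by
  intro v w
  have hs : IsSymmSndFDerivAt ℝ f u := hf.isSymmSndFDerivAt (by simpa using two_le_infty)
  have hI : ∀ a : E, Complex.I • Complex.I • a = -a := fun a => by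
    rw [smul_smul, Complex.I_mul_I, neg_one_smul]
  rw [iddbar_apply hf, iddbar_apply hf, hI, hI, map_neg, map_neg, hs (Complex.I • v) w,
    hs (Complex.I • w) v]
  ring

/-- The derivative of a holomorphic map commutes with `i`, so the pull-back of `dcForm f` is `dcForm
(f ∘ T)`, and `d` commutes with pull-backs. -/
theorem iddbar_comp {V : Type*} [NormedAddCommGroup V] [NormedSpace ℂ V] [NormedSpace ℝ V]
    [IsScalarTower ℝ ℂ V] [FiniteDimensional ℝ V] {T : V → E} {u : V} {f : E → ℝ}
    (hT : ContDiffAt ℂ ω T u)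
    (hf : ContDiffAt ℝ ∞ f (T u)) :
    iddbar (f ∘ T) u = (iddbar f (T u)).compContinuousLinearMap (fderiv ℝ T u) := by
  have hTr : ContDiffAt ℝ ∞ T u := (hT.restrict_scalars ℝ).of_le (by simp)
  have h1 := (hT.of_le (m := 1) (by simp)).eventually (by simp)
  have h2 := hT.continuousAt.eventually (eventually_differentiableAt hf)
  rw [iddbar_eq, iddbar_eq, ← extDeriv_pullback
    ((contDiffAt_dcForm hf).differentiableAt (by simp)) hTr (by simpa using two_le_infty)]
  refine Filter.EventuallyEq.extDeriv_eq ?_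
  filter_upwards [h1, h2] with w hw hfw
  have h3 := ((hw.differentiableAt (by simp)).hasFDerivAt).restrictScalars ℝ
  ext b
  rw [ContinuousAlternatingMap.compContinuousLinearMap_apply, dcForm_apply, dcForm_apply,
    (hfw.hasFDerivAt.comp w h3).fderiv, h3.fderiv]
  show -(1 / 2) * fderiv ℝ f (T w) (fderiv ℂ T w (Complex.I • b 0)) =
    -(1 / 2) * fderiv ℝ f (T w) (Complex.I • fderiv ℂ T w (b 0))
  rw [map_smul]

/-- By the Cauchy-Riemann equations the form `dcForm (Re h)` is the differential of `(1/2) Im h`, so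
it is closed. -/
theorem iddbar_re {h : E → ℂ} (hh : ContDiffAt ℂ ω h u) : iddbar (fun w => (h w).re) u = 0 := by
  have hr : ContDiffAt ℝ ∞ h u := (hh.restrict_scalars ℝ).of_le (by simp)
  have h1 := (hh.of_le (m := 1) (by simp)).eventually (by simp)
  have him : ContDiffAt ℝ ∞ (fun w => (1 / 2) * (h w).im) u :=
    contDiffAt_const.mul (Complex.imCLM.contDiff.contDiffAt.comp u hr)
  have h2 : ContDiffAt ℝ ∞ (fun w => ContinuousAlternatingMap.constOfIsEmpty ℝ E (Fin 0)
      ((1 / 2) * (h w).im)) u := by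
    refine (contDiffWithinAt_alternating_iff (s := Set.univ)).2 fun w => ?_
    exact him
  rw [iddbar_eq, ← extDeriv_extDeriv_apply h2 (by simpa using two_le_infty)]
  refine Filter.EventuallyEq.extDeriv_eq ?_
  filter_upwards [h1] with w hw
  have h3 := ((hw.differentiableAt (by simp)).hasFDerivAt).restrictScalars ℝ
  have h4 : HasFDerivAt (fun w => (h w).re) (Complex.reCLM.comp
      ((fderiv ℂ h w).restrictScalars ℝ)) w := Complex.reCLM.hasFDerivAt.comp w h3
  have h5 : HasFDerivAt (fun w => (1 / 2) * (h w).im) ((1 / 2 : ℝ) • Complex.imCLM.comp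
      ((fderiv ℂ h w).restrictScalars ℝ)) w := (Complex.imCLM.hasFDerivAt.comp w h3).const_mul _
  rw [extDeriv_constOfIsEmpty, h5.fderiv]
  ext b
  rw [dcForm_apply, h4.fderiv]
  show -(1 / 2) * (fderiv ℂ h w (Complex.I • b 0)).re = (1 / 2) * (fderiv ℂ h w (b 0)).im
  rw [map_smul]
  simp

/-- Near `u`, the function `log |h|²` is the real part of a holomorphic function. Division of `h` by
its value at `u` brings the argument of the logarithm near 1, inside the domain of the principal
branch. -/
theorem iddbar_log_normSq {h : E → ℂ} (hh : ContDiffAt ℂ ω h u) (h0 : h u ≠ 0) :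
    iddbar (fun w => Real.log (‖h w‖ ^ 2)) u = 0 := by
  have hk : ContDiffAt ℂ ω (fun w => 2 * Complex.log ((h u)⁻¹ * h w)
      + ((2 * Real.log ‖h u‖ : ℝ) : ℂ)) u := by
    refine (contDiffAt_const.mul (ContDiffAt.comp u (Complex.contDiffAt_log ?_)
      (contDiffAt_const.mul hh))).add contDiffAt_const
    rw [inv_mul_cancel₀ h0]
    exact Complex.one_mem_slitPlane
  rw [← iddbar_re hk]
  refine iddbar_congr ?_
  filter_upwards [hh.continuousAt.eventually_ne h0] with w hw
  have h2 : ∀ z : ℂ, (2 * z).re = 2 * z.re := fun z => by simp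
  rw [Complex.add_re, Complex.ofReal_re, h2, Complex.log_re, norm_mul, norm_inv,
    Real.log_mul (inv_ne_zero (norm_ne_zero_iff.2 h0)) (norm_ne_zero_iff.2 hw), Real.log_inv,
    Real.log_pow]
  push_cast
  ring

end Iddbar

/-! ### The curvature of a metric in a chart -/

section Curvature

variable {E : Type*} [NormedAddCommGroup E] [NormedSpace ℂ E] [NormedSpace ℝ E]
  [IsScalarTower ℝ ℂ E] [FiniteDimensional ℝ E] {X : Type*} [TopologicalSpace X]
  [ChartedSpace E X]
  {L : X → Type*} [TopologicalSpace (Bundle.TotalSpace ℂ L)] [∀ x, AddCommGroup (L x)]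
  [∀ x, Module ℂ (L x)] [∀ x, TopologicalSpace (L x)] [FiberBundle ℂ L] [VectorBundle ℂ ℂ L]

/-- The domain of the preferred local frame at `x₀`. -/
abbrev frameSet (L : X → Type*) [TopologicalSpace (Bundle.TotalSpace ℂ L)]
    [∀ x, AddCommGroup (L x)] [∀ x, Module ℂ (L x)] [∀ x, TopologicalSpace (L x)]
    [FiberBundle ℂ L] (x₀ : X) : Set X := (trivializationAt ℂ L x₀).baseSet

theorem localFrame_eq_smul {x₀ x₁ x : X} (h0 : x ∈ frameSet L x₀) (h1 : x ∈ frameSet L x₁) :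
    localFrame L x₁ x = ((trivializationAt ℂ L x₁).coordChangeL ℂ (trivializationAt ℂ L x₀) x
      (1 : ℂ)) • localFrame L x₀ x := by
  set t0 := trivializationAt ℂ L x₀
  set t1 := trivializationAt ℂ L x₁
  rw [Bundle.Trivialization.coordChangeL_apply t1 t0 ⟨h1, h0⟩]
  unfold localFrame
  rw [← Bundle.Trivialization.linearEquivAt_symm_apply (R := ℂ) t0 x h0, ← map_smul, smul_eq_mul, mul_one,
    ← Bundle.Trivialization.linearEquivAt_apply (R := ℂ) t0 x h0, LinearEquiv.symm_apply_apply]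

theorem localFrame_ne_zero {x₀ x : X} (h0 : x ∈ frameSet L x₀) : localFrame L x₀ x ≠ 0 := by
  unfold localFrame
  rw [← Bundle.Trivialization.linearEquivAt_symm_apply (R := ℂ) (trivializationAt ℂ L x₀) x h0]
  intro h
  exact one_ne_zero ((LinearEquiv.map_eq_zero_iff _).1 h)

theorem HermitianMetric.weight_eq (φ : HermitianMetric E L) {x₀ x₁ x : X}
    (h0 : x ∈ frameSet L x₀) (h1 : x ∈ frameSet L x₁) :
    φ.weight x₁ x = φ.weight x₀ x + -Real.log (‖((trivializationAt ℂ L x₁).coordChangeL ℂ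
      (trivializationAt ℂ L x₀) x (1 : ℂ))‖ ^ 2) := by
  have hg : (trivializationAt ℂ L x₁).coordChangeL ℂ (trivializationAt ℂ L x₀) x (1 : ℂ) ≠ 0 :=
    fun h => one_ne_zero ((map_eq_zero_iff _ (ContinuousLinearEquiv.injective _)).1 h)
  unfold HermitianMetric.weight
  rw [localFrame_eq_smul h0 h1, φ.normSq_smul, Real.log_mul (by positivity)
    (φ.normSq_pos x _ (localFrame_ne_zero h0)).ne', neg_add, add_comm]

variable [IsManifold 𝓘(ℂ, E) ω X] {e : OpenPartialHomeomorph X E}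

theorem HermitianMetric.contDiffAt_weight (φ : HermitianMetric E L) (he : IsHolChart e) {x₀ x : X}
    (hx : x ∈ e.source) (h0 : x ∈ frameSet L x₀) :
    ContDiffAt ℝ ∞ (fun u => φ.weight x₀ (e.symm u)) (e x) := by
  have h := contDiffAt_comp_chart_symm he hx ((φ.smooth x₀).contMDiffAt
    ((trivializationAt ℂ L x₀).open_baseSet.mem_nhds h0))
  refine (h.log ?_).neg
  exact (φ.normSq_pos _ _ (localFrame_ne_zero (by rwa [e.left_inv hx]))).ne'

variable [ContMDiffVectorBundle ω ℂ L 𝓘(ℂ, E)]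

/-- The weights for two frames differ by `log |g|²` with `g` the holomorphic transition function,
which `i ∂∂̄` annihilates. -/
theorem curvature_eq (φ : HermitianMetric E L) {x₀ x : X} (h0 : x ∈ frameSet L x₀) :
    curvature φ x = iddbar (fun u => φ.weight x₀ ((chartAt E x).symm u)) (chartAt E x x) := by
  have hc : IsHolChart (chartAt E x) := IsManifold.chart_mem_maximalAtlas x
  have hxc := mem_chart_source E x
  have h1 : x ∈ frameSet L x := FiberBundle.mem_baseSet_trivializationAt' x
  set t0 := trivializationAt ℂ L x₀
  set t1 := trivializationAt ℂ L x
  have hG : ContDiffAt ℂ ω (fun u => (t1.coordChangeL ℂ t0 ((chartAt E x).symm u) : ℂ →L[ℂ] ℂ) 1)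
      (chartAt E x x) := by
    have h2 := (contMDiffAt_iff.1 (contMDiffAt_coordChangeL (n := ω) (IB := 𝓘(ℂ, E)) h1 h0)).2
    simp only [mfld_simps, contDiffWithinAt_univ] at h2
    exact ContDiffAt.clm_apply h2 contDiffAt_const
  have hG0 : (t1.coordChangeL ℂ t0 ((chartAt E x).symm (chartAt E x x)) : ℂ →L[ℂ] ℂ) 1 ≠ 0 :=
    fun h => one_ne_zero ((map_eq_zero_iff _ (ContinuousLinearEquiv.injective _)).1 h)
  have hlog := iddbar_log_normSq hG hG0
  have hlogs : ContDiffAt ℝ ∞ (fun u => Real.log (‖(t1.coordChangeL ℂ t0 ((chartAt E x).symm u) :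
      ℂ →L[ℂ] ℂ) 1‖ ^ 2)) (chartAt E x x) := by
    have hGr : ContDiffAt ℝ ∞ _ _ := (hG.restrict_scalars ℝ).of_le (by simp)
    exact (hGr.norm_sq ℝ).log (by positivity)
  have h3 : (fun u => φ.weight x₀ ((chartAt E x).symm u)) =ᶠ[𝓝 (chartAt E x x)]
      fun u => φ.weight x ((chartAt E x).symm u) + Real.log (‖(t1.coordChangeL ℂ t0
        ((chartAt E x).symm u) : ℂ →L[ℂ] ℂ) 1‖ ^ 2) := by
    have h4 := (t0.open_baseSet.inter t1.open_baseSet).mem_nhds ⟨h0, h1⟩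
    filter_upwards [eventually_symm hxc h4] with u hu
    rw [φ.weight_eq hu.2.1 hu.2.2]
    exact (neg_add_cancel_right _ _).symm
  rw [iddbar_congr h3, iddbar_add (φ.contDiffAt_weight hc hxc h1) hlogs, hlog, add_zero]
  rfl

/-- The curvature in a chart, through the weight of any of the local frames. -/
theorem inChart_curvature (φ : HermitianMetric E L) (he : IsHolChart e) {x₀ x : X}
    (hx : x ∈ e.source) (h0 : x ∈ frameSet L x₀) :
    inChart (curvature φ) e (e x) = iddbar (fun u => φ.weight x₀ (e.symm u)) (e x) := by
  have hc : IsHolChart (chartAt E x) := IsManifold.chart_mem_maximalAtlas x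
  have hxc := mem_chart_source E x
  have hpt : (chartAt E x ∘ e.symm) (e x) = chartAt E x x := by simp [e.left_inv hx]
  rw [inChart_apply he hx, curvature_eq φ h0, trD, ← hpt, ← iddbar_comp
    (contDiffAt_transition_complex he hc hx hxc) (by
      rw [hpt]
      exact φ.contDiffAt_weight hc hxc h0)]
  refine iddbar_congr ?_
  filter_upwards [eventually_symm hx ((chartAt E x).open_source.mem_nhds hxc)] with u hu
  simp [(chartAt E x).left_inv hu.2]

theorem inChart_curvature_eventuallyEq (φ : HermitianMetric E L) (he : IsHolChart e) {x₀ x : X}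
    (hx : x ∈ e.source) (h0 : x ∈ frameSet L x₀) :
    inChart (curvature φ) e =ᶠ[𝓝 (e x)] iddbar (fun u => φ.weight x₀ (e.symm u)) := by
  filter_upwards [eventually_symm hx ((trivializationAt ℂ L x₀).open_baseSet.mem_nhds h0)] with u hu
  have := inChart_curvature φ he (e.map_target hu.1) hu.2
  rwa [e.right_inv hu.1] at this

theorem isSmoothForm_curvature (φ : HermitianMetric E L) : IsSmoothForm (curvature φ) := by
  rw [isSmoothForm_iff]
  intro x
  have hc : IsHolChart (chartAt E x) := IsManifold.chart_mem_maximalAtlas x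
  have h1 : x ∈ frameSet L x := FiberBundle.mem_baseSet_trivializationAt' x
  exact (contDiffAt_iddbar (φ.contDiffAt_weight hc (mem_chart_source E x) h1)).congr_of_eventuallyEq
    (inChart_curvature_eventuallyEq φ hc (mem_chart_source E x) h1)

theorem inChart_curvature_typeOneOne (φ : HermitianMetric E L) (he : IsHolChart e) {u : E}
    (hu : u ∈ e.target) : IsTypeOneOne (inChart (curvature φ) e u) := by
  have hx := e.map_target hu
  have h1 : e.symm u ∈ frameSet L (e.symm u) := FiberBundle.mem_baseSet_trivializationAt' _
  have h2 := inChart_curvature φ he hx h1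
  have h3 := φ.contDiffAt_weight he hx h1
  rw [e.right_inv hu] at h2 h3
  rw [h2]
  exact iddbar_typeOneOne h3

/-! ### Change of the metric -/

theorem HermitianMetric.ext' {φ ψ : HermitianMetric E L}
    (h : ∀ x s, φ.normSq x s = ψ.normSq x s) : φ = ψ := by
  cases φ
  cases ψ
  congr
  funext x s
  exact h x s

/-- The metric with weight `φ + h`. -/
def HermitianMetric.twist (φ : HermitianMetric E L) (h : X → ℝ)
    (hh : ContMDiff 𝓘(ℝ, E) 𝓘(ℝ, ℝ) ∞ h) : HermitianMetric E L where
  normSq x s := Real.exp (-h x) * φ.normSq x s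
  normSq_pos x s hs := mul_pos (Real.exp_pos _) (φ.normSq_pos x s hs)
  normSq_smul x c s := by
    rw [φ.normSq_smul]
    ring
  smooth x₀ := by
    have h1 : ContMDiff 𝓘(ℝ, E) 𝓘(ℝ, ℝ) ∞ fun x => Real.exp (-h x) :=
      (Real.contDiff_exp.comp contDiff_neg).contMDiff.comp hh
    exact h1.contMDiffOn.mul (φ.smooth x₀)

theorem HermitianMetric.weight_twist (φ : HermitianMetric E L) {h : X → ℝ}
    (hh : ContMDiff 𝓘(ℝ, E) 𝓘(ℝ, ℝ) ∞ h) {x₀ x : X} (h0 : x ∈ frameSet L x₀) :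
    (φ.twist h hh).weight x₀ x = φ.weight x₀ x + h x := by
  show -Real.log (Real.exp (-h x) * φ.normSq x (localFrame L x₀ x)) = _
  rw [Real.log_mul (Real.exp_pos _).ne' (φ.normSq_pos x _ (localFrame_ne_zero h0)).ne',
    Real.log_exp, neg_add, neg_neg, add_comm]
  rfl

theorem HermitianMetric.twist_twist (φ : HermitianMetric E L) {h h' : X → ℝ}
    (hh : ContMDiff 𝓘(ℝ, E) 𝓘(ℝ, ℝ) ∞ h) (hh' : ContMDiff 𝓘(ℝ, E) 𝓘(ℝ, ℝ) ∞ h') :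
    (φ.twist h hh).twist h' hh' = φ.twist (h + h') (hh.add hh') := by
  refine HermitianMetric.ext' fun x s => ?_
  show Real.exp (-h' x) * (Real.exp (-h x) * φ.normSq x s) =
    Real.exp (-(h x + h' x)) * φ.normSq x s
  rw [← mul_assoc, ← Real.exp_add]
  congr 2
  ring

theorem exists_eq_smul_localFrame (x : X) (s : L x) : ∃ c : ℂ, s = c • localFrame L x x := by
  have h0 : x ∈ frameSet L x := FiberBundle.mem_baseSet_trivializationAt' x
  refine ⟨(trivializationAt ℂ L x).linearEquivAt ℂ x h0 s, ?_⟩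
  unfold localFrame
  rw [← Bundle.Trivialization.linearEquivAt_symm_apply (R := ℂ) (trivializationAt ℂ L x) x h0, ← map_smul,
    smul_eq_mul, mul_one, LinearEquiv.symm_apply_apply]

/-- The ratio of two metrics on a line bundle is a positive function. The difference of their
weights is independent of the frame, as a change of frame adds the same term to both, and is smooth
in a fixed frame. -/
theorem exists_twist (φ ψ : HermitianMetric E L) :
    ∃ (h : X → ℝ) (hh : ContMDiff 𝓘(ℝ, E) 𝓘(ℝ, ℝ) ∞ h), φ = ψ.twist h hh := by
  have hmem : ∀ x : X, x ∈ frameSet L x := fun x => FiberBundle.mem_baseSet_trivializationAt' x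
  have hw : ∀ x₀ x : X, x ∈ frameSet L x₀ →
      φ.weight x x - ψ.weight x x = φ.weight x₀ x - ψ.weight x₀ x := by
    intro x₀ x hx
    rw [φ.weight_eq hx (hmem x), ψ.weight_eq hx (hmem x)]
    ring
  have hh : ContMDiff 𝓘(ℝ, E) 𝓘(ℝ, ℝ) ∞ fun x => φ.weight x x - ψ.weight x x := by
    intro x₀
    have h1 : ∀ χ : HermitianMetric E L, ContMDiffAt 𝓘(ℝ, E) 𝓘(ℝ, ℝ) ∞ (χ.weight x₀) x₀ := by
      intro χ
      have h2 := (χ.smooth x₀).contMDiffAt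
        ((trivializationAt ℂ L x₀).open_baseSet.mem_nhds (hmem x₀))
      have h3 : ContDiffAt ℝ ∞ (fun t => -Real.log t) (χ.normSq x₀ (localFrame L x₀ x₀)) :=
        (Real.contDiffAt_log.2 (χ.normSq_pos x₀ _ (localFrame_ne_zero (hmem x₀))).ne').neg
      exact ContMDiffAt.comp (g := fun t => -Real.log t) x₀ h3.contMDiffAt h2
    refine ((h1 φ).sub (h1 ψ)).congr_of_eventuallyEq ?_
    filter_upwards [(trivializationAt ℂ L x₀).open_baseSet.mem_nhds (hmem x₀)] with x hx
    exact hw x₀ x hx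
  refine ⟨_, hh, HermitianMetric.ext' fun x s => ?_⟩
  obtain ⟨c, rfl⟩ := exists_eq_smul_localFrame x s
  have h1 := φ.normSq_pos x _ (localFrame_ne_zero (hmem x))
  have h2 := ψ.normSq_pos x _ (localFrame_ne_zero (hmem x))
  show _ = Real.exp (-(-Real.log _ - -Real.log _)) * _
  rw [φ.normSq_smul, ψ.normSq_smul, show ∀ a b : ℝ, -(-a - -b) = a - b from fun a b => by ring,
    Real.exp_sub, Real.exp_log h1, Real.exp_log h2]
  field_simp

end Curvature

/-! ### Positivity on the fibres -/

section Fibrewise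

variable {m n : ℕ} {X M : Type*} [TopologicalSpace X] [ChartedSpace (CVec m × CVec n) X]
  [TopologicalSpace M] [ChartedSpace (CVec m) M]
  [IsManifold 𝓘(ℂ, CVec m × CVec n) ω X] [IsManifold 𝓘(ℂ, CVec m) ω M]
  {L : X → Type*} [TopologicalSpace (Bundle.TotalSpace ℂ L)] [∀ x, AddCommGroup (L x)]
  [∀ x, Module ℂ (L x)] [∀ x, TopologicalSpace (L x)] [FiberBundle ℂ L] [VectorBundle ℂ ℂ L]
  {π : X → M} {e : OpenPartialHomeomorph X (CVec m × CVec n)}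
  {f : OpenPartialHomeomorph M (CVec m)}

theorem mfderiv_vertical (h : IsAdmissible π e f) {x : X} (hx : x ∈ e.source)
    (v : CVec n) :
    (mfderiv 𝓘(ℂ, CVec m × CVec n) 𝓘(ℂ, CVec m) π x : CVec m × CVec n →L[ℂ] CVec m)
      (trD e (chartAt _ x) x (0, v)) = 0 := by
  have hc : IsHolChart (chartAt (CVec m × CVec n) x) := IsManifold.chart_mem_maximalAtlas x
  have hcM : IsHolChart (chartAt (CVec m) (π x)) := IsManifold.chart_mem_maximalAtlas (π x)
  have hxc := mem_chart_source (CVec m × CVec n) x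
  have hxM := mem_chart_source (CVec m) (π x)
  have h1 := ((contDiffAt_transition_complex hc h.top_mem hxc hx).differentiableAt
    (by simp)).hasFDerivAt
  have h2 := ((contDiffAt_transition_complex h.base_mem hcM (h.maps x hx) hxM).differentiableAt
    (by simp)).hasFDerivAt
  have hpt : ((e ∘ (chartAt (CVec m × CVec n) x).symm) (chartAt _ x x)).1 = f (π x) := by
    simp only [Function.comp_apply, (chartAt (CVec m × CVec n) x).left_inv hxc]
    exact (h.proj x hx).symm
  have h3 := HasFDerivAt.comp (g := chartAt (CVec m) (π x) ∘ f.symm)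
    (g' := fderiv ℂ (chartAt (CVec m) (π x) ∘ f.symm) (f (π x))) (chartAt _ x x)
    (by rw [hpt]; exact h2) h1.fst
  have h4 : (chartAt (CVec m) (π x) ∘ π ∘ (chartAt (CVec m × CVec n) x).symm) =ᶠ[𝓝 (chartAt _ x x)]
      (chartAt (CVec m) (π x) ∘ f.symm) ∘
        fun u => ((e ∘ (chartAt (CVec m × CVec n) x).symm) u).1 := by
    filter_upwards [eventually_symm hxc (e.open_source.mem_nhds hx)] with u hu
    simp only [Function.comp_apply]
    rw [← h.proj _ hu.2, f.left_inv (h.maps _ hu.2)]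
  have h5 := h3.congr_of_eventuallyEq h4
  have h6 : trD (chartAt _ x) e x (trD e (chartAt _ x) x (0, v)) = (0, v) :=
    trD_trD h.top_mem hc hx hxc (0, v)
  rw [trD_eq_restrictScalars hc h.top_mem hxc hx] at h6
  -- At a point where `π` is not differentiable, `mfderiv` is zero by convention and the claim is
  -- trivial.
  by_cases hmd : MDifferentiableAt 𝓘(ℂ, CVec m × CVec n) 𝓘(ℂ, CVec m) π x
  · have h8 : (mfderiv 𝓘(ℂ, CVec m × CVec n) 𝓘(ℂ, CVec m) π x : CVec m × CVec n →L[ℂ] CVec m) =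
        (fderiv ℂ (chartAt (CVec m) (π x) ∘ f.symm) (f (π x))).comp
          ((ContinuousLinearMap.fst ℂ (CVec m) (CVec n)).comp
            (fderiv ℂ (e ∘ (chartAt (CVec m × CVec n) x).symm) (chartAt _ x x))) := by
      unfold mfderiv
      refine (if_pos hmd).trans ?_
      simp only [writtenInExtChartAt, mfld_simps, fderivWithin_univ]
      exact h5.fderiv
    rw [h8]
    show fderiv ℂ (chartAt (CVec m) (π x) ∘ f.symm) (f (π x)) (fderiv ℂ (e ∘ (chartAt _ x).symm)
      (chartAt _ x x) (trD e (chartAt _ x) x (0, v))).1 = 0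
    rw [show fderiv ℂ (e ∘ (chartAt (CVec m × CVec n) x).symm)
      (chartAt _ x x) (trD e (chartAt _ x) x (0, v)) = (0, v) from h6]
    exact map_zero _
  · have h8 : (mfderiv 𝓘(ℂ, CVec m × CVec n) 𝓘(ℂ, CVec m) π x :
        CVec m × CVec n →L[ℂ] CVec m) = 0 := by
      unfold mfderiv
      exact if_neg hmd
    rw [h8]
    rfl

/-- The vector `(0, v)` of the admissible chart, read in the preferred chart, is a nonzero element
of the kernel of the differential of `π`, and the transition commutes with `i`. -/
theorem inChart_curvature_vertical_pos
    {φ : HermitianMetric (CVec m × CVec n) L}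
    (hφ : IsFibrewisePositive π φ) (h : IsAdmissible π e f) {x : X} (hx : x ∈ e.source)
    {v : CVec n} (hv : v ≠ 0) :
    0 < inChart (curvature φ) e (e x) ![(0, v), Complex.I • (0, v)] := by
  have hc : IsHolChart (chartAt (CVec m × CVec n) x) := IsManifold.chart_mem_maximalAtlas x
  have hxc := mem_chart_source (CVec m × CVec n) x
  have h1 := hφ x (trD e (chartAt _ x) x (0, v)) ?_ (mfderiv_vertical h hx v)
  · rw [inChart_apply h.top_mem hx, two_form_comp_apply, trD_I h.top_mem hc hx hxc]
    exact h1
  · intro h0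
    have h2 := trD_trD h.top_mem hc hx hxc (0, v)
    rw [h0, map_zero] at h2
    exact hv (congrArg Prod.snd h2).symm

theorem inChart_pos {E : Type*} [NormedAddCommGroup E] [NormedSpace ℂ E] [NormedSpace ℝ E]
    [IsScalarTower ℝ ℂ E] [FiniteDimensional ℝ E] {Y : Type*} [TopologicalSpace Y]
    [ChartedSpace E Y] [IsManifold 𝓘(ℂ, E) ω Y] {e : OpenPartialHomeomorph Y E}
    (he : IsHolChart e) {α : DForm E Y 2} (hα : ∀ x (v : E), v ≠ 0 → 0 < α x ![v, Complex.I • v])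
    {x : Y} (hx : x ∈ e.source) {v : E} (hv : v ≠ 0) :
    0 < inChart α e (e x) ![v, Complex.I • v] := by
  have hc : IsHolChart (chartAt E x) := IsManifold.chart_mem_maximalAtlas x
  have hxc := mem_chart_source E x
  rw [inChart_apply he hx, two_form_comp_apply, trD_I he hc hx hxc]
  refine hα x _ fun h0 => hv ?_
  have h2 := trD_trD he hc hx hxc v
  rw [h0, map_zero] at h2
  exact h2.symm

end Fibrewise

end

/-! ### Existence of partitions of unity and of admissible coordinates. -/

section

/-! ### Partitions of unity -/

section Partition

variable {E : Type*} [NormedAddCommGroup E] [NormedSpace ℂ E] [NormedSpace ℝ E]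
  [IsScalarTower ℝ ℂ E] [FiniteDimensional ℝ E] {X : Type*} [TopologicalSpace X]
  [ChartedSpace E X] [IsManifold 𝓘(ℂ, E) ω X]

theorem isManifold_real : IsManifold 𝓘(ℝ, E) ∞ X := by
  refine isManifold_of_contDiffOn _ _ _ fun e e' he he' => ?_
  have h1 := contDiffOn_transition (e := e) (e' := e')
    (IsManifold.subset_maximalAtlas he) (IsManifold.subset_maximalAtlas he')
  have h2 : ContDiffOn ℝ ∞ (e' ∘ e.symm) (e.symm.trans e').source :=
    (h1.restrict_scalars ℝ).of_le (by simp)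
  simpa [mfld_simps] using h2

theorem exists_partition [T2Space X] [CompactSpace X] (U : X → Set X) (hU : ∀ x, IsOpen (U x))
    (hx : ∀ x, x ∈ U x) : ∃ (N : ℕ) (p : Fin N → X) (w : Fin N → X → ℝ),
      (∀ j, ContMDiff 𝓘(ℝ, E) 𝓘(ℝ, ℝ) ∞ (w j)) ∧ (∀ j x, 0 ≤ w j x) ∧
      (∀ j, tsupport (w j) ⊆ U (p j)) ∧ ∀ x, ∑ j, w j x = 1 := by
  obtain ⟨t, ht⟩ := isCompact_univ.elim_finite_subcover U hU
    fun x _ => Set.mem_iUnion.2 ⟨x, hx x⟩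
  have hM : IsManifold 𝓘(ℝ, E) ∞ X := isManifold_real
  obtain ⟨w, hw⟩ := SmoothPartitionOfUnity.exists_isSubordinate 𝓘(ℝ, E) isClosed_univ
    (fun i : t => U i) (fun i => hU i) (by
      intro x hx
      obtain ⟨i, hi⟩ := Set.mem_iUnion.1 (ht hx)
      obtain ⟨hit, hxi⟩ := Set.mem_iUnion.1 hi
      exact Set.mem_iUnion.2 ⟨⟨i, hit⟩, hxi⟩)
  refine ⟨t.card, fun j => t.equivFin.symm j, fun j => w (t.equivFin.symm j),
    fun j => (w _).contMDiff, fun j x => w.nonneg _ x, fun j => hw _, fun x => ?_⟩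
  have h1 := w.sum_eq_one (Set.mem_univ x)
  rw [finsum_eq_sum_of_fintype] at h1
  rw [← h1]
  exact Equiv.sum_comp t.equivFin.symm fun i => w i x

/-- This keeps `integral` away from its default value 0, taken when no partition exists. -/
theorem nonempty_chartPartition [T2Space X] [CompactSpace X] : Nonempty (ChartPartition E X) := by
  obtain ⟨N, p, w, h1, h2, h3, h4⟩ := exists_partition (E := E) (fun x : X => (chartAt E x).source)
    (fun x => (chartAt E x).open_source) (fun x => mem_chart_source E x)
  exact ⟨⟨N, fun j => chartAt E (p j), fun j => IsManifold.chart_mem_maximalAtlas _, w, h1, h2, h3,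
    h4⟩⟩

end Partition

/-! ### Admissible coordinates -/

section Admissible

/-- The kernel of `A` has dimension `n`; `B` is a projection onto it followed by an isomorphism with
`ℂ^n`. A vector killed by both lies in the kernel and has zero projection. -/
theorem exists_complement {m n : ℕ} (A : CVec m × CVec n →L[ℂ] CVec m)
    (hA : Function.Surjective A) : ∃ (B : CVec m × CVec n →L[ℂ] CVec n)
      (T : (CVec m × CVec n) ≃L[ℂ] CVec m × CVec n),
      (T : CVec m × CVec n →L[ℂ] CVec m × CVec n) = A.prod B := by
  let K := LinearMap.ker (A : CVec m × CVec n →ₗ[ℂ] CVec m)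
  have hdim : Module.finrank ℂ K = Module.finrank ℂ (CVec n) := by
    have h1 := LinearMap.finrank_range_add_finrank_ker (A : CVec m × CVec n →ₗ[ℂ] CVec m)
    have h2 : LinearMap.range (A : CVec m × CVec n →ₗ[ℂ] CVec m) = ⊤ :=
      LinearMap.range_eq_top.2 hA
    rw [h2, finrank_top, Module.finrank_prod] at h1
    exact Nat.add_left_cancel h1
  let φ : K ≃ₗ[ℂ] CVec n := LinearEquiv.ofFinrankEq _ _ hdim
  obtain ⟨q, hq⟩ := LinearMap.exists_leftInverse_of_injective K.subtype
    (LinearMap.ker_eq_bot.2 K.injective_subtype)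
  let B : CVec m × CVec n →L[ℂ] CVec n := LinearMap.toContinuousLinearMap (φ.toLinearMap ∘ₗ q)
  have hinj : Function.Injective (A.prod B : CVec m × CVec n →ₗ[ℂ] CVec m × CVec n) := by
    rw [← LinearMap.ker_eq_bot, LinearMap.ker_eq_bot']
    intro x hx
    have h1 : A x = 0 := congrArg Prod.fst hx
    have h2 : φ (q x) = 0 := congrArg Prod.snd hx
    have h3 : q x = ⟨x, h1⟩ := congrArg (fun L : K →ₗ[ℂ] K => L ⟨x, h1⟩) hq
    rw [LinearEquiv.map_eq_zero_iff, h3] at h2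
    exact congrArg Subtype.val h2
  refine ⟨B, (LinearEquiv.ofInjectiveEndo _ hinj).toContinuousLinearEquiv, ?_⟩
  ext x <;> rfl

variable {m n : ℕ} {X M : Type*} [TopologicalSpace X] [ChartedSpace (CVec m × CVec n) X]
  [TopologicalSpace M] [ChartedSpace (CVec m) M]
  [IsManifold 𝓘(ℂ, CVec m × CVec n) ω X] [IsManifold 𝓘(ℂ, CVec m) ω M]
  {π : X → M}

/-- Holomorphic rank theorem: the coordinates of `π`, completed by linear functions whose
differentials are independent of those of `π` at the point, form a local chart by the inverse
function theorem. -/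
theorem exists_admissible (hπ : IsHolomorphicFibration m n π) (x₀ : X) {U : Set X} (hU : IsOpen U)
    (hx₀ : x₀ ∈ U) : ∃ (e : OpenPartialHomeomorph X (CVec m × CVec n))
      (f : OpenPartialHomeomorph M (CVec m)), IsAdmissible π e f ∧ x₀ ∈ e.source ∧ e.source ⊆ U := by
  set c := chartAt (CVec m × CVec n) x₀ with hc
  set d := chartAt (CVec m) (π x₀) with hd
  have hcm : IsHolChart c := IsManifold.chart_mem_maximalAtlas x₀
  have hdm : IsHolChart d := IsManifold.chart_mem_maximalAtlas (π x₀)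
  have hxc : x₀ ∈ c.source := mem_chart_source _ x₀
  have hxd : π x₀ ∈ d.source := mem_chart_source _ (π x₀)
  have hP : ContDiffAt ℂ ω (d ∘ π ∘ c.symm) (c x₀) := by
    have h := (contMDiffAt_iff.1 (hπ.holomorphic x₀)).2
    simp only [mfld_simps, contDiffWithinAt_univ] at h
    exact h
  have hA : Function.Surjective (fderiv ℂ (d ∘ π ∘ c.symm) (c x₀)) := by
    have h := hπ.submersion x₀
    have hmd := (hπ.holomorphic x₀).mdifferentiableAt (by simp)
    have h8 : (mfderiv 𝓘(ℂ, CVec m × CVec n) 𝓘(ℂ, CVec m) π x₀ : CVec m × CVec n →L[ℂ] CVec m) =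
        fderiv ℂ (d ∘ π ∘ c.symm) (c x₀) := by
      unfold mfderiv
      refine (if_pos hmd).trans ?_
      simp only [writtenInExtChartAt, mfld_simps, fderivWithin_univ]
      rfl
    rw [← h8]
    exact h
  obtain ⟨B, T, hT⟩ := exists_complement _ hA
  set G : CVec m × CVec n → CVec m × CVec n := fun u => ((d ∘ π ∘ c.symm) u, B u) with hG
  have hGd : ContDiffAt ℂ ω G (c x₀) := hP.prodMk B.contDiff.contDiffAt
  have hG' : HasFDerivAt G (T : CVec m × CVec n →L[ℂ] CVec m × CVec n) (c x₀) := by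
    rw [hT]
    exact (hP.differentiableAt (by simp)).hasFDerivAt.prodMk B.hasFDerivAt
  let Φ := hGd.toOpenPartialHomeomorph G hG' (by simp)
  have hΦ : (Φ : CVec m × CVec n → CVec m × CVec n) = G := rfl
  -- The inverse function theorem gives regularity of the inverse only at the image of a point where
  -- the derivative is invertible. The domain is therefore shrunk until this holds everywhere,
  -- together with the conditions on `U` and on the base chart.
  have hev : ∀ᶠ u in 𝓝 (c x₀), ContDiffAt ℂ ω G u ∧
      (∃ T' : (CVec m × CVec n) ≃L[ℂ] CVec m × CVec n,
        HasFDerivAt G (T' : CVec m × CVec n →L[ℂ] CVec m × CVec n) u) ∧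
      (u ∈ c.target ∧ (c.symm u ∈ U ∧ π (c.symm u) ∈ d.source)) := by
    have h1 := hGd.eventually (by simp)
    have h2 : ContinuousAt (fderiv ℂ G) (c x₀) :=
      (hGd.fderiv_right (m := ω) (by simp)).continuousAt
    have h3 := h2.eventually (hG'.fderiv ▸ ContinuousLinearEquiv.nhds T)
    have h4 := eventually_symm hxc (p := fun x => x ∈ U ∧ π x ∈ d.source)
      (Filter.Eventually.and (hU.mem_nhds hx₀)
        (hπ.holomorphic.continuous.continuousAt.eventually (d.open_source.mem_nhds hxd)))
    filter_upwards [h1, h3, h4] with u hu1 hu3 hu4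
    obtain ⟨T', hT'⟩ := hu3
    refine ⟨hu1, ⟨T', ?_⟩, hu4⟩
    rw [hT']
    exact (hu1.differentiableAt (by simp)).hasFDerivAt
  obtain ⟨V, hV, hVo, hVx⟩ := eventually_nhds_iff.1 hev
  let Φ' := Φ.restrOpen V hVo
  have hΦs : Φ'.source = Φ.source ∩ V := Φ.restrOpen_source V hVo
  have hΦm : ContDiffOn ℂ ω Φ' Φ'.source := by
    intro u hu
    rw [hΦs] at hu
    exact (hV u hu.2).1.contDiffWithinAt
  have hΦsm : ContDiffOn ℂ ω Φ'.symm Φ'.target := by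
    intro u hu
    have h1 := Φ'.map_target hu
    rw [hΦs] at h1
    obtain ⟨h2, ⟨T', hT'⟩, h3⟩ := hV _ h1.2
    exact (Φ'.contDiffAt_symm hu hT' h2).contDiffWithinAt
  refine ⟨c.trans Φ', d, ⟨?_, hdm, ?_, ?_⟩, ?_, ?_⟩
  · refine OpenPartialHomeomorph.mem_maximalAtlas_of_contMDiffOn _ ?_ ?_
    · refine hΦm.contMDiffOn.comp ((contMDiffOn_of_mem_maximalAtlas hcm).mono ?_) ?_
      · rw [OpenPartialHomeomorph.trans_source]
        exact Set.inter_subset_left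
      · rw [OpenPartialHomeomorph.trans_source]
        exact Set.inter_subset_right
    · refine (contMDiffOn_symm_of_mem_maximalAtlas hcm).comp (hΦsm.contMDiffOn.mono ?_) ?_
      · rw [OpenPartialHomeomorph.trans_target]
        exact Set.inter_subset_left
      · rw [OpenPartialHomeomorph.trans_target]
        exact Set.inter_subset_right
  · intro x hx
    rw [OpenPartialHomeomorph.trans_source, hΦs] at hx
    have := (hV _ hx.2.2).2.2.2.2
    rwa [c.left_inv hx.1] at this
  · intro x hx
    rw [OpenPartialHomeomorph.trans_source, hΦs] at hx
    show d (π x) = d (π (c.symm (c x)))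
    rw [c.left_inv hx.1]
  · rw [OpenPartialHomeomorph.trans_source, hΦs]
    exact ⟨hxc, hGd.mem_toOpenPartialHomeomorph_source hG' (by simp), hVx⟩
  · intro x hx
    rw [OpenPartialHomeomorph.trans_source, hΦs] at hx
    have := (hV _ hx.2.2).2.2.2.1
    rwa [c.left_inv hx.1] at this

/-- There is an admissible partition whose charts lie in given open neighbourhoods. -/
theorem exists_admissiblePartition [T2Space X] [CompactSpace X]
    (hπ : IsHolomorphicFibration m n π) (U : X → Set X)
    (hU : ∀ x, IsOpen (U x)) (hx : ∀ x, x ∈ U x) :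
    ∃ P : AdmissiblePartition (m := m) (n := n) π, ∀ j, ∃ x, (P.chart j).source ⊆ U x := by
  choose e f hef hxe heU using fun x => exists_admissible hπ x (hU x) (hx x)
  obtain ⟨N, p, w, h1, h2, h3, h4⟩ := exists_partition (E := CVec m × CVec n)
    (fun x : X => (e x).source) (fun x => (e x).open_source) hxe
  exact ⟨⟨⟨N, fun j => e (p j), fun j => (hef _).top_mem, w, h1, h2, h3, h4⟩, fun j => f (p j),
    fun j => hef _⟩, fun j => ⟨p j, heU _⟩⟩

theorem compactSpace_total [CompactSpace M] (hπ : IsHolomorphicFibration m n π) :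
    CompactSpace X := by
  refine ⟨?_⟩
  have := hπ.proper.isCompact_preimage (isCompact_univ (X := M))
  simpa using this

end Admissible

end

/-! ### Transgression of the powers of the curvature. -/

section

/-! ### Primitives of the powers of `i ∂∂̄ f`

The powers of `i ∂∂̄ f` are pulled back, by the graph of `df`, from a constant form on
`E* × E`, which has a linear primitive. -/

section Primitive

variable {E : Type*} [NormedAddCommGroup E] [NormedSpace ℂ E] [NormedSpace ℝ E]
  [IsScalarTower ℝ ℂ E] [FiniteDimensional ℝ E]

theorem extDeriv_clm {W : Type*} [NormedAddCommGroup W] [NormedSpace ℝ W] {k : ℕ}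
    (Λ : W →L[ℝ] W [⋀^Fin k]→L[ℝ] ℝ) (w : W) :
    extDeriv (fun w => Λ w) w = ContinuousAlternatingMap.alternatizeUncurryFin Λ := by
  unfold extDeriv
  congr 1
  exact Λ.fderiv

theorem contDiff_clm_form {W : Type*} [NormedAddCommGroup W] [NormedSpace ℝ W] {k : ℕ}
    (Λ : W →L[ℝ] W [⋀^Fin k]→L[ℝ] ℝ) : ContDiff ℝ ∞ fun w => Λ w := Λ.contDiff

/-- The tautological one-form on `E* × E`. -/
def tautForm (E : Type*) [NormedAddCommGroup E] [NormedSpace ℝ E] [FiniteDimensional ℝ E] :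
    ((E →L[ℝ] ℝ) × E) →L[ℝ] ((E →L[ℝ] ℝ) × E) [⋀^Fin 1]→L[ℝ] ℝ :=
  LinearMap.toContinuousLinearMap
    { toFun := fun w : (E →L[ℝ] ℝ) × E => ContinuousAlternatingMap.ofSubsingleton ℝ
        ((E →L[ℝ] ℝ) × E) ℝ (0 : Fin 1) (w.1.comp (ContinuousLinearMap.snd ℝ (E →L[ℝ] ℝ) E))
      map_add' := fun w w' => by
        ext v
        rfl
      map_smul' := fun c w => by
        ext v
        rfl }

/-- A linear primitive of the powers of the symplectic form on `E* × E`. -/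
def symplecticPrim (E : Type*) [NormedAddCommGroup E] [NormedSpace ℝ E] [FiniteDimensional ℝ E]
    (p : ℕ) : ((E →L[ℝ] ℝ) × E) →L[ℝ] ((E →L[ℝ] ℝ) × E) [⋀^Fin (2 * p + 1)]→L[ℝ] ℝ :=
  ((2 * p + 2 : ℝ)⁻¹) • ContinuousAlternatingMap.curryLeft (n := 2 * p + 1)
    (wedgePow (ContinuousAlternatingMap.alternatizeUncurryFin (tautForm E)) (p + 1))

/-- Inserting the position vector in a constant form of degree `2p + 2` and differentiating
multiplies the form by its degree, hence the normalization. -/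
theorem extDeriv_symplecticPrim (p : ℕ) (w : (E →L[ℝ] ℝ) × E) :
    extDeriv (fun w => symplecticPrim E p w) w =
      wedgePow (ContinuousAlternatingMap.alternatizeUncurryFin (tautForm E)) (p + 1) := by
  rw [extDeriv_clm, symplecticPrim, ContinuousAlternatingMap.alternatizeUncurryFin_smul,
    ContinuousAlternatingMap.alternatizeUncurryFin_curryLeft]
  ext v
  simp only [ContinuousAlternatingMap.smul_apply, nsmul_eq_mul, smul_eq_mul]
  push_cast
  field_simp
  ring

/-- The graph of the differential, twisted by the complex structure. -/
def graphMap (f : E → ℝ) (u : E) : (E →L[ℝ] ℝ) × E :=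
  ((-(1 / 2) : ℝ) • (fderiv ℝ f u).comp (complexStr E), u)

/-- A primitive of `(i ∂∂̄ f)^(p+1)`. -/
def primForm (p : ℕ) (f : E → ℝ) (u : E) : E [⋀^Fin (2 * p + 1)]→L[ℝ] ℝ :=
  (symplecticPrim E p (graphMap f u)).compContinuousLinearMap (fderiv ℝ (graphMap f) u)

variable {f g : E → ℝ} {u : E}

theorem contDiffAt_graphMap (hf : ContDiffAt ℝ ∞ f u) : ContDiffAt ℝ ∞ (graphMap f) u := by
  have h1 : ContDiffAt ℝ ∞ (fderiv ℝ f) u := hf.fderiv_right (m := ∞) (by simp)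
  exact ((h1.clm_comp contDiffAt_const).const_smul (-(1 / 2) : ℝ)).prodMk contDiffAt_id

theorem contDiffAt_primForm (p : ℕ) (hf : ContDiffAt ℝ ∞ f u) :
    ContDiffAt ℝ ∞ (primForm p f) u := by
  have h := contDiffAt_graphMap hf
  exact contDiffWithinAt_comp_form (s := Set.univ)
    (ContDiffAt.comp (g := fun w => symplecticPrim E p w) u
      (contDiff_clm_form (symplecticPrim E p)).contDiffAt h) (h.fderiv_right (m := ∞) (by simp))

/-- The pull-back of the tautological one-form by the graph is `dcForm f`, and `d` commutes with the
pull-back. -/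
theorem iddbar_eq_pullback (hf : ContDiffAt ℝ ∞ f u) : iddbar f u =
    (ContinuousAlternatingMap.alternatizeUncurryFin (tautForm E)).compContinuousLinearMap
      (fderiv ℝ (graphMap f) u) := by
  have h := contDiffAt_graphMap hf
  rw [iddbar_eq, ← extDeriv_clm (tautForm E) (graphMap f u), ← extDeriv_pullback
    ((contDiff_clm_form (tautForm E)).contDiffAt.differentiableAt (by simp)) h (by simpa using two_le_infty)]
  refine Filter.EventuallyEq.extDeriv_eq ?_
  filter_upwards [(h.of_le (m := 1) (by simp)).eventually (by simp)] with w hw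
  ext v
  have h1 := ((hw.differentiableAt (by simp)).hasFDerivAt).snd
  have h2 : HasFDerivAt (fun w => (graphMap f w).2) (ContinuousLinearMap.id ℝ E) w :=
    hasFDerivAt_id w
  have h3 := congrArg (fun T : E →L[ℝ] E => T (v 0)) (h1.unique h2)
  show -(1 / 2) * fderiv ℝ f w (Complex.I • v 0) =
    -(1 / 2) * fderiv ℝ f w (Complex.I • (fderiv ℝ (graphMap f) w (v 0)).2)
  rw [show (fderiv ℝ (graphMap f) w (v 0)).2 = v 0 from h3]

theorem extDeriv_primForm (p : ℕ) (hf : ContDiffAt ℝ ∞ f u) :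
    extDeriv (primForm p f) u = wedgePow (iddbar f u) (p + 1) := by
  rw [iddbar_eq_pullback hf, ← wedgePow_comp, ← extDeriv_symplecticPrim p (graphMap f u)]
  exact extDeriv_pullback ((contDiff_clm_form (symplecticPrim E p)).contDiffAt.differentiableAt
    (by simp)) (contDiffAt_graphMap hf) (by simpa using two_le_infty)

/-- The primitive is local in `f`. The primitives of two weights thus agree wherever the weights
agree locally, which keeps the support of the transgression form under control. -/
theorem primForm_congr (p : ℕ) (h : f =ᶠ[𝓝 u] g) : primForm p f u = primForm p g u := by
  have h1 : graphMap f =ᶠ[𝓝 u] graphMap g := by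
    filter_upwards [h.fderiv (𝕜 := ℝ)] with w hw
    rw [graphMap, hw, graphMap]
  unfold primForm
  rw [h1.fderiv_eq, h1.eq_of_nhds]

end Primitive

theorem extDeriv_form_sub {V : Type*} [NormedAddCommGroup V] [NormedSpace ℝ V] {k : ℕ}
    {a b : V → V [⋀^Fin k]→L[ℝ] ℝ} {u : V} (ha : DifferentiableAt ℝ a u)
    (hb : DifferentiableAt ℝ b u) :
    extDeriv (fun w => a w - b w) u = extDeriv a u - extDeriv b u := by
  unfold extDeriv
  rw [fderiv_fun_sub ha hb]
  exact map_sub (ContinuousAlternatingMap.alternatizeUncurryFinCLM ℝ V ℝ) _ _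

/-! ### Powers of the curvature: closedness and transgression -/

section Transgression

variable {E : Type*} [NormedAddCommGroup E] [NormedSpace ℂ E] [NormedSpace ℝ E]
  [IsScalarTower ℝ ℂ E] [FiniteDimensional ℝ E] {X : Type*} [TopologicalSpace X]
  [ChartedSpace E X] [IsManifold 𝓘(ℂ, E) ω X]
  {L : X → Type*} [TopologicalSpace (Bundle.TotalSpace ℂ L)] [∀ x, AddCommGroup (L x)]
  [∀ x, Module ℂ (L x)] [∀ x, TopologicalSpace (L x)] [FiberBundle ℂ L] [VectorBundle ℂ ℂ L]
  [ContMDiffVectorBundle ω ℂ L 𝓘(ℂ, E)] {e : OpenPartialHomeomorph X E}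

theorem inChart_wedgePow_curvature (φ : HermitianMetric E L) (he : IsHolChart e) {x₀ x : X}
    (hx : x ∈ e.source) (h0 : x ∈ frameSet L x₀) (p : ℕ) :
    inChart (DForm.wedgePow (curvature φ) (p + 1)) e (e x) =
      extDeriv (primForm p fun u => φ.weight x₀ (e.symm u)) (e x) := by
  rw [inChart_wedgePow, inChart_curvature φ he hx h0, extDeriv_primForm p
    (φ.contDiffAt_weight he hx h0)]

theorem extD_wedgePow_curvature (φ : HermitianMetric E L) (p : ℕ) (x : X) :
    extD (DForm.wedgePow (curvature φ) (p + 1)) x = 0 := by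
  have hc : IsHolChart (chartAt E x) := IsManifold.chart_mem_maximalAtlas x
  have hxc := mem_chart_source E x
  have h0 : x ∈ frameSet L x := FiberBundle.mem_baseSet_trivializationAt' x
  unfold extD
  rw [← extDeriv_extDeriv_apply (contDiffAt_primForm p (φ.contDiffAt_weight hc hxc h0))
    (by simpa using two_le_infty)]
  refine Filter.EventuallyEq.extDeriv_eq ?_
  filter_upwards [eventually_symm hxc ((trivializationAt ℂ L x).open_baseSet.mem_nhds h0)] with u hu
  have h := inChart_wedgePow_curvature φ hc ((chartAt E x).map_target hu.1) hu.2 p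
  rwa [(chartAt E x).right_inv hu.1] at h

/-- A local change of the metric changes the powers of the curvature by exact forms with the same
support. -/
theorem exists_transgression [T2Space X] (ψ : HermitianMetric E L) {h : X → ℝ}
    (hh : ContMDiff 𝓘(ℝ, E) 𝓘(ℝ, ℝ) ∞ h) (he : IsHolChart e) {K : Set X} (hKc : IsCompact K)
    {x₀ : X} (hKe : K ⊆ e.source) (hKf : K ⊆ frameSet L x₀) (hK : ∀ x, x ∉ K → h x = 0) (p : ℕ) :
    ∃ T : DForm E X (2 * p + 1), IsSmoothForm T ∧ (∀ x, x ∉ K → T x = 0) ∧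
      ∀ x, DForm.wedgePow (curvature (ψ.twist h hh)) (p + 1) x =
        DForm.wedgePow (curvature ψ) (p + 1) x + (extD T x : E [⋀^Fin (2 * (p + 1))]→L[ℝ] ℝ) := by
  set w1 : E → ℝ := fun u => (ψ.twist h hh).weight x₀ (e.symm u)
  set w0 : E → ℝ := fun u => ψ.weight x₀ (e.symm u)
  set U : Set E := e.target ∩ e.symm ⁻¹' frameSet L x₀
  have hU : IsOpen U := e.isOpen_inter_preimage_symm (trivializationAt ℂ L x₀).open_baseSet
  have hKU : e '' K ⊆ U := by
    rintro _ ⟨x, hx, rfl⟩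
    refine ⟨e.map_source (hKe hx), ?_⟩
    rw [Set.mem_preimage, e.left_inv (hKe hx)]
    exact hKf hx
  have hKi := isCompact_image_chart hKc hKe
  -- The transgression form is the difference of the primitives for the new and the old weight,
  -- extended by zero off the compact set where the weights may differ.
  set τ : E → E [⋀^Fin (2 * p + 1)]→L[ℝ] ℝ := fun u => primForm p w1 u - primForm p w0 u with hτ
  have hs1 : ∀ u ∈ U, ContDiffAt ℝ ∞ w1 u := fun u hu => by
    have := (ψ.twist h hh).contDiffAt_weight he (e.map_target hu.1) hu.2
    rwa [e.right_inv hu.1] at this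
  have hs0 : ∀ u ∈ U, ContDiffAt ℝ ∞ w0 u := fun u hu => by
    have := ψ.contDiffAt_weight he (e.map_target hu.1) hu.2
    rwa [e.right_inv hu.1] at this
  have hτs : ∀ u ∈ U, ContDiffAt ℝ ∞ τ u := fun u hu =>
    (contDiffAt_primForm p (hs1 u hu)).sub (contDiffAt_primForm p (hs0 u hu))
  have hw : ∀ u ∈ U, u ∉ e '' K → w1 =ᶠ[𝓝 u] w0 := by
    intro u hu hK'
    filter_upwards [hU.mem_nhds hu, hKi.isClosed.isOpen_compl.mem_nhds hK'] with v hv hvK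
    show (ψ.twist h hh).weight x₀ (e.symm v) = ψ.weight x₀ (e.symm v)
    rw [ψ.weight_twist hh hv.2, hK _ fun hk => hvK ⟨_, hk, e.right_inv hv.1⟩, add_zero]
  have hτ0 : ∀ u ∈ U, u ∉ e '' K → τ u = 0 := fun u hu hK' => by
    rw [hτ]
    show primForm p w1 u - primForm p w0 u = 0
    rw [primForm_congr p (hw u hu hK'), sub_self]
  have hσ : ContDiff ℝ ∞ (U.indicator τ) := contDiff_indicator hU hKi hKU
    (fun u hu => (hτs u hu).contDiffWithinAt) hτ0
  have hσ0 : ∀ u, u ∉ e '' K → U.indicator τ u = 0 := fun u hu => indicator_eq_of_compact hτ0 hu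
  have hKt : e '' K ⊆ e.target := image_chart_subset hKe
  have himg : e.symm '' (e '' K) = K := by
    rw [Set.image_image]
    ext x
    constructor
    · rintro ⟨y, hy, rfl⟩
      show e.symm (e y) ∈ K
      rwa [e.left_inv (hKe hy)]
    · intro hx
      exact ⟨x, hx, e.left_inv (hKe hx)⟩
  refine ⟨ofChart e (U.indicator τ), isSmoothForm_ofChart he hKi hKt hσ0 hσ, fun x hx => ?_,
    fun x => ?_⟩
  · exact ofChart_eq_zero_of_image hσ0 x (by rwa [himg])
  · by_cases hx : x ∈ K
    · have hxe := hKe hx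
      have hxU : e x ∈ U := hKU ⟨x, hx, rfl⟩
      have hext : extDeriv (U.indicator τ) (e x) = extDeriv (primForm p w1) (e x) -
          extDeriv (primForm p w0) (e x) := by
        have h1 : U.indicator τ =ᶠ[𝓝 (e x)] τ := by
          filter_upwards [hU.mem_nhds hxU] with v hv
          exact Set.indicator_of_mem hv _
        rw [h1.extDeriv_eq]
        exact extDeriv_form_sub ((contDiffAt_primForm p (hs1 _ hxU)).differentiableAt (by simp))
          ((contDiffAt_primForm p (hs0 _ hxU)).differentiableAt (by simp))
      rw [extD_ofChart he hKi hKt hσ0 hσ, ofChart_of_mem hxe, hext,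
        eq_inChart_comp he hxe (DForm.wedgePow (curvature (ψ.twist h hh)) (p + 1)),
        eq_inChart_comp he hxe (DForm.wedgePow (curvature ψ) (p + 1)),
        inChart_wedgePow_curvature _ he hxe (hKf hx), inChart_wedgePow_curvature _ he hxe (hKf hx)]
      ext v
      exact (add_sub_cancel _ _).symm
    -- Off `K` the two metrics agree near `x`, so the curvatures coincide and the correction
    -- vanishes.
    · have h1 : extD (ofChart e (U.indicator τ)) x = 0 := extD_eq_zero hKc.isClosed
        (fun y hy => ofChart_eq_zero_of_image hσ0 y (by rwa [himg])) x hx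
      rw [h1]
      refine Eq.trans ?_ (add_zero _).symm
      show wedgePow _ _ = wedgePow _ _
      congr 1
      have hc : IsHolChart (chartAt E x) := IsManifold.chart_mem_maximalAtlas x
      have hxc := mem_chart_source E x
      have h0 : x ∈ frameSet L x := FiberBundle.mem_baseSet_trivializationAt' x
      rw [curvature_eq _ h0, curvature_eq _ h0]
      refine iddbar_congr ?_
      filter_upwards [eventually_symm hxc (((trivializationAt ℂ L x).open_baseSet.inter
        hKc.isClosed.isOpen_compl).mem_nhds ⟨h0, hx⟩)] with u hu
      rw [ψ.weight_twist hh hu.2.1, hK _ hu.2.2, add_zero]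

end Transgression

end

/-! ### Products of forms in low degree and the Leibniz rule. -/

section

/-! ### Some algebra of forms -/

section Algebra

variable {E : Type*} [NormedAddCommGroup E] [NormedSpace ℝ E]

theorem wedgePow_smul (c : ℝ) (a : E [⋀^Fin 2]→L[ℝ] ℝ) (p : ℕ) :
    wedgePow (c • a) p = c ^ p • wedgePow a p := by
  ext v
  rw [ContinuousAlternatingMap.smul_apply, wedgePow_apply, wedgePow_apply, smul_eq_mul,
    mul_left_comm]
  congr 1
  rw [Finset.mul_sum]
  refine Finset.sum_congr rfl fun σ _ => ?_
  simp only [ContinuousAlternatingMap.smul_apply, smul_eq_mul, Finset.prod_mul_distrib,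
    Finset.prod_const, Finset.card_univ, Fintype.card_fin]
  ring

theorem wedge_smul_left (c : ℝ) (a b : E [⋀^Fin 2]→L[ℝ] ℝ) :
    wedge (c • a) b = c • wedge a b := by
  ext v
  refine Eq.trans (wedge_two_two_apply _ _ v) ?_
  refine Eq.trans ?_ (congrArg (c * ·) (wedge_two_two_apply a b v)).symm
  simp only [ContinuousAlternatingMap.smul_apply, smul_eq_mul]
  ring

theorem wedge_add_self (a b : E [⋀^Fin 2]→L[ℝ] ℝ) :
    wedge (a + b) (a + b) = wedge a a + (2 : ℝ) • wedge b a + wedge b b := by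
  ext v
  refine Eq.trans (wedge_two_two_apply _ _ v) ?_
  refine Eq.trans ?_ (congrArg₂ (· + ·) (congrArg₂ (· + ·) (wedge_two_two_apply a a v)
    (congrArg ((2 : ℝ) * ·) (wedge_two_two_apply b a v))) (wedge_two_two_apply b b v)).symm
  simp only [ContinuousAlternatingMap.add_apply]
  ring

theorem fderiv_three_products {p₁ q₁ p₂ q₂ p₃ q₃ : E → ℝ} {u : E} (hp₁ : DifferentiableAt ℝ p₁ u)
    (hq₁ : DifferentiableAt ℝ q₁ u) (hp₂ : DifferentiableAt ℝ p₂ u) (hq₂ : DifferentiableAt ℝ q₂ u)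
    (hp₃ : DifferentiableAt ℝ p₃ u) (hq₃ : DifferentiableAt ℝ q₃ u) (d : E) :
    fderiv ℝ (fun x => p₁ x * q₁ x - p₂ x * q₂ x + p₃ x * q₃ x) u d =
      fderiv ℝ p₁ u d * q₁ u + p₁ u * fderiv ℝ q₁ u d
      - (fderiv ℝ p₂ u d * q₂ u + p₂ u * fderiv ℝ q₂ u d)
      + (fderiv ℝ p₃ u d * q₃ u + p₃ u * fderiv ℝ q₃ u d) := by
  rw [fderiv_fun_add (by fun_prop) (by fun_prop), fderiv_fun_sub (by fun_prop) (by fun_prop),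
    fderiv_fun_mul hp₁ hq₁, fderiv_fun_mul hp₂ hq₂, fderiv_fun_mul hp₃ hq₃]
  simp only [add_apply, sub_apply, smul_apply, smul_eq_mul]
  ring

/-- Leibniz rule `d(t ∧ s) = dt ∧ s - t ∧ ds` with the last term zero, checked on the explicit
expansions in these degrees. -/
theorem extDeriv_wedge_one_two [FiniteDimensional ℝ E] {t : E → E [⋀^Fin 1]→L[ℝ] ℝ}
    {s : E → E [⋀^Fin 2]→L[ℝ] ℝ} {u : E} (ht : ContDiffAt ℝ ∞ t u) (hs : ContDiffAt ℝ ∞ s u)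
    (hs0 : extDeriv s u = 0) :
    (extDeriv (fun u => wedge (t u) (s u)) u : E [⋀^Fin 4]→L[ℝ] ℝ) =
      (wedge (extDeriv t u) (s u) : E [⋀^Fin 4]→L[ℝ] ℝ) := by
  have htd := ht.differentiableAt (by simp)
  have hsd := hs.differentiableAt (by simp)
  have ht1 : ∀ a, DifferentiableAt ℝ (fun x => t x ![a]) u := fun a =>
    (ContDiffWithinAt.contDiffAt ((contDiffWithinAt_alternating_iff (s := Set.univ)).1 ht ![a])
      Filter.univ_mem).differentiableAt (by simp)
  have hs1 : ∀ a b, DifferentiableAt ℝ (fun x => s x ![a, b]) u := fun a b =>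
    (ContDiffWithinAt.contDiffAt ((contDiffWithinAt_alternating_iff (s := Set.univ)).1 hs ![a, b])
      Filter.univ_mem).differentiableAt (by simp)
  have hprod : ∀ a b c d : E, fderiv ℝ (fun x => wedge (t x) (s x) ![a, b, c]) u d =
      fderiv ℝ (fun x => t x ![a]) u d * s u ![b, c] + t u ![a] * fderiv ℝ (fun x => s x ![b, c]) u d
      - (fderiv ℝ (fun x => t x ![b]) u d * s u ![a, c]
        + t u ![b] * fderiv ℝ (fun x => s x ![a, c]) u d)
      + (fderiv ℝ (fun x => t x ![c]) u d * s u ![a, b]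
        + t u ![c] * fderiv ℝ (fun x => s x ![a, b]) u d) := by
    intro a b c d
    have h1 : (fun x => wedge (t x) (s x) ![a, b, c]) = fun x =>
        t x ![a] * s x ![b, c] - t x ![b] * s x ![a, c] + t x ![c] * s x ![a, b] := by
      funext x
      exact wedge_one_two_apply _ _ _
    rw [h1]
    exact fderiv_three_products (ht1 a) (hs1 b c) (ht1 b) (hs1 a c) (ht1 c) (hs1 a b) d
  have hwd : DifferentiableAt ℝ (fun x => wedge (t x) (s x)) u :=
    (ContDiffWithinAt.contDiffAt (contDiffWithinAt_wedge (s := Set.univ) ht hs)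
      Filter.univ_mem).differentiableAt (by simp)
  have hds : ∀ a b c : E, fderiv ℝ (fun x => s x ![b, c]) u a - fderiv ℝ (fun x => s x ![a, c]) u b
      + fderiv ℝ (fun x => s x ![a, b]) u c = 0 := by
    intro a b c
    have h1 := congrArg (fun A : E [⋀^Fin 3]→L[ℝ] ℝ => A ![a, b, c]) hs0
    rw [extDeriv_eq_sum hsd, Fin.sum_univ_three] at h1
    have e0 : Fin.removeNth 0 ![a, b, c] = ![b, c] := by ext i; fin_cases i <;> rfl
    have e1 : Fin.removeNth 1 ![a, b, c] = ![a, c] := by ext i; fin_cases i <;> rfl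
    have e2 : Fin.removeNth 2 ![a, b, c] = ![a, b] := by ext i; fin_cases i <;> rfl
    rw [e0, e1, e2] at h1
    simp at h1
    linarith
  have hdt : ∀ a b : E, extDeriv t u ![a, b] = fderiv ℝ (fun x => t x ![b]) u a
      - fderiv ℝ (fun x => t x ![a]) u b := by
    intro a b
    have h1 := extDeriv_eq_sum htd ![a, b]
    rw [Fin.sum_univ_two] at h1
    have e0 : Fin.removeNth 0 ![a, b] = ![b] := by ext i; fin_cases i; rfl
    have e1 : Fin.removeNth 1 ![a, b] = ![a] := by ext i; fin_cases i; rfl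
    rw [e0, e1] at h1
    simp at h1
    linarith
  ext v
  refine Eq.trans (extDeriv_eq_sum (q := 3) hwd v) ?_
  refine Eq.trans ?_ (wedge_two_two_apply _ _ v).symm
  rw [Fin.sum_univ_four]
  have e0 : Fin.removeNth 0 v = ![v 1, v 2, v 3] := by ext i; fin_cases i <;> rfl
  have e1 : Fin.removeNth 1 v = ![v 0, v 2, v 3] := by ext i; fin_cases i <;> rfl
  have e2 : Fin.removeNth 2 v = ![v 0, v 1, v 3] := by ext i; fin_cases i <;> rfl
  have e3 : Fin.removeNth 3 v = ![v 0, v 1, v 2] := by ext i; fin_cases i <;> rfl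
  rw [e0, e1, e2, e3]
  have s0 : ((-1 : ℝ) ^ ((0 : Fin 4) : ℕ)) = 1 := by norm_num
  have s1 : ((-1 : ℝ) ^ ((1 : Fin 4) : ℕ)) = -1 := by norm_num
  have s2 : ((-1 : ℝ) ^ ((2 : Fin 4) : ℕ)) = 1 := by norm_num
  have s3 : ((-1 : ℝ) ^ ((3 : Fin 4) : ℕ)) = -1 := by
    rw [show ((3 : Fin 4) : ℕ) = 3 from rfl]; norm_num
  rw [s0, s1, s2, s3, hprod, hprod, hprod, hprod]
  simp only [hdt]
  -- The terms with undifferentiated `t` are those of `t ∧ ds`, one closedness relation for each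
  -- omitted vector.
  linear_combination (-(t u ![v 0])) * hds (v 1) (v 2) (v 3) + (t u ![v 1]) * hds (v 0) (v 2) (v 3)
    - (t u ![v 2]) * hds (v 0) (v 1) (v 3) + (t u ![v 3]) * hds (v 0) (v 1) (v 2)

end Algebra

end

/-! ### Independence of the S-classes of the metric. -/

section

/-! ### Exterior derivatives of products and casts -/

section ExtD

variable {E : Type*} [NormedAddCommGroup E] [NormedSpace ℂ E] [NormedSpace ℝ E]
  [IsScalarTower ℝ ℂ E] [FiniteDimensional ℝ E] {X : Type*} [TopologicalSpace X]
  [ChartedSpace E X] [IsManifold 𝓘(ℂ, E) ω X]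

theorem extD_cast {k q : ℕ} (h : k = q) (α : DForm E X k) :
    extD (DForm.cast h α) = DForm.cast (congrArg (· + 1) h) (extD α) := by
  subst h
  rfl

theorem isSmoothForm_zero {k : ℕ} : IsSmoothForm (0 : DForm E X k) :=
  isSmoothForm_iff.2 fun _ => smoothFormAt_zero

theorem extD_wedge_one_two {τ : DForm E X 1} {σ : DForm E X 2} (hτ : IsSmoothForm τ)
    (hσ : IsSmoothForm σ) (h0 : ∀ x, extD σ x = 0) (x : X) :
    (extD (DForm.wedge τ σ) x : E [⋀^Fin 4]→L[ℝ] ℝ) =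
      (wedge (extD τ x) (σ x) : E [⋀^Fin 4]→L[ℝ] ℝ) := by
  have h1 : inChart (DForm.wedge τ σ) (chartAt E x) = fun u => wedge (inChart τ (chartAt E x) u)
      (inChart σ (chartAt E x) u) := funext fun u => inChart_wedge σ u
  have h2 : (extD (DForm.wedge τ σ) x : E [⋀^Fin 4]→L[ℝ] ℝ) = (extDeriv (fun u =>
      wedge (inChart τ (chartAt E x) u) (inChart σ (chartAt E x) u)) (chartAt E x x) :
      E [⋀^Fin 4]→L[ℝ] ℝ) := congrArg (fun F => extDeriv F (chartAt E x x)) h1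
  refine h2.trans ((extDeriv_wedge_one_two (isSmoothForm_iff.1 hτ x) (isSmoothForm_iff.1 hσ x)
    (h0 x)).trans ?_)
  rw [inChart_chartAt]
  rfl

end ExtD

/-! ### Dependence of the `S`-forms on the metric -/

section Fibration

variable {m n : ℕ} {X M : Type*} [TopologicalSpace X] [ChartedSpace (CVec m × CVec n) X]
  [TopologicalSpace M] [ChartedSpace (CVec m) M]
  [IsManifold 𝓘(ℂ, CVec m × CVec n) ω X] [IsManifold 𝓘(ℂ, CVec m) ω M]
  [T2Space X] [CompactSpace X] [T2Space M]
  {π : X → M} {k : ℕ}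

theorem fibreIntegral_zero (hP : Nonempty (AdmissiblePartition (m := m) (n := n) π)) :
    fibreIntegral π (0 : DForm (CVec m × CVec n) X (k + 2 * n)) = 0 := by
  have h := fibreIntegral_add (Θ := (0 : DForm (CVec m × CVec n) X (k + 2 * n))) hP
    isSmoothForm_zero isSmoothForm_zero
  rw [add_zero] at h
  exact left_eq_add.1 h

/-- The primitive is the fibre integral of `T`; the statement leaves the degrees as variables so
that the powers `n + i` can be handled together. -/
theorem fibreIntegral_extD_cast (hP : Nonempty (AdmissiblePartition (m := m) (n := n) π))
    (hπ : Continuous π) {q d : ℕ} (hd : k + 1 = d) (hq : q + 1 = d + 2 * n)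
    {T : DForm (CVec m × CVec n) X q} (hT : IsSmoothForm T) :
    ∃ τ : DForm (CVec m) M k, IsSmoothForm τ ∧
      fibreIntegral π (DForm.cast hq (extD T)) = DForm.cast hd (extD τ) := by
  subst hd
  obtain rfl : q = k + 2 * n := by omega
  exact ⟨fibreIntegral π T, isSmoothForm_fibreIntegral hP hπ hT, (extD_fibreIntegral hP hπ hT hq).symm⟩

theorem extD_fibreIntegral_eq_zero (hP : Nonempty (AdmissiblePartition (m := m) (n := n) π))
    (hπ : Continuous π) {Θ : DForm (CVec m × CVec n) X (k + 2 * n)} (hΘ : IsSmoothForm Θ)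
    (h0 : ∀ x, extD Θ x = 0) (y : M) : extD (fibreIntegral π Θ) y = 0 := by
  rw [extD_fibreIntegral hP hπ hΘ (by omega)]
  have h1 : DForm.cast (show k + 2 * n + 1 = k + 1 + 2 * n by omega) (extD Θ) = 0 := by
    funext x
    rw [DForm.cast_apply, h0 x]
    rfl
  rw [h1, fibreIntegral_zero hP]
  rfl

variable {L : X → Type*} [TopologicalSpace (Bundle.TotalSpace ℂ L)] [∀ x, AddCommGroup (L x)]
  [∀ x, Module ℂ (L x)] [∀ x, TopologicalSpace (L x)] [FiberBundle ℂ L] [VectorBundle ℂ ℂ L]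
  [ContMDiffVectorBundle ω ℂ L 𝓘(ℂ, CVec m × CVec n)]

theorem wedgePow_chernForm (φ : HermitianMetric (CVec m × CVec n) L) (p : ℕ) :
    DForm.wedgePow (chernForm φ) p = ((2 * Real.pi)⁻¹ ^ p) • DForm.wedgePow (curvature φ) p :=
  funext fun x => wedgePow_smul _ (curvature φ x) p

theorem isSmoothForm_chernForm (φ : HermitianMetric (CVec m × CVec n) L) :
    IsSmoothForm (chernForm φ) :=
  (isSmoothForm_curvature φ).const_smul (2 * Real.pi)⁻¹

theorem extD_wedgePow_chernForm (φ : HermitianMetric (CVec m × CVec n) L) {p : ℕ} (hp : 1 ≤ p)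
    (x : X) : extD (DForm.wedgePow (chernForm φ) p) x = 0 := by
  obtain ⟨p, rfl⟩ := Nat.exists_eq_add_of_le' hp
  rw [wedgePow_chernForm, extD_const_smul, extD_wedgePow_curvature, smul_zero]

theorem exists_transgression_chernForm (ψ : HermitianMetric (CVec m × CVec n) L) {h : X → ℝ}
    (hh : ContMDiff 𝓘(ℝ, CVec m × CVec n) 𝓘(ℝ, ℝ) ∞ h)
    {e : OpenPartialHomeomorph X (CVec m × CVec n)} (he : IsHolChart e) {K : Set X}
    (hKc : IsCompact K) {x₀ : X} (hKe : K ⊆ e.source) (hKf : K ⊆ frameSet L x₀)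
    (hK : ∀ x, x ∉ K → h x = 0) {p : ℕ} (hp : 1 ≤ p) :
    ∃ (q : ℕ) (hq : q + 1 = 2 * p) (T : DForm (CVec m × CVec n) X q), IsSmoothForm T ∧
      (∀ x, x ∉ K → T x = 0) ∧ DForm.wedgePow (chernForm (ψ.twist h hh)) p =
        DForm.wedgePow (chernForm ψ) p + DForm.cast hq (extD T) := by
  obtain ⟨p, rfl⟩ := Nat.exists_eq_add_of_le' hp
  obtain ⟨T, hT, hT0, hTd⟩ := exists_transgression ψ hh he hKc hKe hKf hK p
  set c : ℝ := (2 * Real.pi)⁻¹ ^ (p + 1) with hc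
  refine ⟨2 * p + 1, rfl, c • T, hT.const_smul c, fun x hx => ?_, ?_⟩
  · rw [DForm.smul_apply, hT0 x hx, smul_zero]
  · funext x
    rw [wedgePow_chernForm, wedgePow_chernForm, ← hc]
    show c • DForm.wedgePow (curvature (ψ.twist h hh)) (p + 1) x = c • DForm.wedgePow (curvature ψ)
      (p + 1) x + (extD (c • T) x : (CVec m × CVec n) [⋀^Fin (2 * (p + 1))]→L[ℝ] ℝ)
    rw [hTd x, extD_const_smul, smul_add]

/-- The integrand of the `S`-forms. -/
def sIntegrand (φ : HermitianMetric (CVec m × CVec n) L) (i : ℕ) :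
    DForm (CVec m × CVec n) X (2 * i + 2 * n) :=
  DForm.cast (show 2 * (n + i) = 2 * i + 2 * n by ring) (DForm.wedgePow (chernForm φ) (n + i))

theorem sForm_eq (φ : HermitianMetric (CVec m × CVec n) L) (i : ℕ) :
    sForm π φ i = fibreIntegral π (sIntegrand φ i) := rfl

theorem isSmoothForm_sIntegrand (φ : HermitianMetric (CVec m × CVec n) L) (i : ℕ) :
    IsSmoothForm (sIntegrand φ i) :=
  ((isSmoothForm_chernForm φ).wedgePow (n + i)).castDegree _

theorem isSmoothForm_sForm (hP : Nonempty (AdmissiblePartition (m := m) (n := n) π))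
    (hπ : Continuous π) (φ : HermitianMetric (CVec m × CVec n) L) (i : ℕ) :
    IsSmoothForm (sForm π φ i) :=
  isSmoothForm_fibreIntegral hP hπ (isSmoothForm_sIntegrand φ i)

theorem extD_sForm (hP : Nonempty (AdmissiblePartition (m := m) (n := n) π))
    (hπ : Continuous π) (hn : 1 ≤ n) (φ : HermitianMetric (CVec m × CVec n) L) (i : ℕ) (y : M) :
    extD (sForm π φ i) y = 0 := by
  refine extD_fibreIntegral_eq_zero hP hπ (isSmoothForm_sIntegrand φ i) (fun x => ?_) y
  -- The condition `1 ≤ n` makes the power `n + i` positive, as the local primitives require.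
  rw [sIntegrand, extD_cast, DForm.cast_apply, extD_wedgePow_chernForm φ (by omega) x]
  rfl

/-- The `S`-forms of two metrics are cohomologous. -/
def Cohomologous (π : X → M) (φ φ' : HermitianMetric (CVec m × CVec n) L) : Prop :=
  sForm π φ' 0 = sForm π φ 0 ∧ ∀ (i k : ℕ) (hk : k + 1 = 2 * i), ∃ τ : DForm (CVec m) M k,
    IsSmoothForm τ ∧ sForm π φ' i = sForm π φ i + DForm.cast hk (extD τ)

theorem Cohomologous.refl (φ : HermitianMetric (CVec m × CVec n) L) : Cohomologous π φ φ := by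
  refine ⟨rfl, fun i k hk => ⟨0, isSmoothForm_zero, ?_⟩⟩
  have h : DForm.cast hk (extD (0 : DForm (CVec m) M k)) = 0 := by
    funext y
    rw [DForm.cast_apply, extD_zero]
    rfl
  rw [h, add_zero]

theorem Cohomologous.trans {φ φ' φ'' : HermitianMetric (CVec m × CVec n) L}
    (h : Cohomologous π φ φ') (h' : Cohomologous π φ' φ'') : Cohomologous π φ φ'' := by
  refine ⟨h'.1.trans h.1, fun i k hk => ?_⟩
  obtain ⟨τ, hτ, h1⟩ := h.2 i k hk
  obtain ⟨τ', hτ', h2⟩ := h'.2 i k hk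
  refine ⟨τ + τ', hτ.add hτ', ?_⟩
  rw [h2, h1, add_assoc]
  congr 1
  funext y
  rw [DForm.cast_apply, extD_add (isSmoothForm_iff.1 hτ y) (isSmoothForm_iff.1 hτ' y)]
  rfl

/-- A twist supported in one admissible chart and one frame changes the integrand by some `dT` with
the same support. Its fibre integral is the derivative of a fibre integral in positive degree, and
zero in degree 0. -/
theorem cohomologous_twist (hP : Nonempty (AdmissiblePartition (m := m) (n := n) π))
    (hπ : Continuous π) (hn : 1 ≤ n) (ψ : HermitianMetric (CVec m × CVec n) L) {h : X → ℝ}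
    (hh : ContMDiff 𝓘(ℝ, CVec m × CVec n) 𝓘(ℝ, ℝ) ∞ h)
    {e : OpenPartialHomeomorph X (CVec m × CVec n)} {f : OpenPartialHomeomorph M (CVec m)}
    (he : IsAdmissible π e f) {K : Set X}
    (hKc : IsCompact K) {x₀ : X} (hKe : K ⊆ e.source) (hKf : K ⊆ frameSet L x₀)
    (hK : ∀ x, x ∉ K → h x = 0) : Cohomologous π ψ (ψ.twist h hh) := by
  have key : ∀ i : ℕ, ∃ (q : ℕ) (hq : q + 1 = 2 * i + 2 * n) (T : DForm (CVec m × CVec n) X q),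
      IsSmoothForm T ∧ (∀ x, x ∉ K → T x = 0) ∧
      sForm π (ψ.twist h hh) i = sForm π ψ i + fibreIntegral π (DForm.cast hq (extD T)) := by
    intro i
    obtain ⟨q, hq, T, hT, hT0, h1⟩ := exists_transgression_chernForm ψ hh he.top_mem hKc hKe hKf hK
      (p := n + i) (by omega)
    have hq' : q + 1 = 2 * i + 2 * n := by omega
    refine ⟨q, hq', T, hT, hT0, ?_⟩
    rw [sForm_eq, sForm_eq, ← fibreIntegral_add hP (isSmoothForm_sIntegrand ψ i)
      (hT.extD.castDegree hq')]
    congr 1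
    rw [sIntegrand, h1]
    rfl
  constructor
  · obtain ⟨q, hq, T, hT, hT0, h1⟩ := key 0
    rw [h1]
    have h2 := fibreIntegral_extD_top hP he hKc hKe hT0 hT hq
    exact (congrArg (sForm π ψ 0 + ·) h2).trans (add_zero _)
  · intro i k hk
    obtain ⟨q, hq, T, hT, -, h1⟩ := key i
    obtain ⟨τ, hτ, h2⟩ := fibreIntegral_extD_cast hP hπ hk hq hT
    exact ⟨τ, hτ, by rw [h1, h2]⟩

/-- The function relating the two metrics is cut by a partition of unity into pieces supported in
one admissible chart and one frame domain. The pieces are added to the weight one at a time. -/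
theorem cohomologous (hπ : IsHolomorphicFibration m n π) (hn : 1 ≤ n)
    (ψ φ : HermitianMetric (CVec m × CVec n) L) : Cohomologous π ψ φ := by
  obtain ⟨u, hu, rfl⟩ := exists_twist φ ψ
  obtain ⟨P, hPU⟩ := exists_admissiblePartition hπ (fun x => frameSet L x)
    (fun x => (trivializationAt ℂ L x).open_baseSet)
    (fun x => FiberBundle.mem_baseSet_trivializationAt' x)
  have hP : Nonempty (AdmissiblePartition (m := m) (n := n) π) := ⟨P⟩
  have hw : ∀ j, ContMDiff 𝓘(ℝ, CVec m × CVec n) 𝓘(ℝ, ℝ) ∞ fun x => P.weight j x * u x :=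
    fun j => (P.weight_smooth j).mul hu
  have key : ∀ (s : Finset (Fin P.size)) (g : X → ℝ) (hg : ContMDiff 𝓘(ℝ, CVec m × CVec n)
      𝓘(ℝ, ℝ) ∞ g), (g = fun x => ∑ j ∈ s, P.weight j x * u x) →
      Cohomologous π ψ (ψ.twist g hg) := by
    intro s
    induction s using Finset.induction_on with
    | empty =>
      intro g hg hgs
      have h1 : ψ.twist g hg = ψ := HermitianMetric.ext' fun x s => by
        show Real.exp (-g x) * ψ.normSq x s = _
        rw [hgs]
        simp
      rw [h1]
      exact Cohomologous.refl ψ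
    | insert a s ha ih =>
      intro g hg hgs
      have hs : ContMDiff 𝓘(ℝ, CVec m × CVec n) 𝓘(ℝ, ℝ) ∞ fun x => ∑ j ∈ s, P.weight j x * u x := by
        intro x
        exact ContMDiffAt.sum fun j _ => hw j x
      have h1 : ψ.twist g hg = (ψ.twist _ hs).twist _ (hw a) := by
        rw [HermitianMetric.twist_twist]
        refine HermitianMetric.ext' fun x v => ?_
        show Real.exp (-g x) * ψ.normSq x v = Real.exp (-(_ + _)) * ψ.normSq x v
        rw [hgs]
        beta_reduce
        rw [Finset.sum_insert ha, add_comm]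
      rw [h1]
      refine (ih _ hs rfl).trans ?_
      obtain ⟨x, hx⟩ := hPU a
      refine cohomologous_twist hP hπ.holomorphic.continuous hn _ (hw a) (P.admissible a)
        (isClosed_tsupport (P.weight a)).isCompact (P.weight_supp a)
        ((P.weight_supp a).trans hx) fun y hy => ?_
      rw [image_eq_zero_of_notMem_tsupport hy, zero_mul]
  refine key Finset.univ u hu (funext fun x => ?_)
  rw [← Finset.sum_mul, P.weight_sum, one_mul]

end Fibration

end

/-! ### The class C_2 and its integral. -/

section

section Classes

variable {m n : ℕ} {X M : Type*} [TopologicalSpace X] [ChartedSpace (CVec m × CVec n) X]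
  [TopologicalSpace M] [ChartedSpace (CVec m) M]
  [IsManifold 𝓘(ℂ, CVec m × CVec n) ω X] [IsManifold 𝓘(ℂ, CVec m) ω M]
  [T2Space X] [CompactSpace X] [T2Space M]
  {π : X → M}
  {L : X → Type*} [TopologicalSpace (Bundle.TotalSpace ℂ L)] [∀ x, AddCommGroup (L x)]
  [∀ x, Module ℂ (L x)] [∀ x, TopologicalSpace (L x)] [FiberBundle ℂ L] [VectorBundle ℂ ℂ L]
  [ContMDiffVectorBundle ω ℂ L 𝓘(ℂ, CVec m × CVec n)]

/-! ### The function `S_0` is constant -/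

/-- In a chart the derivative vanishes, so the function is constant on balls, hence locally constant
on a connected space. -/
theorem eq_of_extD_eq_zero [PreconnectedSpace M] {α : DForm (CVec m) M 0} (hα : IsSmoothForm α)
    (h0 : ∀ y, extD α y = 0) (v : Fin 0 → CVec m) (y y' : M) : α y v = α y' v := by
  refine IsLocallyConstant.apply_eq_of_preconnectedSpace (f := fun y => α y v)
    ((IsLocallyConstant.iff_eventually_eq _).2 fun y => ?_) y y'
  set c := chartAt (CVec m) y
  have hc : IsHolChart c := IsManifold.chart_mem_maximalAtlas y
  have hy : y ∈ c.source := mem_chart_source _ y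
  have hval : ∀ u, inChart α c u v = α (c.symm u) v := fun u => by
    exact congrArg (fun w => (α (c.symm u) : CVec m [⋀^Fin 0]→L[ℝ] ℝ) w) (Subsingleton.elim _ _)
  have hd : ∀ u ∈ c.target, DifferentiableAt ℝ (inChart α c) u := fun u hu =>
    (((hα.contDiffOn_inChart hc).contDiffAt (c.open_target.mem_nhds hu))).differentiableAt (by simp)
  have hdv : ∀ u ∈ c.target, DifferentiableAt ℝ (fun u => inChart α c u v) u := fun u hu =>
    (ContDiffWithinAt.contDiffAt ((contDiffWithinAt_alternating_iff (s := Set.univ)).1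
      ((hα.contDiffOn_inChart hc).contDiffAt (c.open_target.mem_nhds hu)) v)
      Filter.univ_mem).differentiableAt (by simp)
  have hz : ∀ u ∈ c.target, fderiv ℝ (fun u => inChart α c u v) u = 0 := by
    intro u hu
    have h1 := inChart_extD hc (c.map_target hu) (isSmoothForm_iff.1 hα _)
    rw [c.right_inv hu, inChart_eq_zero (h0 _)] at h1
    ext w
    have h2 := congrArg (fun A : CVec m [⋀^Fin 1]→L[ℝ] ℝ => A fun _ => w) h1
    have h3 : extDeriv (inChart α c) u (fun _ => w) = fderiv ℝ (fun u => inChart α c u v) u w := by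
      refine (extDeriv_eq_sum (hd u hu) _).trans ((Fin.sum_univ_one _).trans ?_)
      rw [Subsingleton.elim ((0 : Fin 1).removeNth fun _ => w) v]
      simp
    exact (h3.symm.trans h2.symm)
  obtain ⟨r, hr, hball⟩ := Metric.isOpen_iff.1 c.open_target (c y) (c.map_source hy)
  have h4 : ∀ᶠ x in 𝓝 y, c x ∈ Metric.ball (c y) r :=
    (c.continuousAt hy).eventually (Metric.ball_mem_nhds _ hr)
  filter_upwards [h4, c.open_source.mem_nhds hy] with x hx hxs
  have h5 := Metric.isOpen_ball.is_const_of_fderiv_eq_zero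
    (convex_ball (c y) r).isPreconnected (f := fun u => inChart α c u v)
    (fun u hu => (hdv u (hball hu)).differentiableWithinAt) (fun u hu => hz u (hball hu)) hx
    (Metric.mem_ball_self hr)
  simp only [hval, c.left_inv hxs, c.left_inv hy] at h5
  exact h5

theorem sZero_const [PreconnectedSpace M]
    (hP : Nonempty (AdmissiblePartition (m := m) (n := n) π))
    (hπ : Continuous π) (hn : 1 ≤ n) (φ : HermitianMetric (CVec m × CVec n) L) (y y' : M) :
    sZero π φ y = sZero π φ y' :=
  eq_of_extD_eq_zero (α := sForm π φ 0) (isSmoothForm_sForm hP hπ φ 0)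
    (extD_sForm hP hπ hn φ 0) Fin.elim0 y y'

/-! ### Representatives of the class `C_2` -/

/-- With `S_0` constant the divisions become multiplications by scalars, which commute with `d` and
with the integral. -/
theorem cTwo_eq {φ : HermitianMetric (CVec m × CVec n) L} {c : ℝ} (hc : ∀ y, sZero π φ y = c) :
    cTwo π φ = c⁻¹ ^ 3 • (DForm.wedge (sForm π φ 1) (sForm π φ 1) : DForm (CVec m) M 4)
      + (-c⁻¹ ^ 2) • (sForm π φ 2 : DForm (CVec m) M 4) := by
  funext y
  have h1 : cOne π φ y = (-(c⁻¹ ^ 2)) • sForm π φ 1 y := by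
    unfold cOne cZero
    rw [hc, div_eq_mul_inv, pow_two]
  have h2 : wedge (cOne π φ y) (sForm π φ 1 y) =
      (-(c⁻¹ ^ 2)) • wedge (sForm π φ 1 y) (sForm π φ 1 y) := by
    rw [h1]
    exact wedge_smul_left _ _ _
  show (-(sZero π φ y)⁻¹) • (cZero π φ y • (sForm π φ 2 y : CVec m [⋀^Fin 4]→L[ℝ] ℝ)
      + (wedge (cOne π φ y) (sForm π φ 1 y) : CVec m [⋀^Fin 4]→L[ℝ] ℝ)) =
    c⁻¹ ^ 3 • (wedge (sForm π φ 1 y) (sForm π φ 1 y) : CVec m [⋀^Fin 4]→L[ℝ] ℝ) +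
      (-c⁻¹ ^ 2) • (sForm π φ 2 y : CVec m [⋀^Fin 4]→L[ℝ] ℝ)
  rw [show (wedge (cOne π φ y) (sForm π φ 1 y) : CVec m [⋀^Fin 4]→L[ℝ] ℝ) =
      ((-(c⁻¹ ^ 2)) • wedge (sForm π φ 1 y) (sForm π φ 1 y) : CVec m [⋀^Fin 4]→L[ℝ] ℝ) from h2,
    cZero, hc]
  module

theorem isSmoothForm_cTwo (hP : Nonempty (AdmissiblePartition (m := m) (n := n) π))
    (hπ : Continuous π) {φ : HermitianMetric (CVec m × CVec n) L} {c : ℝ}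
    (hc : ∀ y, sZero π φ y = c) : IsSmoothForm (cTwo π φ) := by
  rw [cTwo_eq hc]
  have h1 := isSmoothForm_sForm hP hπ φ 1
  exact IsSmoothForm.add (IsSmoothForm.const_smul _ (IsSmoothForm.wedge h1 h1))
    (IsSmoothForm.const_smul _ (isSmoothForm_sForm hP hπ φ 2))

/-- For closed `s = S_1`, the square of `s + dτ` is `s ∧ s + d(2 τ ∧ s + τ ∧ dτ)`, and `S_2` changes
by some `dρ`. The same combination of these primitives as in the formula for `C_2` gives the
primitive sought. -/
theorem exists_cTwo_eq_add_extD (hP : Nonempty (AdmissiblePartition (m := m) (n := n) π))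
    (hπ : Continuous π) (hn : 1 ≤ n) {φ φ' : HermitianMetric (CVec m × CVec n) L}
    (h : Cohomologous π φ φ') {c : ℝ} (hc : ∀ y, sZero π φ y = c) :
    ∃ β : DForm (CVec m) M 3, IsSmoothForm β ∧
      cTwo π φ' = cTwo π φ + (extD β : DForm (CVec m) M 4) := by
  have hc' : ∀ y, sZero π φ' y = c := fun y => by
    rw [← hc y]
    unfold sZero
    rw [h.1]
  obtain ⟨τ, hτ, h1⟩ := h.2 1 1 rfl
  obtain ⟨ρ, hρ, h2⟩ := h.2 2 3 rfl
  set s : DForm (CVec m) M 2 := sForm π φ 1 with hs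
  have hss : IsSmoothForm s := isSmoothForm_sForm hP hπ φ 1
  have hsc : ∀ y, extD s y = 0 := extD_sForm hP hπ hn φ 1
  have hb1 : IsSmoothForm (DForm.wedge τ s) := hτ.wedge hss
  have hb2 : IsSmoothForm (DForm.wedge τ (extD τ : DForm (CVec m) M 2)) := hτ.wedge hτ.extD
  have hA : ∀ (A B : DForm (CVec m) M 3) (C : DForm (CVec m) M 3) (a b : ℝ), IsSmoothForm A →
      IsSmoothForm B → IsSmoothForm C → ∀ y, extD (a • ((2 : ℝ) • A + B) + b • C) y =
        a • ((2 : ℝ) • extD A y + extD B y) + b • extD C y := by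
    intro A B C a b ha hb hC y
    have g1 := (isSmoothForm_iff.1 (ha.const_smul (2 : ℝ)) y)
    have g2 := isSmoothForm_iff.1 hb y
    have g3 := isSmoothForm_iff.1 hC y
    rw [extD_add ((g1.add g2).const_smul a) (g3.const_smul b), extD_const_smul, extD_const_smul,
      extD_add g1 g2, extD_const_smul]
  refine ⟨c⁻¹ ^ 3 • ((2 : ℝ) • (DForm.wedge τ s : DForm (CVec m) M 3) +
      (DForm.wedge τ (extD τ : DForm (CVec m) M 2) : DForm (CVec m) M 3)) + (-c⁻¹ ^ 2) • ρ,
    (((hb1.const_smul 2).add hb2).const_smul _).add (hρ.const_smul _), ?_⟩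
  rw [cTwo_eq hc, cTwo_eq hc']
  funext y
  have e1 : sForm π φ' 1 y = s y + extD τ y := by rw [h1]; rfl
  have e2 : (sForm π φ' 2 y : CVec m [⋀^Fin 4]→L[ℝ] ℝ) = sForm π φ 2 y + extD ρ y := by
    rw [h2]; rfl
  have e3 : (wedge (sForm π φ' 1 y) (sForm π φ' 1 y) : CVec m [⋀^Fin 4]→L[ℝ] ℝ) =
      (wedge (s y) (s y) : CVec m [⋀^Fin 4]→L[ℝ] ℝ)
      + (2 : ℝ) • (wedge (extD τ y) (s y) : CVec m [⋀^Fin 4]→L[ℝ] ℝ)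
      + (wedge (extD τ y) (extD τ y) : CVec m [⋀^Fin 4]→L[ℝ] ℝ) := by
    rw [e1]
    exact wedge_add_self _ _
  have e4 := hA (DForm.wedge τ s) (DForm.wedge τ (extD τ : DForm (CVec m) M 2)) ρ (c⁻¹ ^ 3)
    (-c⁻¹ ^ 2) hb1 hb2 hρ y
  have e5 := extD_wedge_one_two hτ hss hsc y
  have e6 := extD_wedge_one_two hτ (σ := extD τ) hτ.extD (extD_extD hτ) y
  show c⁻¹ ^ 3 • (wedge (sForm π φ' 1 y) (sForm π φ' 1 y) : CVec m [⋀^Fin 4]→L[ℝ] ℝ)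
      + (-c⁻¹ ^ 2) • (sForm π φ' 2 y : CVec m [⋀^Fin 4]→L[ℝ] ℝ) =
    c⁻¹ ^ 3 • (wedge (s y) (s y) : CVec m [⋀^Fin 4]→L[ℝ] ℝ)
      + (-c⁻¹ ^ 2) • (sForm π φ 2 y : CVec m [⋀^Fin 4]→L[ℝ] ℝ) + extD _ y
  refine Eq.trans ?_ (congrArg _ e4.symm)
  rw [e3, e2]
  refine Eq.trans ?_ (congrArg₂ (fun P Q : CVec m [⋀^Fin 4]→L[ℝ] ℝ =>
    c⁻¹ ^ 3 • (wedge (s y) (s y) : CVec m [⋀^Fin 4]→L[ℝ] ℝ)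
      + (-c⁻¹ ^ 2) • (sForm π φ 2 y : CVec m [⋀^Fin 4]→L[ℝ] ℝ)
      + (c⁻¹ ^ 3 • ((2 : ℝ) • P + Q) + (-c⁻¹ ^ 2) • extD ρ y)) e5 e6).symm
  module

end Classes

section Integrals

variable {n : ℕ} {X M : Type*} [TopologicalSpace X] [ChartedSpace (CVec 2 × CVec n) X]
  [TopologicalSpace M] [ChartedSpace (CVec 2) M]
  [IsManifold 𝓘(ℂ, CVec 2 × CVec n) ω X] [IsManifold 𝓘(ℂ, CVec 2) ω M]
  [T2Space X] [T2Space M] [CompactSpace M]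
  {π : X → M}
  {L : X → Type*} [TopologicalSpace (Bundle.TotalSpace ℂ L)] [∀ x, AddCommGroup (L x)]
  [∀ x, Module ℂ (L x)] [∀ x, TopologicalSpace (L x)] [FiberBundle ℂ L] [VectorBundle ℂ ℂ L]
  [ContMDiffVectorBundle ω ℂ L 𝓘(ℂ, CVec 2 × CVec n)]

theorem nonempty_admissiblePartition [CompactSpace X] (hπ : IsHolomorphicFibration 2 n π) :
    Nonempty (AdmissiblePartition (m := 2) (n := n) π) :=
  ⟨(exists_admissiblePartition hπ (fun _ => Set.univ) (fun _ => isOpen_univ)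
    fun _ => trivial).choose⟩

theorem integral_add_extD {α : DForm (CVec 2) M 4} (hα : IsSmoothForm α) {β : DForm (CVec 2) M 3}
    (hβ : IsSmoothForm β) :
    integral (d := 2) (α + (extD β : DForm (CVec 2) M 4)) = integral (d := 2) α := by
  have h1 := integral_add (d := 2) nonempty_chartPartition hα
    (IsSmoothForm.castDegree (show 3 + 1 = 2 * 2 from rfl) hβ.extD)
  have h2 := integral_extD (d := 2) nonempty_chartPartition (show 3 + 1 = 2 * 2 from rfl) hβ
  rw [h2, add_zero] at h1
  exact h1

theorem integral_sForm_two [CompactSpace X] (hπ : IsHolomorphicFibration 2 n π) (hn : 1 ≤ n)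
    (φ φ' : HermitianMetric (CVec 2 × CVec n) L) :
    integral (d := 2) (sForm π φ' 2) = integral (d := 2) (sForm π φ 2) := by
  obtain ⟨τ, hτ, h⟩ := (cohomologous hπ hn φ φ').2 2 3 rfl
  rw [h]
  exact integral_add_extD (isSmoothForm_sForm (nonempty_admissiblePartition hπ)
    hπ.holomorphic.continuous φ 2) hτ

/-- A representative differs by an exact form from the C-form of some metric, which differs by
another exact form from that of `φ`; Stokes' formula applies twice. -/
theorem integral_cTwoClass [CompactSpace X] [PreconnectedSpace M]
    (hπ : IsHolomorphicFibration 2 n π) (hn : 1 ≤ n)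
    (φ : HermitianMetric (CVec 2 × CVec n) L) {c : ℝ} (hc : ∀ y, sZero π φ y = c)
    {Γ : DForm (CVec 2) M 4} (hΓ : Γ ∈ cTwoClass (m := 2) (n := n) π L) :
    integral (d := 2) Γ = integral (d := 2) (cTwo π φ) := by
  obtain ⟨φ', β, hβ, h⟩ := hΓ
  have hP := nonempty_admissiblePartition hπ
  have hcont := hπ.holomorphic.continuous
  have hco := cohomologous hπ hn φ φ'
  obtain ⟨γ, hγ, h'⟩ := exists_cTwo_eq_add_extD hP hcont hn hco hc
  have hc' : ∀ y, sZero π φ' y = c := fun y => by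
    rw [← hc y]
    unfold sZero
    rw [hco.1]
  have h1 : Γ = cTwo π φ' + (extD β : DForm (CVec 2) M 4) := funext h
  rw [h1, integral_add_extD (isSmoothForm_cTwo hP hcont hc') hβ, h',
    integral_add_extD (isSmoothForm_cTwo hP hcont hc) hγ]

end Integrals

end

section

open MeasureTheory

/-! ### The `S`-forms as moments of the geodesic curvature -/

section Moments

variable {m n : ℕ} {X M : Type*} [TopologicalSpace X] [ChartedSpace (CVec m × CVec n) X]
  [TopologicalSpace M] [ChartedSpace (CVec m) M]
  [IsManifold 𝓘(ℂ, CVec m × CVec n) ω X] [IsManifold 𝓘(ℂ, CVec m) ω M]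
  {π : X → M}
  {L : X → Type*} [TopologicalSpace (Bundle.TotalSpace ℂ L)] [∀ x, AddCommGroup (L x)]
  [∀ x, Module ℂ (L x)] [∀ x, TopologicalSpace (L x)] [FiberBundle ℂ L] [VectorBundle ℂ ℂ L]
  [ContMDiffVectorBundle ω ℂ L 𝓘(ℂ, CVec m × CVec n)]
  {e : OpenPartialHomeomorph X (CVec m × CVec n)} {f : OpenPartialHomeomorph M (CVec m)}
  {φ : HermitianMetric (CVec m × CVec n) L}

/-- The horizontal part of the Chern form at the point of an admissible chart with coordinates
`u`, as a form on the tangent space of the base at `y`. -/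
def chernHorizontal (φ : HermitianMetric (CVec m × CVec n) L)
    (e : OpenPartialHomeomorph X (CVec m × CVec n)) (f : OpenPartialHomeomorph M (CVec m)) (y : M)
    (u : CVec m × CVec n) : CVec m [⋀^Fin 2]→L[ℝ] ℝ :=
  ((2 * Real.pi)⁻¹ • horizontalForm (inChart (curvature φ) e u)).compContinuousLinearMap
    (trD (chartAt (CVec m) y) f y)

/-- Of the `n + i` factors `1/2π` of the Chern form, `n` go to the density and `i` to the horizontal
form, so the density remains independent of `i`. -/
theorem exists_density (hφ : IsFibrewisePositive π φ) (h : IsAdmissible π e f) {u : CVec m × CVec n}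
    (hu : u ∈ e.target) : ∃ D : ℝ, 0 < D ∧ ∀ (i : ℕ) (w : Fin (2 * i) → CVec m),
      inChart (sIntegrand φ i) e u (fibreTuple w) = ((n + i).factorial / i.factorial : ℝ) * D *
        wedgePow ((2 * Real.pi)⁻¹ • horizontalForm (inChart (curvature φ) e u)) i w := by
  have ha := inChart_curvature_typeOneOne φ h.top_mem hu
  obtain ⟨D, hD, hDw⟩ := exists_density_contract_wedgePow ha fun v hv => by
    have := inChart_curvature_vertical_pos hφ h (e.map_target hu) hv
    rwa [e.right_inv hu] at this
  refine ⟨(2 * Real.pi)⁻¹ ^ n * D, by positivity, fun i w => ?_⟩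
  have h1 : inChart (sIntegrand φ i) e u = (2 * Real.pi)⁻¹ ^ (n + i) •
      castDegree (show 2 * (n + i) = 2 * i + 2 * n by ring)
        (wedgePow (inChart (curvature φ) e u) (n + i)) := by
    rw [sIntegrand, inChart_castDegree, inChart_wedgePow]
    have h2 : inChart (chernForm φ) e u = (2 * Real.pi)⁻¹ • inChart (curvature φ) e u := rfl
    rw [h2, wedgePow_smul]
    rfl
  have h3 := hDw i (n + i) (show 2 * (n + i) = 2 * i + 2 * n by ring) w
  rw [h1, ← contractFibre_apply, contractFibre_smul, wedgePow_smul,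
    ContinuousAlternatingMap.smul_apply, ContinuousAlternatingMap.smul_apply]
  refine (congrArg ((2 * Real.pi)⁻¹ ^ (n + i) • ·) h3).trans ?_
  simp only [smul_eq_mul]
  ring

variable [T2Space X] [CompactSpace X] [T2Space M]

/-- The `S`-forms at a point of the base are the moments of the horizontal part of the Chern form,
for one measure on the fibre. -/
theorem exists_moments (hP : Nonempty (AdmissiblePartition (m := m) (n := n) π))
    (hs : Function.Surjective π) (hφ : IsFibrewisePositive π φ) (y : M) :
    ∃ (N : ℕ) (A : Fin N → CVec n → ℝ) (C : Fin N → CVec n → CVec m [⋀^Fin 2]→L[ℝ] ℝ),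
      (∀ j v, 0 ≤ A j v) ∧
      (∀ j v, A j v ≠ 0 → ∃ (e : OpenPartialHomeomorph X (CVec m × CVec n))
        (f : OpenPartialHomeomorph M (CVec m)), IsAdmissible π e f ∧ ∃ x ∈ e.source, π x = y ∧
          C j v = chernHorizontal φ e f y (e x)) ∧
      (∀ i j w, Integrable fun v => A j v * wedgePow (C j v) i w) ∧
      (∀ i w, sForm π φ i y w = ((n + i).factorial / i.factorial : ℝ) *
        ∑ j, ∫ v, A j v * wedgePow (C j v) i w) ∧
      ∃ j, 0 < ∫ v, A j v := by
  classical
  obtain ⟨P, hPf⟩ := exists_fibreIntegral_eq hP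
  have hD : ∀ (j : Fin P.size) (v : CVec n), ∃ D : ℝ, 0 < D ∧
      ((P.base j y, v) ∈ (P.chart j).target → ∀ (i : ℕ) (w : Fin (2 * i) → CVec m),
        inChart (sIntegrand φ i) (P.chart j) (P.base j y, v) (fibreTuple w) =
          ((n + i).factorial / i.factorial : ℝ) * D * wedgePow ((2 * Real.pi)⁻¹ •
            horizontalForm (inChart (curvature φ) (P.chart j) (P.base j y, v))) i w) := by
    intro j v
    -- Off the chart the density plays no role; the value 1 only keeps it positive.
    by_cases hv : (P.base j y, v) ∈ (P.chart j).target
    · obtain ⟨D, hD, h1⟩ := exists_density hφ (P.admissible j) hv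
      exact ⟨D, hD, fun _ => h1⟩
    · exact ⟨1, one_pos, fun h => absurd h hv⟩
  choose D hD0 hDw using hD
  -- The fibre measure is the partition weight times the density, in each chart that meets the fibre
  -- over `y`.
  set A : Fin P.size → CVec n → ℝ := fun j v =>
    if y ∈ (P.base j).source ∧ (P.base j y, v) ∈ (P.chart j).target then
      P.weight j ((P.chart j).symm (P.base j y, v)) * D j v else 0 with hA
  set C : Fin P.size → CVec n → CVec m [⋀^Fin 2]→L[ℝ] ℝ := fun j v =>
    chernHorizontal φ (P.chart j) (P.base j) y (P.base j y, v) with hC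
  have hA0 : ∀ j v, 0 ≤ A j v := by
    intro j v
    simp only [hA]
    split_ifs
    · exact mul_nonneg (P.weight_nonneg j _) (hD0 j v).le
    · exact le_rfl
  have hKc : ∀ j, IsCompact (tsupport (P.weight j)) := fun j => (isClosed_tsupport _).isCompact
  have hK0 : ∀ i j x, x ∉ tsupport (P.weight j) →
      DForm.mul (P.weight j) (sIntegrand φ i) x = 0 := fun i j =>
    weight_smul_eq_zero P.toChartPartition (sIntegrand φ i) j
  have hsm : ∀ i j, ContDiff ℝ ∞ (extForm (DForm.mul (P.weight j) (sIntegrand φ i)) (P.chart j)) :=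
    fun i j => contDiff_extForm (P.admissible j).top_mem (hKc j) (P.weight_supp j) (hK0 i j)
      ((isSmoothForm_sIntegrand φ i).smul (P.weight_smooth j))
  have hcs : ∀ i j, HasCompactSupport
      (extForm (DForm.mul (P.weight j) (sIntegrand φ i)) (P.chart j)) :=
    fun i j => hasCompactSupport_extForm (hKc j) (P.weight_supp j) (hK0 i j)
  have hval : ∀ i j w v, y ∈ (P.base j).source →
      extForm (DForm.mul (P.weight j) (sIntegrand φ i)) (P.chart j) (P.base j y, v)
        (fibreTuple fun l => trD (chartAt (CVec m) y) (P.base j) y (w l)) =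
      ((n + i).factorial / i.factorial : ℝ) * (A j v * wedgePow (C j v) i w) := by
    intro i j w v hy
    by_cases hv : (P.base j y, v) ∈ (P.chart j).target
    · rw [extForm_of_mem hv, inChart_smul, ContinuousAlternatingMap.smul_apply, hDw j v hv i]
      simp only [hA, hC]
      rw [if_pos ⟨hy, hv⟩, chernHorizontal, ← wedgePow_comp,
        ContinuousAlternatingMap.compContinuousLinearMap_apply, smul_eq_mul]
      simp only [Function.comp_def]
      ring
    · rw [extForm_of_notMem hv]
      simp only [hA]
      rw [if_neg fun h => hv h.2, zero_mul, mul_zero]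
      rfl
  have hcoef : ∀ i : ℕ, ((n + i).factorial / i.factorial : ℝ) ≠ 0 := fun i =>
    (div_pos (Nat.cast_pos.2 (Nat.factorial_pos _)) (Nat.cast_pos.2 (Nat.factorial_pos _))).ne'
  have hAn : ∀ j v, y ∉ (P.base j).source → A j v = 0 := fun j v hy => if_neg fun h => hy h.1
  have hslice : ∀ i j w, y ∈ (P.base j).source → (fun v => A j v * wedgePow (C j v) i w) =
      fun v => ((n + i).factorial / i.factorial : ℝ)⁻¹ *
        extForm (DForm.mul (P.weight j) (sIntegrand φ i)) (P.chart j) (P.base j y, v)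
          (fibreTuple fun l => trD (chartAt (CVec m) y) (P.base j) y (w l)) := by
    intro i j w hy
    funext v
    rw [hval i j w v hy, inv_mul_cancel_left₀ (hcoef i)]
  have hint : ∀ i j w, Integrable fun v => A j v * wedgePow (C j v) i w := by
    intro i j w
    by_cases hy : y ∈ (P.base j).source
    · rw [hslice i j w hy]
      exact (integrable_slice (contDiff_eval (hsm i j) _).continuous
        (hasCompactSupport_eval (hcs i j) _) _).const_mul _
    · simp only [hAn j _ hy, zero_mul]
      exact integrable_zero _ _ _
  refine ⟨P.size, A, C, hA0, fun j v hv => ?_, hint, fun i w => ?_, ?_⟩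
  · have h1 : y ∈ (P.base j).source ∧ (P.base j y, v) ∈ (P.chart j).target := by
      by_contra h
      exact hv (if_neg h)
    refine ⟨P.chart j, P.base j, P.admissible j, _, (P.chart j).map_target h1.2,
      (P.admissible j).proj_symm h1.1 h1.2, ?_⟩
    rw [(P.chart j).right_inv h1.2]
  · rw [sForm_eq, hPf, DForm.sum_apply, ContinuousAlternatingMap.sum_apply, Finset.mul_sum]
    refine Finset.sum_congr rfl fun j _ => ?_
    unfold chartFib
    by_cases hy : y ∈ (P.base j).source
    · rw [ofChart_of_mem hy, ContinuousAlternatingMap.compContinuousLinearMap_apply,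
        fibreInt_apply (hsm i j) (hcs i j), ← integral_const_mul]
      exact integral_congr_ae (Filter.Eventually.of_forall fun v => hval i j w v hy)
    · rw [ofChart_of_notMem hy]
      simp [hAn j _ hy]
  · obtain ⟨x, rfl⟩ := hs y
    have hex : ∃ j, 0 < P.weight j x := by
      by_contra! hne
      have h1 := P.weight_sum x
      rw [Finset.sum_eq_zero fun j _ => le_antisymm (hne j) (P.weight_nonneg j x)] at h1
      exact zero_ne_one h1
    obtain ⟨j, hj⟩ := hex
    have hx : x ∈ (P.chart j).source := P.weight_supp j (subset_tsupport _ hj.ne')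
    have hy := (P.admissible j).maps x hx
    have hpr := (P.admissible j).proj x hx
    refine ⟨j, ?_⟩
    -- The zeroth wedge power is 1, so `A j` is the integrand of the zeroth moment and inherits its
    -- continuity and integrability.
    have h0 : A j = fun v => A j v * wedgePow (C j v) 0 Fin.elim0 := by
      funext v
      exact (mul_one _).symm
    have hcont : Continuous (A j) := by
      rw [h0, hslice 0 j _ hy]
      exact continuous_const.mul ((contDiff_eval (hsm 0 j) _).continuous.comp (by fun_prop))
    have hi : Integrable (A j) := by
      rw [h0]
      exact hint 0 j _
    refine (integral_pos_iff_support_of_nonneg (fun v => hA0 j v) hi).2 ?_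
    -- The open support of `A j` contains the fibre coordinate of a point `x` where the weight is
    -- positive, so it has positive measure.
    refine IsOpen.measure_pos _ hcont.isOpen_support ⟨((P.chart j) x).2, ?_⟩
    have hpt : (P.base j (π x), ((P.chart j) x).2) = P.chart j x := by rw [hpr]
    show A j _ ≠ 0
    simp only [hA]
    rw [hpt, if_pos ⟨hy, (P.chart j).map_source hx⟩, (P.chart j).left_inv hx]
    exact (mul_pos hj (hD0 j _)).ne'

end Moments

end

/-! ### The reversed Cauchy-Schwarz inequality and the lower bound for C_2. -/

section

open MeasureTheory

/-! ### The variance inequality for the moments -/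

section Variance

/-- Written as a combination of six values of `a` with coefficients from `b`, so that integrals in
`a` pass through the pairing. -/
theorem pairing_apply (a b : CVec 2 [⋀^Fin 2]→L[ℝ] ℝ) : pairing a b =
    b ![realBasis 2 2, realBasis 2 3] * a ![realBasis 2 0, realBasis 2 1]
    - b ![realBasis 2 1, realBasis 2 3] * a ![realBasis 2 0, realBasis 2 2]
    + b ![realBasis 2 1, realBasis 2 2] * a ![realBasis 2 0, realBasis 2 3]
    + b ![realBasis 2 0, realBasis 2 3] * a ![realBasis 2 1, realBasis 2 2]
    - b ![realBasis 2 0, realBasis 2 2] * a ![realBasis 2 1, realBasis 2 3]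
    + b ![realBasis 2 0, realBasis 2 1] * a ![realBasis 2 2, realBasis 2 3] := by
  refine (wedge_two_two_apply a b (realBasis 2)).trans ?_
  ring

theorem pairing_comm (a b : CVec 2 [⋀^Fin 2]→L[ℝ] ℝ) : pairing a b = pairing b a := by
  rw [pairing_apply, pairing_apply]
  ring

theorem pairing_smul_left (c : ℝ) (a b : CVec 2 [⋀^Fin 2]→L[ℝ] ℝ) :
    pairing (c • a) b = c * pairing a b := by
  rw [pairing_apply, pairing_apply]
  simp only [ContinuousAlternatingMap.smul_apply, smul_eq_mul]
  ring

theorem pairing_sub_left (a a' b : CVec 2 [⋀^Fin 2]→L[ℝ] ℝ) :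
    pairing (a - a') b = pairing a b - pairing a' b := by
  rw [pairing_apply, pairing_apply, pairing_apply]
  simp only [ContinuousAlternatingMap.sub_apply]
  ring

theorem pairing_comp (a b : CVec 2 [⋀^Fin 2]→L[ℝ] ℝ) (T : CVec 2 →L[ℝ] CVec 2) :
    pairing (a.compContinuousLinearMap T) (b.compContinuousLinearMap T) =
      T.det * pairing a b := by
  unfold pairing
  rw [← wedge_comp]
  exact alternating_map_realBasis (d := 2) (wedge a b).toAlternatingMap T.toLinearMap

variable {Ω : Type*} [MeasurableSpace Ω] {μ : Measure Ω} {N : ℕ} {A : Fin N → Ω → ℝ}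
  {C : Fin N → Ω → CVec 2 [⋀^Fin 2]→L[ℝ] ℝ} {S : CVec 2 [⋀^Fin 2]→L[ℝ] ℝ}

theorem integral_three {p q r : Ω → ℝ} (hp : Integrable p μ) (hq : Integrable q μ)
    (hr : Integrable r μ) (a b c : ℝ) : Integrable (fun v => a * p v - b * q v + c * r v) μ ∧
      ∫ v, (a * p v - b * q v + c * r v) ∂μ =
        a * ∫ v, p v ∂μ - b * ∫ v, q v ∂μ + c * ∫ v, r v ∂μ := by
  have h1 : Integrable (fun v => a * p v - b * q v) μ := (hp.const_mul a).sub (hq.const_mul b)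
  refine ⟨h1.add (hr.const_mul c), ?_⟩
  rw [MeasureTheory.integral_add h1 (hr.const_mul c), integral_sub (hp.const_mul a) (hq.const_mul b),
    integral_const_mul, integral_const_mul, integral_const_mul]

theorem integrable_pairing (hint : ∀ j x y, Integrable (fun v => A j v * C j v ![x, y]) μ)
    (b : CVec 2 [⋀^Fin 2]→L[ℝ] ℝ) (j : Fin N) :
    Integrable (fun v => A j v * pairing (C j v) b) μ := by
  have h : (fun v => A j v * pairing (C j v) b) = fun v =>
      b ![realBasis 2 2, realBasis 2 3] * (A j v * C j v ![realBasis 2 0, realBasis 2 1])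
      - b ![realBasis 2 1, realBasis 2 3] * (A j v * C j v ![realBasis 2 0, realBasis 2 2])
      + b ![realBasis 2 1, realBasis 2 2] * (A j v * C j v ![realBasis 2 0, realBasis 2 3])
      + b ![realBasis 2 0, realBasis 2 3] * (A j v * C j v ![realBasis 2 1, realBasis 2 2])
      - b ![realBasis 2 0, realBasis 2 2] * (A j v * C j v ![realBasis 2 1, realBasis 2 3])
      + b ![realBasis 2 0, realBasis 2 1] * (A j v * C j v ![realBasis 2 2, realBasis 2 3]) := by
    funext v
    rw [pairing_apply]
    ring
  rw [h]
  exact ((((((hint j _ _).const_mul _).sub ((hint j _ _).const_mul _)).add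
    ((hint j _ _).const_mul _)).add ((hint j _ _).const_mul _)).sub ((hint j _ _).const_mul _)).add
    ((hint j _ _).const_mul _)

theorem pairing_moment (hint : ∀ j x y, Integrable (fun v => A j v * C j v ![x, y]) μ)
    (hS : ∀ x y, S ![x, y] = ∑ j, ∫ v, A j v * C j v ![x, y] ∂μ)
    (b : CVec 2 [⋀^Fin 2]→L[ℝ] ℝ) :
    pairing S b = ∑ j, ∫ v, A j v * pairing (C j v) b ∂μ := by
  have h : ∀ j, ∫ v, A j v * pairing (C j v) b ∂μ =
      b ![realBasis 2 2, realBasis 2 3] * ∫ v, A j v * C j v ![realBasis 2 0, realBasis 2 1] ∂μ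
      - b ![realBasis 2 1, realBasis 2 3] * ∫ v, A j v * C j v ![realBasis 2 0, realBasis 2 2] ∂μ
      + b ![realBasis 2 1, realBasis 2 2] * ∫ v, A j v * C j v ![realBasis 2 0, realBasis 2 3] ∂μ
      + b ![realBasis 2 0, realBasis 2 3] * ∫ v, A j v * C j v ![realBasis 2 1, realBasis 2 2] ∂μ
      - b ![realBasis 2 0, realBasis 2 2] * ∫ v, A j v * C j v ![realBasis 2 1, realBasis 2 3] ∂μ
      + b ![realBasis 2 0, realBasis 2 1] * ∫ v, A j v * C j v ![realBasis 2 2, realBasis 2 3] ∂μ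
        := by
    intro j
    have h1 := integral_three (hint j (realBasis 2 0) (realBasis 2 1))
      (hint j (realBasis 2 0) (realBasis 2 2)) (hint j (realBasis 2 0) (realBasis 2 3))
      (b ![realBasis 2 2, realBasis 2 3]) (b ![realBasis 2 1, realBasis 2 3])
      (b ![realBasis 2 1, realBasis 2 2])
    have h2 := integral_three (hint j (realBasis 2 1) (realBasis 2 2))
      (hint j (realBasis 2 1) (realBasis 2 3)) (hint j (realBasis 2 2) (realBasis 2 3))
      (b ![realBasis 2 0, realBasis 2 3]) (b ![realBasis 2 0, realBasis 2 2])
      (b ![realBasis 2 0, realBasis 2 1])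
    have h3 := MeasureTheory.integral_add h1.1 h2.1
    rw [h1.2, h2.2] at h3
    refine Eq.trans (integral_congr_ae (Filter.Eventually.of_forall fun v => ?_)) (h3.trans ?_)
    · beta_reduce
      rw [pairing_apply]
      ring
    · ring
  simp only [h, Finset.sum_add_distrib, Finset.sum_sub_distrib, ← Finset.mul_sum, ← hS]
  exact pairing_apply S b

/-- The variance of a family of `(1,1)`-forms with the same trace is nonpositive. -/
theorem mass_mul_moment_le {b : CVec 2 [⋀^Fin 2]→L[ℝ] ℝ} (hb : IsTypeOneOne b)
    (hpos : ∀ v : CVec 2, v ≠ 0 → 0 < b ![v, Complex.I • v]) {r : ℝ}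
    (hA : ∀ j v, 0 ≤ A j v)
    (hC : ∀ j v, A j v ≠ 0 → IsTypeOneOne (C j v) ∧ pairing (C j v) b = r)
    (hint0 : ∀ j, Integrable (A j) μ)
    (hint : ∀ j x y, Integrable (fun v => A j v * C j v ![x, y]) μ)
    (hint2 : ∀ j, Integrable (fun v => A j v * pairing (C j v) (C j v)) μ)
    (hS : ∀ x y, S ![x, y] = ∑ j, ∫ v, A j v * C j v ![x, y] ∂μ)
    (hmass : 0 < ∑ j, ∫ v, A j v ∂μ) :
    (∑ j, ∫ v, A j v ∂μ) * ∑ j, ∫ v, A j v * pairing (C j v) (C j v) ∂μ ≤ pairing S S := by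
  set a := ∑ j, ∫ v, A j v ∂μ with ha
  set t := ∑ j, ∫ v, A j v * pairing (C j v) (C j v) ∂μ with ht
  have hS1 : IsTypeOneOne S := by
    intro x y
    rw [hS, hS]
    refine Finset.sum_congr rfl fun j _ => integral_congr_ae (Filter.Eventually.of_forall fun v => ?_)
    by_cases hv : A j v = 0
    · simp [hv]
    · simp only [(hC j v hv).1 x y]
  have hSb : pairing S b = a * r := by
    rw [pairing_moment hint hS, ha, Finset.sum_mul]
    refine Finset.sum_congr rfl fun j _ => ?_
    rw [← integral_mul_const]
    refine integral_congr_ae (Filter.Eventually.of_forall fun v => ?_)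
    by_cases hv : A j v = 0
    · simp [hv]
    · simp only [(hC j v hv).2]
  -- Where the measure does not vanish, `a C - S` pairs with `b` to `a r - a r = 0`. The bracket is
  -- its square, hence nonpositive.
  have hpt : ∀ j v, A j v * (a ^ 2 * pairing (C j v) (C j v) - 2 * a * pairing (C j v) S
      + pairing S S) ≤ 0 := by
    intro j v
    by_cases hv : A j v = 0
    · simp [hv]
    · obtain ⟨h1, h2⟩ := hC j v hv
      have h3 : IsTypeOneOne (a • C j v - S) := fun x y => by
        simp only [ContinuousAlternatingMap.sub_apply, ContinuousAlternatingMap.smul_apply]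
        rw [h1 x y, hS1 x y]
      have h4 := pairing_self_nonpos h3 hb hpos (by
        rw [pairing_sub_left, pairing_smul_left, h2, hSb, sub_self])
      rw [pairing_sub_left, pairing_smul_left, pairing_comm (C j v), pairing_comm S,
        pairing_sub_left, pairing_sub_left, pairing_smul_left, pairing_smul_left,
        pairing_comm S (C j v)] at h4
      refine mul_nonpos_of_nonneg_of_nonpos (hA j v) ?_
      linarith
  have hi1 := integrable_pairing hint S
  have hsum : ∑ j, ∫ v, A j v * (a ^ 2 * pairing (C j v) (C j v) - 2 * a * pairing (C j v) S
      + pairing S S) ∂μ = a ^ 2 * t - 2 * a * pairing S S + a * pairing S S := by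
    have h1 : ∀ j, ∫ v, A j v * (a ^ 2 * pairing (C j v) (C j v) - 2 * a * pairing (C j v) S
        + pairing S S) ∂μ = a ^ 2 * (∫ v, A j v * pairing (C j v) (C j v) ∂μ)
          - 2 * a * (∫ v, A j v * pairing (C j v) S ∂μ) + (∫ v, A j v ∂μ) * pairing S S := by
      intro j
      have h2 := (integral_three (hint2 j) (hi1 j) (hint0 j) (a ^ 2) (2 * a) (pairing S S)).2
      refine Eq.trans (integral_congr_ae (Filter.Eventually.of_forall fun v => ?_)) (h2.trans ?_)
      · beta_reduce
        ring
      · ring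
    simp only [h1, Finset.sum_add_distrib, Finset.sum_sub_distrib, ← Finset.mul_sum,
      ← Finset.sum_mul]
    rw [← pairing_moment hint hS S]
  -- The integrated inequality reads `a² t ≤ a (S ∧ S)`, and one factor of the positive mass `a` is
  -- cancelled.
  have hle : a ^ 2 * t - 2 * a * pairing S S + a * pairing S S ≤ 0 := by
    rw [← hsum]
    exact Finset.sum_nonpos fun j _ => integral_nonpos fun v => hpt j v
  have h5 : a * (a * t) ≤ a * pairing S S := by linarith
  exact le_of_mul_le_mul_left h5 hmass

end Variance

section Pointwise

variable {n : ℕ} {X M : Type*} [TopologicalSpace X] [ChartedSpace (CVec 2 × CVec n) X]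
  [TopologicalSpace M] [ChartedSpace (CVec 2) M]
  [IsManifold 𝓘(ℂ, CVec 2 × CVec n) ω X] [IsManifold 𝓘(ℂ, CVec 2) ω M]
  {π : X → M}
  {L : X → Type*} [TopologicalSpace (Bundle.TotalSpace ℂ L)] [∀ x, AddCommGroup (L x)]
  [∀ x, Module ℂ (L x)] [∀ x, TopologicalSpace (L x)] [FiberBundle ℂ L] [VectorBundle ℂ ℂ L]
  [ContMDiffVectorBundle ω ℂ L 𝓘(ℂ, CVec 2 × CVec n)]
  {e : OpenPartialHomeomorph X (CVec 2 × CVec n)} {f : OpenPartialHomeomorph M (CVec 2)}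
  {φ : HermitianMetric (CVec 2 × CVec n) L} {x : X}

theorem chernHorizontal_typeOneOne (h : IsAdmissible π e f) (hx : x ∈ e.source) :
    IsTypeOneOne (chernHorizontal φ e f (π x) (e x)) := by
  have h1 := horizontalForm_typeOneOne
    (inChart_curvature_typeOneOne φ h.top_mem (e.map_source hx))
  refine IsTypeOneOne.comp (fun u v => ?_) _ (trD_I (IsManifold.chart_mem_maximalAtlas _) h.base_mem
    (mem_chart_source _ (π x)) (h.maps x hx))
  rw [ContinuousAlternatingMap.smul_apply, ContinuousAlternatingMap.smul_apply, h1 u v]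

theorem chernHorizontal_pos (hφ : ∀ x (v : CVec 2 × CVec n), v ≠ 0 →
    0 < curvature φ x ![v, Complex.I • v]) (h : IsAdmissible π e f) (hx : x ∈ e.source)
    {w : CVec 2} (hw : w ≠ 0) :
    0 < chernHorizontal φ e f (π x) (e x) ![w, Complex.I • w] := by
  have hc : IsHolChart (chartAt (CVec 2) (π x)) := IsManifold.chart_mem_maximalAtlas _
  have hy := mem_chart_source (CVec 2) (π x)
  have hTw : trD (chartAt (CVec 2) (π x)) f (π x) w ≠ 0 := fun h0 => hw (by
    rw [← trD_trD hc h.base_mem hy (h.maps x hx) w, h0, map_zero])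
  have h1 := horizontalForm_pos (fun v hv => inChart_pos h.top_mem hφ hx (v := v) hv) _ hTw
  rw [chernHorizontal, two_form_comp_apply, trD_I hc h.base_mem hy (h.maps x hx),
    ContinuousAlternatingMap.smul_apply, smul_eq_mul]
  exact mul_pos (by positivity) h1

/-- The trace equation becomes a pairing in coordinates, and the passage to the tangent space at `π
x` multiplies both pairings by the same determinant. The right-hand side depends only on `π x`, so
the pairing is constant along the fibre, as the variance argument requires. -/
theorem pairing_chernHorizontal {η : DForm (CVec 2) M 2} (hη : IsKahlerForm η) {lam : ℝ}
    (hφ : IsFibrewisePositive π φ) (h : IsAdmissible π e f) (hx : x ∈ e.source)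
    (hlam : ((baseMatrix η f (f (π x)))⁻¹ * geodesicCurvature φ e (e x)).trace = (lam : ℂ)) :
    pairing (chernHorizontal φ e f (π x) (e x)) (η (π x)) =
      (2 * Real.pi)⁻¹ * (lam / 2 * pairing (η (π x)) (η (π x))) := by
  have hc : IsHolChart (chartAt (CVec 2) (π x)) := IsManifold.chart_mem_maximalAtlas _
  have hy := mem_chart_source (CVec 2) (π x)
  have hyf := h.maps x hx
  have ha := inChart_curvature_typeOneOne φ h.top_mem (e.map_source hx)
  have hdet := det_fibreMatrix_ne_zero ha fun v hv => inChart_curvature_vertical_pos hφ h hx hv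
  have hb : IsTypeOneOne (inChart η f (f (π x))) := by
    rw [inChart_apply h.base_mem hyf]
    exact IsTypeOneOne.comp (hη.type_one_one (π x)) _ (trD_I h.base_mem hc hyf hy)
  have hbpos : ∀ v : CVec 2, v ≠ 0 → 0 < inChart η f (f (π x)) ![v, Complex.I • v] :=
    fun v hv => inChart_pos h.base_mem hη.positive hyf hv
  have hsch : (Matrix.of fun α β : Fin 2 => hermCoeff (horizontalForm (inChart (curvature φ) e (e x)))
      (Pi.single α 1) (Pi.single β 1)) = geodesicCurvature φ e (e x) := by
    ext α β
    exact hermCoeff_horizontalForm_single ha hdet α β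
  have h1 := pairing_of_trace (horizontalForm_typeOneOne ha) hb hbpos lam (by
    rw [hsch]
    exact hlam)
  rw [eq_inChart_comp h.base_mem hyf η, chernHorizontal, pairing_comp, pairing_comp,
    pairing_smul_left, h1]
  ring

variable [T2Space X] [CompactSpace X] [T2Space M]

theorem wedgePow_two_realBasis (a : CVec 2 [⋀^Fin 2]→L[ℝ] ℝ) :
    wedgePow a 2 (realBasis 2) = pairing a a := by
  rw [wedgePow_two]
  rfl

/-- `S_0` is `n!` times the mass of the fibre measure. -/
theorem sZero_pos (hP : Nonempty (AdmissiblePartition (m := 2) (n := n) π))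
    (hs : Function.Surjective π) (hφ : IsFibrewisePositive π φ) (y : M) : 0 < sZero π φ y := by
  obtain ⟨N, A, C, hA, -, -, hmom, j, hj⟩ := exists_moments hP hs hφ y
  have h1 : ∀ j, ∫ v, A j v * wedgePow (C j v) 0 Fin.elim0 = ∫ v, A j v := fun j =>
    integral_congr_ae (Filter.Eventually.of_forall fun v => mul_one (A j v))
  unfold sZero
  rw [hmom 0]
  simp only [h1]
  refine mul_pos (by positivity) (Finset.sum_pos' (fun i _ => MeasureTheory.integral_nonneg (hA i))
    ⟨j, Finset.mem_univ j, hj⟩)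

/-- A positive curvature form has positive horizontal parts, whose squares are positive. This is
applied to the metric provided by ampleness. -/
theorem sForm_two_pos (hP : Nonempty (AdmissiblePartition (m := 2) (n := n) π))
    (hs : Function.Surjective π) (hφ : ∀ x (v : CVec 2 × CVec n), v ≠ 0 →
      0 < curvature φ x ![v, Complex.I • v]) (y : M) : 0 < sForm π φ 2 y (realBasis 2) := by
  obtain ⟨N, A, C, hA, hAC, hint, hmom, j, hj⟩ := exists_moments hP hs
    (fun x v hv _ => hφ x v hv) y
  have hC : ∀ j v, A j v ≠ 0 → 0 < wedgePow (C j v) 2 (realBasis 2) := by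
    intro j v hv
    obtain ⟨e, f, h, x, hx, rfl, hCx⟩ := hAC j v hv
    rw [wedgePow_two_realBasis, hCx]
    exact pairing_self_pos (chernHorizontal_typeOneOne h hx) fun w hw =>
      chernHorizontal_pos hφ h hx hw
  have h0 : ∀ j v, 0 ≤ A j v * wedgePow (C j v) 2 (realBasis 2) := by
    intro j v
    by_cases hv : A j v = 0
    · simp [hv]
    · exact mul_nonneg (hA j v) (hC j v hv).le
  rw [hmom 2]
  refine mul_pos (by positivity) (Finset.sum_pos' (fun i _ => MeasureTheory.integral_nonneg (h0 i))
    ⟨j, Finset.mem_univ j, ?_⟩)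
  rw [integral_pos_iff_support_of_nonneg (h0 j) (hint 2 j _)]
  have hi : Integrable (A j) := by
    have := hint 0 j Fin.elim0
    refine this.congr (Filter.Eventually.of_forall fun v => mul_one (A j v))
  rw [integral_pos_iff_support_of_nonneg (hA j) hi] at hj
  -- The integrand of the second moment is nonzero wherever `A j` is, so its support also has
  -- positive measure.
  refine hj.trans_le (measure_mono fun v hv => ?_)
  exact mul_ne_zero hv (hC j v hv).ne'

/-- The pointwise inequality between the `S`-forms of a geodesic-Einstein metric. -/
theorem sZero_mul_sForm_two_le (hP : Nonempty (AdmissiblePartition (m := 2) (n := n) π))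
    (hs : Function.Surjective π) {η : DForm (CVec 2) M 2} (hη : IsKahlerForm η)
    (hφ : IsGeodesicEinstein π η φ) (y : M) :
    2 * (n + 1) / (n + 2) * (sZero π φ y * sForm π φ 2 y (realBasis 2)) ≤
      pairing (sForm π φ 1 y) (sForm π φ 1 y) := by
  obtain ⟨hpos, lam, hlam⟩ := hφ
  obtain ⟨N, A, C, hA, hAC, hint, hmom, j, hj⟩ := exists_moments hP hs hpos y
  have hfac : ∀ k : ℕ, (0 : ℝ) < k.factorial := fun k => Nat.cast_pos.2 (Nat.factorial_pos k)
  have h1 : ∀ j, ∫ v, A j v * wedgePow (C j v) 0 Fin.elim0 = ∫ v, A j v := fun j =>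
    integral_congr_ae (Filter.Eventually.of_forall fun v => mul_one (A j v))
  have hi : ∀ j, Integrable (A j) := fun j =>
    (hint 0 j Fin.elim0).congr (Filter.Eventually.of_forall fun v => mul_one (A j v))
  have hmass : 0 < ∑ j, ∫ v, A j v :=
    Finset.sum_pos' (fun i _ => MeasureTheory.integral_nonneg (hA i)) ⟨j, Finset.mem_univ j, hj⟩
  -- The coefficients `(n+i)!/i!` of the moments are `n!`, `(n+1)!` and `(n+2)!/2` for `i = 0, 1,
  -- 2`.
  have hs0 : sZero π φ y = n.factorial * ∑ j, ∫ v, A j v := by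
    unfold sZero
    rw [hmom 0]
    simp only [h1]
    simp
  have hs2 : sForm π φ 2 y (realBasis 2) = (n + 2).factorial / 2 *
      ∑ j, ∫ v, A j v * pairing (C j v) (C j v) := by
    rw [hmom 2]
    simp only [wedgePow_two_realBasis]
    norm_num
  have hs1 : ∀ x z, sForm π φ 1 y ![x, z] = (n + 1).factorial * ∑ j, ∫ v, A j v * C j v ![x, z] := by
    intro x z
    rw [hmom 1]
    simp only [wedgePow_one_apply]
    norm_num
  have hint1 : ∀ j x z, Integrable fun v => A j v * C j v ![x, z] := by
    intro j x z
    have := hint 1 j ![x, z]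
    simp only [wedgePow_one_apply] at this
    exact this
  have hint2 : ∀ j, Integrable fun v => A j v * pairing (C j v) (C j v) := by
    intro j
    have := hint 2 j (realBasis 2)
    simp only [wedgePow_two_realBasis] at this
    exact this
  set S : CVec 2 [⋀^Fin 2]→L[ℝ] ℝ :=
    ((n + 1).factorial : ℝ)⁻¹ • (sForm π φ 1 y : CVec 2 [⋀^Fin 2]→L[ℝ] ℝ) with hSdef
  have hS : ∀ x z, S ![x, z] = ∑ j, ∫ v, A j v * C j v ![x, z] := by
    intro x z
    rw [hSdef, ContinuousAlternatingMap.smul_apply, smul_eq_mul]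
    rw [show (sForm π φ 1 y : CVec 2 [⋀^Fin 2]→L[ℝ] ℝ) ![x, z] = _ from hs1 x z,
      inv_mul_cancel_left₀ (hfac _).ne']
  have hvar := mass_mul_moment_le (hη.type_one_one y) (hη.positive y)
    (r := (2 * Real.pi)⁻¹ * (lam / 2 * pairing (η y) (η y))) hA (fun j v hv => ?_) hi hint1 hint2 hS
    hmass
  · have hpS : pairing (sForm π φ 1 y) (sForm π φ 1 y) =
        ((n + 1).factorial : ℝ) ^ 2 * pairing S S := by
      have h0 : ∀ (r : ℝ) (a : CVec 2 [⋀^Fin 2]→L[ℝ] ℝ), r ≠ 0 →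
          pairing a a = r ^ 2 * pairing (r⁻¹ • a) (r⁻¹ • a) := by
        intro r a hr
        rw [pairing_smul_left, pairing_comm a (r⁻¹ • a), pairing_smul_left]
        field_simp
      exact h0 _ _ (hfac (n + 1)).ne'
    rw [hpS, hs0, hs2]
    have h2 : ((n + 2).factorial : ℝ) = (n + 2) * (n + 1).factorial := by
      rw [Nat.factorial_succ]
      push_cast
      ring
    have h3 : ((n + 1).factorial : ℝ) = (n + 1) * n.factorial := by
      rw [Nat.factorial_succ]
      push_cast
      ring
    calc _ = ((n + 1).factorial : ℝ) ^ 2 * ((∑ j, ∫ v, A j v) *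
          ∑ j, ∫ v, A j v * pairing (C j v) (C j v)) := by
          -- The constant comes from `(n+1)!² = 2(n+1)/(n+2) · n! · (n+2)!/2`.
          rw [h2, h3]
          field_simp
      _ ≤ _ := mul_le_mul_of_nonneg_left hvar (by positivity)
  · obtain ⟨e, f, h, x, hx, rfl, hCx⟩ := hAC j v hv
    rw [hCx]
    exact ⟨chernHorizontal_typeOneOne h hx,
      pairing_chernHorizontal hη hpos h hx (hlam e f h x hx)⟩

/-- The `C`-form of a geodesic-Einstein metric is bounded below by a multiple of `S_2`. -/
theorem cTwo_ge (hP : Nonempty (AdmissiblePartition (m := 2) (n := n) π))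
    (hs : Function.Surjective π) {η : DForm (CVec 2) M 2} (hη : IsKahlerForm η)
    (hφ : IsGeodesicEinstein π η φ) {c : ℝ} (hc : ∀ y, sZero π φ y = c) (y : M) :
    n / (n + 2) * c⁻¹ ^ 2 * sForm π φ 2 y (realBasis 2) ≤ cTwo π φ y (realBasis 2) := by
  have h1 := sZero_mul_sForm_two_le hP hs hη hφ y
  have hc0 : 0 < c := hc y ▸ sZero_pos hP hs hφ.1 y
  rw [hc] at h1
  have h2 : cTwo π φ y (realBasis 2) = c⁻¹ ^ 3 * pairing (sForm π φ 1 y) (sForm π φ 1 y)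
      + (-c⁻¹ ^ 2) * sForm π φ 2 y (realBasis 2) :=
    congrArg (fun α : DForm (CVec 2) M 4 => (α y : CVec 2 [⋀^Fin 4]→L[ℝ] ℝ) (realBasis 2)) (cTwo_eq hc)
  rw [h2]
  have h3 := mul_le_mul_of_nonneg_left h1 (show 0 ≤ c⁻¹ ^ 3 by positivity)
  -- Since `2(n+1)/(n+2) = 1 + n/(n+2)`, subtraction of `S_0 S_2` leaves a positive multiple of
  -- `S_2`.
  have h4 : c⁻¹ ^ 3 * (2 * (n + 1) / (n + 2) * (c * sForm π φ 2 y (realBasis 2))) =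
      n / (n + 2) * c⁻¹ ^ 2 * sForm π φ 2 y (realBasis 2)
        + c⁻¹ ^ 2 * sForm π φ 2 y (realBasis 2) := by
    field_simp
    ring
  linarith

end Pointwise

end

end

end GeodesicEinstein
-- Positivity of the integral of C_2(L).
theorem corollary4p5 {n : ℕ} (hn : 1 ≤ n)
    {M : Type*} [TopologicalSpace M] [T2Space M] [CompactSpace M] [ConnectedSpace M]
    [ChartedSpace (GeodesicEinstein.CVec 2) M]
    [IsManifold 𝓘(ℂ, GeodesicEinstein.CVec 2) ω M]
    {X : Type*} [TopologicalSpace X] [T2Space X]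
    [ChartedSpace (GeodesicEinstein.CVec 2 × GeodesicEinstein.CVec n) X]
    [IsManifold 𝓘(ℂ, GeodesicEinstein.CVec 2 × GeodesicEinstein.CVec n) ω X]
    (π : X → M) (hπ : GeodesicEinstein.IsHolomorphicFibration 2 n π)
    (L : X → Type*) [TopologicalSpace (Bundle.TotalSpace ℂ L)]
    [∀ x, AddCommGroup (L x)] [∀ x, Module ℂ (L x)] [∀ x, TopologicalSpace (L x)]
    [FiberBundle ℂ L] [VectorBundle ℂ ℂ L]
    [ContMDiffVectorBundle ω ℂ L 𝓘(ℂ, GeodesicEinstein.CVec 2 × GeodesicEinstein.CVec n)]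
    (hample : GeodesicEinstein.IsAmple (GeodesicEinstein.CVec 2 × GeodesicEinstein.CVec n) L)
    (η : GeodesicEinstein.DForm (GeodesicEinstein.CVec 2) M 2)
    (hη : GeodesicEinstein.IsKahlerForm η)
    (hGE : ∃ φ : GeodesicEinstein.HermitianMetric
        (GeodesicEinstein.CVec 2 × GeodesicEinstein.CVec n) L,
      GeodesicEinstein.IsGeodesicEinstein π η φ) :
    ∃ c : ℝ, 0 < c ∧
      ∀ Γ ∈ GeodesicEinstein.cTwoClass (m := 2) (n := n) π L,
        GeodesicEinstein.integral (d := 2) Γ = c := by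
  have := GeodesicEinstein.compactSpace_total hπ
  obtain ⟨ψ, hψ⟩ := hample
  obtain ⟨φ, hφ⟩ := hGE
  have hP := GeodesicEinstein.nonempty_admissiblePartition hπ
  have hcont := hπ.holomorphic.continuous
  have hM := GeodesicEinstein.nonempty_chartPartition (E := GeodesicEinstein.CVec 2) (X := M)
  obtain ⟨y₀⟩ := (inferInstance : Nonempty M)
  have hc : ∀ y, GeodesicEinstein.sZero π φ y = GeodesicEinstein.sZero π φ y₀ := fun y =>
    GeodesicEinstein.sZero_const hP hcont hn φ y y₀
  have hc0 := GeodesicEinstein.sZero_pos hP hπ.surjective hφ.1 y₀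
  -- The common value is the integral of the C-form of the geodesic-Einstein metric `φ`.
  refine ⟨_, ?_, fun Γ hΓ => GeodesicEinstein.integral_cTwoClass hπ hn φ hc hΓ⟩
  set c := GeodesicEinstein.sZero π φ y₀
  set κ : ℝ := n / (n + 2) * c⁻¹ ^ 2
  have hκ : 0 < κ := mul_pos (div_pos (Nat.cast_pos.2 hn) (by positivity)) (by positivity)
  -- The integral of `S_2` is computed with the metric `ψ` of positive curvature, for which the form
  -- is positive at every point.
  have hS2 : 0 < GeodesicEinstein.integral (d := 2) (GeodesicEinstein.sForm π φ 2) := by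
    rw [GeodesicEinstein.integral_sForm_two hπ hn ψ φ]
    exact GeodesicEinstein.integral_pos hM (GeodesicEinstein.isSmoothForm_sForm hP hcont ψ 2)
      (GeodesicEinstein.sForm_two_pos hP hπ.surjective hψ)
  have h1 := GeodesicEinstein.integral_add (d := 2) hM
    (GeodesicEinstein.isSmoothForm_cTwo hP hcont hc)
    ((GeodesicEinstein.isSmoothForm_sForm hP hcont φ 2).const_smul (-κ))
  have h2 := GeodesicEinstein.integral_const_smul (d := 2) hM (-κ)
    (α := GeodesicEinstein.sForm π φ 2)
  have h3 : 0 ≤ GeodesicEinstein.integral (d := 2)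
      (GeodesicEinstein.cTwo π φ + (-κ) • GeodesicEinstein.sForm π φ 2) := by
    refine GeodesicEinstein.integral_nonneg hM fun y => ?_
    have h4 := GeodesicEinstein.cTwo_ge hP hπ.surjective hη hφ hc y
    have h5 : (GeodesicEinstein.cTwo π φ + (-κ) • GeodesicEinstein.sForm π φ 2 :
        GeodesicEinstein.DForm (GeodesicEinstein.CVec 2) M (2 * 2)) y
        (GeodesicEinstein.realBasis 2) = GeodesicEinstein.cTwo π φ y (GeodesicEinstein.realBasis 2)
          + (-κ) * GeodesicEinstein.sForm π φ 2 y (GeodesicEinstein.realBasis 2) := rfl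
    rw [h5]
    linarith
  rw [h1, h2] at h3
  -- The integral of `C_2` is at least `κ` times that of `S_2`, and `κ > 0` because `n ≥ 1`.
  nlinarith [mul_pos hκ hS2]
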